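/- Let $m,q\in\mathbb R$ with $0<|q|<m$, and let $(M,g_0,E_0)$ be the canonical slice of the Reissner–Nordström spacetime of mass $m$ and charge $q$: with $s\ge r_+:=m+\sqrt{m^2-q^2}$ the area radius, $$g_0=\Bigl(1-\frac{2m}{s}+\frac{q^2}{s^2}\Bigr)^{-1}ds^2+s^2d\omega^2,\qquad E_0=\frac{q}{s^2}\,n,$$ where $n$ is the outward unit normal of the spheres; equivalently, in isotropic coordinates $M=\{x\in\mathbb R^3:|x|\ge\tfrac12\sqrt{m^2-q^2}\}$, $s=|x|+m+\frac{m^2-q^2}{4|x|}$, $g_0=(s/|x|)^2\delta$, $E_0=(q/s^3)\,x$. Let $r_+<r_1<r_2$, $k\in\mathbb N$ and $\varepsilon>0$. Then there are a smooth Riemannian metric $g$ and a smooth vector field $E$ on $M$, with $B=0$, such that: 1. $g$ and $E$ are spherically symmetric, coincide with $g_0$ and $E_0$ outside the annulus $\{r_1<s<r_2\}$, and in the isotropic coordinates all derivatives of order at most $k$ of the components of $g-g_0$ and of $E-E_0$ are smaller than $\varepsilon$ on $M$; 2. the perturbation is nontrivial: $(M,g)$ is not isometric to the canonical slice of any Reissner–Nordström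 spacetime with parameters $|q'|<m'$; 3. $(M,g,E,B)$ satisfies all hypotheses of the charged Riemannian Penrose inequality with compactly supported charges: it is strongly asymptotically flat ($g-\delta=O(|x|^{-1})$ and $E,B=O(|x|^{-2})$, with corresponding decay of the first two derivatives, and integrable scalar curvature $R$); $\partial M$ is an outermost minimal surface (it is minimal, and $M$ contains no other compact minimal surface), of area $4\pi\rho^2$ with $\rho>0$; the ADM mass is $m$; the total charge $\sqrt{q_E^2+q_B^2}$ is $|q|$, where $4\pi q_E$ and $4\pi q_B$ are the limits of the fluxes of $E$ and $B$ through large spheres; the charged dominant energy condition $R\ge 2(|E|_g^2+|B|_g^2)$ holds; and $\operatorname{div}_gE$ and $\operatorname{div}_gB$ are compactly supported; 4. $|q|\le\rho$ and $m=\frac12\bigl(\rho+\frac{q^2}{\rho}\bigr)$. Hence the rigidity statement for the equality case fails once charges are allowed outside the horizon. -/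

import Mathlib

open Filter Topology MeasureTheory
open scoped ContDiff

noncomputable section

namespace Penrose

/-- Euclidean three-space, the global coordinate chart of the initial data sets below. -/
abbrev E3 : Type := EuclideanSpace ℝ (Fin 3)

/-- Partial derivative in the `i`-th coordinate direction. -/
def pd {n : ℕ} (i : Fin n) (f : EuclideanSpace ℝ (Fin n) → ℝ)
    (x : EuclideanSpace ℝ (Fin n)) : ℝ :=
  fderiv ℝ f x (EuclideanSpace.single i 1)

/-! ### Riemannian geometry in the chart

A metric is given by its coefficient matrix `g x i j`; vector fields by their components. -/

/-- A field of (symmetric) coefficient matrices. -/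
abbrev MetricField : Type := E3 → Matrix (Fin 3) (Fin 3) ℝ

/-- The product `g_x(v, w)`. -/
def gInner (g : MetricField) (x v w : E3) : ℝ :=
  ∑ i, ∑ j, g x i j * v i * w j

/-- The Christoffel symbol `Γ^k_{ij}`. -/
def christoffel (g : MetricField) (k i j : Fin 3) (x : E3) : ℝ :=
  (1 / 2) * ∑ l, (g x)⁻¹ k l *
    (pd i (fun y => g y j l) x + pd j (fun y => g y i l) x - pd l (fun y => g y i j) x)

/-- The Ricci curvature
`R_{ij} = ∂_k Γ^k_{ij} - ∂_j Γ^k_{ik} + Γ^k_{kl} Γ^l_{ij} - Γ^k_{jl} Γ^l_{ik}`. -/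
def ricci (g : MetricField) (i j : Fin 3) (x : E3) : ℝ :=
  (∑ k, (pd k (christoffel g k i j) x - pd j (christoffel g k i k) x)) +
    ∑ k, ∑ l, (christoffel g k k l x * christoffel g l i j x -
      christoffel g k j l x * christoffel g l i k x)

/-- The scalar curvature `g^{ij} R_{ij}`. -/
def scalarCurvature (g : MetricField) (x : E3) : ℝ :=
  ∑ i, ∑ j, (g x)⁻¹ i j * ricci g i j x

/-- The Riemannian volume density `√(det g)`. -/
def volumeDensity (g : MetricField) (x : E3) : ℝ :=
  Real.sqrt (g x).det

/-- The divergence `(1/√(det g)) ∂_i (√(det g) X^i)` of a vector field. -/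
def divergence (g : MetricField) (X : E3 → E3) (x : E3) : ℝ :=
  (∑ i, pd i (fun y => volumeDensity g y * X y i) x) / volumeDensity g x

/-! ### Coordinate spheres -/

/-- `g^{ij} ν_i ν_j` for the Euclidean unit conormal `ν = d|x|` of the sphere through `x`. -/
def conormalSq (g : MetricField) (x : E3) : ℝ :=
  ∑ i, ∑ j, (g x)⁻¹ i j * (x i / ‖x‖) * (x j / ‖x‖)

/-- The outward `g`-unit normal `n^i = g^{ij} ν_j / |ν|_g` of the coordinate sphere through `x`. -/
def sphereNormal (g : MetricField) (x : E3) : E3 :=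
  WithLp.toLp 2 fun i => (∑ j, (g x)⁻¹ i j * (x j / ‖x‖)) / Real.sqrt (conormalSq g x)

/-- The density of the `g`-area element of the coordinate sphere through `x` with respect to its
Euclidean area element, `√(det g) |ν|_g`. -/
def sphereAreaDensity (g : MetricField) (x : E3) : ℝ :=
  volumeDensity g x * Real.sqrt (conormalSq g x)

/-- Euclidean surface integral of `f` over the coordinate sphere `|x| = r`. -/
def sphereIntegral (r : ℝ) (f : E3 → ℝ) : ℝ :=
  r ^ 2 * ∫ w : Metric.sphere (0 : E3) 1, f (r • (w : E3)) ∂((volume : Measure E3).toSphere)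

/-- The `g`-area of the coordinate sphere `|x| = r`. -/
def sphereArea (g : MetricField) (r : ℝ) : ℝ :=
  sphereIntegral r (sphereAreaDensity g)

/-- The charge `(1/4π) ∫ g(X, n) dA` of the vector field `X` in the coordinate sphere `|x| = r`. -/
def sphereCharge (g : MetricField) (X : E3 → E3) (r : ℝ) : ℝ :=
  1 / (4 * Real.pi) *
    sphereIntegral r (fun x => gInner g x (X x) (sphereNormal g x) * sphereAreaDensity g x)

/-! ### Minimal surfaces -/

/-- The `k`-th component of the covariant derivative `D_a ∂_b X` along a parametrized surface `X`. -/
def surfaceHessian (g : MetricField) (X : EuclideanSpace ℝ (Fin 2) → E3) (a b : Fin 2)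
    (v : EuclideanSpace ℝ (Fin 2)) : E3 :=
  WithLp.toLp 2 fun k => pd a (pd b (fun u => X u k)) v +
    ∑ i, ∑ j, christoffel g k i j (X v) * pd a (fun u => X u i) v * pd b (fun u => X u j) v

/-- The coordinate tangent vector `∂_a X`. -/
def surfaceTangent (X : EuclideanSpace ℝ (Fin 2) → E3) (a : Fin 2)
    (v : EuclideanSpace ℝ (Fin 2)) : E3 :=
  WithLp.toLp 2 fun i => pd a (fun u => X u i) v

/-- The first fundamental form of a parametrized surface. -/
def firstFundamentalForm (g : MetricField) (X : EuclideanSpace ℝ (Fin 2) → E3)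
    (v : EuclideanSpace ℝ (Fin 2)) : Matrix (Fin 2) (Fin 2) ℝ :=
  Matrix.of fun a b => gInner g (X v) (surfaceTangent X a v) (surfaceTangent X b v)

/-- A smooth immersion `X` of an open set `V` of the plane with vanishing mean curvature: the
trace of `D_a ∂_b X` over the surface has no component in a normal direction. -/
structure IsMinimalPatch (g : MetricField) (V : Set (EuclideanSpace ℝ (Fin 2)))
    (X : EuclideanSpace ℝ (Fin 2) → E3) : Prop where
  isOpen : IsOpen V
  smooth : ContDiffOn ℝ ∞ X V
  immersion : ∀ v ∈ V, Function.Injective (fderiv ℝ X v)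
  meanCurvature_eq_zero : ∀ v ∈ V, ∀ N : E3,
    (∀ a, gInner g (X v) (surfaceTangent X a v) N = 0) →
      ∑ a, ∑ b, (firstFundamentalForm g X v)⁻¹ a b *
        gInner g (X v) (surfaceHessian g X a b v) N = 0

/-- Compact, possibly immersed minimal surfaces: through every point passes a minimal patch. -/
def IsCompactMinimalSurface (g : MetricField) (S : Set E3) : Prop :=
  IsCompact S ∧ ∀ p ∈ S, ∃ V X, IsMinimalPatch g V X ∧ p ∈ X '' V ∧ X '' V ⊆ S

/-- Compact embedded minimal surfaces: the patches are homeomorphisms onto relatively open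
subsets of the surface. -/
def IsCompactEmbeddedMinimalSurface (g : MetricField) (S : Set E3) : Prop :=
  IsCompact S ∧ ∀ p ∈ S, ∃ V X, IsMinimalPatch g V X ∧
    ∃ U : Set E3, IsOpen U ∧ p ∈ U ∧ X '' V = S ∩ U ∧
      ∃ Y : E3 → EuclideanSpace ℝ (Fin 2), ContinuousOn Y (S ∩ U) ∧ ∀ v ∈ V, Y (X v) = v

/-! ### Initial data sets -/

/-- The manifold with boundary `{|x| ≥ a}`. -/
def exterior (a : ℝ) : Set E3 := {x | a ≤ ‖x‖}

/-- The fields of a time-symmetric Einstein-Maxwell initial data set; they matter only on the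
manifold on which the data set is considered. -/
structure InitialData where
  metric : MetricField
  electric : E3 → E3
  magnetic : E3 → E3

namespace InitialData

/-- Metric and vector fields are smooth on `{|x| ≥ a}` up to and including the boundary, and the
metric is symmetric and positive definite there. -/
structure IsRegular (D : InitialData) (a : ℝ) : Prop where
  smooth_metric : ∀ x ∈ exterior a, ∀ i j, ContDiffAt ℝ ∞ (fun y => D.metric y i j) x
  smooth_electric : ∀ x ∈ exterior a, ContDiffAt ℝ ∞ D.electric x
  smooth_magnetic : ∀ x ∈ exterior a, ContDiffAt ℝ ∞ D.magnetic x
  posDef : ∀ x ∈ exterior a, (D.metric x).PosDef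

/-- `f` and its partial derivatives up to second order decay: `∂^l f = O(|x|^{-p-l})`, `l ≤ 2`. -/
def DecaysTwo (p : ℕ) (f : E3 → ℝ) : Prop :=
  ∃ C R : ℝ, 0 < R ∧ ∀ x : E3, R ≤ ‖x‖ →
    |f x| ≤ C / ‖x‖ ^ p ∧ (∀ k, |pd k f x| ≤ C / ‖x‖ ^ (p + 1)) ∧
      ∀ k l, |pd k (pd l f) x| ≤ C / ‖x‖ ^ (p + 2)

/-- Strong asymptotic flatness: `g - δ = O₂(|x|⁻¹)`, `E, B = O₂(|x|⁻²)`, and the scalar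
curvature is integrable. -/
structure IsStronglyAsymptoticallyFlat (D : InitialData) (a : ℝ) : Prop where
  metric_decay : ∀ i j,
    DecaysTwo 1 (fun x => D.metric x i j - (1 : Matrix (Fin 3) (Fin 3) ℝ) i j)
  electric_decay : ∀ i, DecaysTwo 2 (fun x => D.electric x i)
  magnetic_decay : ∀ i, DecaysTwo 2 (fun x => D.magnetic x i)
  integrable_scalarCurvature :
    IntegrableOn (fun x => scalarCurvature D.metric x * volumeDensity D.metric x) (exterior a)

/-- `m` is the ADM mass `lim (1/16π) ∫_{|x| = r} (∂_j g_{ij} - ∂_i g_{jj}) ν^i dA`. -/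
def HasADMMass (D : InitialData) (m : ℝ) : Prop :=
  Tendsto (fun r : ℝ => 1 / (16 * Real.pi) * sphereIntegral r (fun x =>
      ∑ i, ∑ j, (pd j (fun y => D.metric y i j) x - pd i (fun y => D.metric y j j) x) *
        (x i / ‖x‖)))
    atTop (𝓝 m)

/-- `Q = √(q_E² + q_B²)` is the total charge, with `q_E`, `q_B` the total electric and magnetic
charges, that is, the limits of the charges in large spheres. -/
def HasTotalCharge (D : InitialData) (Q : ℝ) : Prop :=
  ∃ qE qB : ℝ, Tendsto (sphereCharge D.metric D.electric) atTop (𝓝 qE) ∧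
    Tendsto (sphereCharge D.metric D.magnetic) atTop (𝓝 qB) ∧
    Q = Real.sqrt (qE ^ 2 + qB ^ 2)

/-- The charged dominant energy condition `R ≥ 2 (|E|² + |B|²)` on `{|x| ≥ a}`. -/
def ChargedDominantEnergyCondition (D : InitialData) (a : ℝ) : Prop :=
  ∀ x ∈ exterior a,
    2 * (gInner D.metric x (D.electric x) (D.electric x) +
      gInner D.metric x (D.magnetic x) (D.magnetic x)) ≤ scalarCurvature D.metric x

/-- The boundary of `{|x| ≥ a}` is a compact embedded minimal surface, and the only one: every
compact minimal surface in `{|x| ≥ a}`, even if it is merely immersed, lies in the boundary. -/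
def HasOutermostMinimalBoundary (D : InitialData) (a : ℝ) : Prop :=
  IsCompactEmbeddedMinimalSurface D.metric (Metric.sphere 0 a) ∧
    ∀ S : Set E3, S ⊆ exterior a → IsCompactMinimalSurface D.metric S → S ⊆ Metric.sphere 0 a

/-- The vector field `X` has compactly supported divergence on `{|x| ≥ a}`. -/
def HasCompactlySupportedDivergence (g : MetricField) (X : E3 → E3) (a : ℝ) : Prop :=
  ∃ K : Set E3, IsCompact K ∧ ∀ x ∈ exterior a, x ∉ K → divergence g X x = 0

/-- The data set `D` on the manifold `{|x| ≥ a}` is strongly asymptotically flat with outermost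
minimal surface boundary of area `4πρ²`, ADM mass `m` and total charge `Q`, satisfies the charged
dominant energy condition, and the charge densities `div E`, `div B` are compactly supported. -/
structure IsPenroseDataWithCharges (D : InitialData) (a m Q ρ : ℝ) : Prop where
  pos : 0 < a
  regular : D.IsRegular a
  asymptoticallyFlat : D.IsStronglyAsymptoticallyFlat a
  outermost : D.HasOutermostMinimalBoundary a
  areaRadius_pos : 0 < ρ
  area : sphereArea D.metric a = 4 * Real.pi * ρ ^ 2
  mass : D.HasADMMass m
  charge : D.HasTotalCharge Q
  energy : D.ChargedDominantEnergyCondition a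
  electric_charge_compact : HasCompactlySupportedDivergence D.metric D.electric a
  magnetic_charge_compact : HasCompactlySupportedDivergence D.metric D.magnetic a

/-- Invariance of all fields on `{|x| ≥ a}` under the orthogonal group. -/
def IsSphericallySymmetric (D : InitialData) (a : ℝ) : Prop :=
  ∀ A : E3 ≃ₗᵢ[ℝ] E3, ∀ x ∈ exterior a,
    (∀ v w, gInner D.metric (A x) (A v) (A w) = gInner D.metric x v w) ∧
      D.electric (A x) = A (D.electric x) ∧ D.magnetic (A x) = A (D.magnetic x)

/-- On `{|x| ≥ a}` the fields of `D` and `D'` and their derivatives up to order `k` differ by less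
than `ε`. -/
def IsCkClose (D D' : InitialData) (a : ℝ) (k : ℕ) (ε : ℝ) : Prop :=
  ∀ x ∈ exterior a, ∀ l ≤ k,
    (∀ i j, ‖iteratedFDeriv ℝ l (fun y => D.metric y i j - D'.metric y i j) x‖ < ε) ∧
      ‖iteratedFDeriv ℝ l (fun y => D.electric y - D'.electric y) x‖ < ε ∧
      ‖iteratedFDeriv ℝ l (fun y => D.magnetic y - D'.magnetic y) x‖ < ε

/-- There is a diffeomorphism `{|x| ≥ a} → {|x| ≥ a'}` of manifolds with boundary, with
inverse `G`, that pulls back the metric `g'` to `g`. -/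
def AreIsometric (g : MetricField) (a : ℝ) (g' : MetricField) (a' : ℝ) : Prop :=
  ∃ F G : E3 → E3, ContDiffOn ℝ ∞ F (exterior a) ∧ ContDiffOn ℝ ∞ G (exterior a') ∧
    Set.MapsTo F (exterior a) (exterior a') ∧ Set.MapsTo G (exterior a') (exterior a) ∧
    Set.LeftInvOn G F (exterior a) ∧ Set.RightInvOn G F (exterior a') ∧
    ∀ x ∈ exterior a, ∀ v w : E3,
      gInner g' (F x) (fderivWithin ℝ F (exterior a) x v) (fderivWithin ℝ F (exterior a) x w) =
        gInner g x v w

end InitialData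

/-! ### The canonical slice of the Reissner-Nordström spacetime

In isotropic coordinates, with `s = |x| + m + (m² - q²)/(4|x|)` the area radius, the metric
`(1 - 2m/s + q²/s²)⁻¹ ds² + s² dω²` is `(s/|x|)² δ`, the horizon `s = m + √(m² - q²)` is
`|x| = √(m² - q²)/2`, and the electric field `(q/s²) n`, with `n` the outward unit normal of the
spheres, is `(q/s³) x`. -/

/-- Isotropic radius of the horizon. -/
def rnHorizon (m q : ℝ) : ℝ := Real.sqrt (m ^ 2 - q ^ 2) / 2

/-- Area radius of the sphere through `x`. -/
def rnAreaRadius (m q : ℝ) (x : E3) : ℝ := ‖x‖ + m + (m ^ 2 - q ^ 2) / (4 * ‖x‖)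

/-- The canonical Reissner-Nordström data of mass `m` and charge `q`, on
`{|x| ≥ rnHorizon m q}`. -/
def reissnerNordstrom (m q : ℝ) : InitialData where
  metric x := (rnAreaRadius m q x / ‖x‖) ^ 2 • (1 : Matrix (Fin 3) (Fin 3) ℝ)
  electric x := (q / rnAreaRadius m q x ^ 3) • x
  magnetic _ := 0

end Penrose

end

open Penrose

/-! The Reissner–Nordström slice saturates the energy condition, `R = 2|E|²`, while equality in the
Penrose inequality involves only data at the horizon and at infinity. Once `div E` may be nonzero in
between, the electric field can be weakened on an annulus. This creates slack in the energy
condition, and the slack pays for a small deformation of the metric there.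

In the isotropic radius `r` write `g = (S/r)² δ` with area radius `S`. Then `R = 2Q/S⁴` with `Q = S²
+ r²S'² - 2rS(S' + rS'')` (`scalarCurvature_profile`), and `Q = q²` for the Reissner–Nordström
profile `s` (`curvatureCharge_rn`). For `E = e x` the energy condition reads `e²S⁶ ≤ Q`. Take `S = s
+ δη` and `e = (1 - Kδχ) q/s³`, where `η`, `χ` are bumps and `χ = 1` on the support of `η`. The
deformation costs `O(δ)` in `Q` and in `S⁶`, independently of `K`, whereas the electric factor gains
about `2Kδq²`. As `q ≠ 0`, a large `K` and then a small `δ` suffice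
(`exists_perturbation_constants`). Near the horizon and near infinity nothing changes, so area, mass
and charge keep their values.

The boundary is outermost because `S' > 0` outside the horizon persists for small `δ`: a compact
minimal surface reaching beyond the horizon would violate the maximum principle at its point
farthest from the origin (`IsCompactMinimalSurface.subset_sphere`).

For nontriviality, an isometry preserves the distance to the boundary and the volume, hence the area
radius of the distance spheres and its normal derivative, even if it is not assumed to commute with
rotations (`IsConformalIsometry.exists_areaRadius_eq`). On a Reissner–Nordström slice these satisfy
`(rS')² = S² - 2m'S + q'²`. The unperturbed outer region forces `m' = m` and `q'² = q²`, and then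
the relation fails at the peak of `η`, where `S = s + δ` and `S' = s'`. -/

noncomputable section

namespace Penrose

/-! ### Partial derivatives of radial functions -/

theorem pd_eq_of_hasFDerivAt {n : ℕ} {i : Fin n} {f : EuclideanSpace ℝ (Fin n) → ℝ}
    {f' : EuclideanSpace ℝ (Fin n) →L[ℝ] ℝ} {x : EuclideanSpace ℝ (Fin n)}
    (h : HasFDerivAt f f' x) : pd i f x = f' (EuclideanSpace.single i 1) := by
  rw [pd, h.fderiv]

theorem pd_congr {n : ℕ} {i : Fin n} {f g : EuclideanSpace ℝ (Fin n) → ℝ}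
    {x : EuclideanSpace ℝ (Fin n)} (h : f =ᶠ[𝓝 x] g) : pd i f x = pd i g x := by
  rw [pd, pd, h.fderiv_eq]

theorem hasFDerivAt_norm_of_ne_zero {E : Type*} [NormedAddCommGroup E] [InnerProductSpace ℝ E]
    {x : E} (hx : x ≠ 0) : HasFDerivAt (fun y : E => ‖y‖) (‖x‖⁻¹ • innerSL ℝ x) x := by
  have h := (hasStrictFDerivAt_norm_sq x).hasFDerivAt.sqrt (by positivity)
  simp only [Real.sqrt_sq (norm_nonneg _)] at h
  refine h.congr_fderiv ?_
  ext v
  simp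
  field_simp

theorem hasFDerivAt_radial {F : ℝ → ℝ} {F' : ℝ} {x : E3} (hx : x ≠ 0)
    (h : HasDerivAt F F' ‖x‖) :
    HasFDerivAt (fun y : E3 => F ‖y‖) ((F' / ‖x‖) • innerSL ℝ x) x := by
  refine (h.comp_hasFDerivAt x (hasFDerivAt_norm_of_ne_zero hx)).congr_fderiv ?_
  rw [smul_smul, div_eq_mul_inv]

theorem pd_radial {F : ℝ → ℝ} {F' : ℝ} {x : E3} (hx : x ≠ 0) (h : HasDerivAt F F' ‖x‖)
    (i : Fin 3) : pd i (fun y => F ‖y‖) x = F' * (x i / ‖x‖) := by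
  rw [pd_eq_of_hasFDerivAt (hasFDerivAt_radial hx h)]
  simp [EuclideanSpace.inner_single_right]
  ring

theorem pd_radial_mul {F : ℝ → ℝ} {F' : ℝ} {x : E3} (hx : x ≠ 0) (h : HasDerivAt F F' ‖x‖)
    {f : E3 → ℝ} (hf : DifferentiableAt ℝ f x) (i : Fin 3) :
    pd i (fun y => F ‖y‖ * f y) x = F' * (x i / ‖x‖) * f x + F ‖x‖ * pd i f x := by
  have h1 : HasFDerivAt (fun y => F ‖y‖ * f y) _ x :=
    (hasFDerivAt_radial hx h).mul hf.hasFDerivAt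
  rw [pd_eq_of_hasFDerivAt h1, pd]
  simp [EuclideanSpace.inner_single_right]
  ring

theorem hasFDerivAt_coord {n : ℕ} (i : Fin n) (x : EuclideanSpace ℝ (Fin n)) :
    HasFDerivAt (fun y : EuclideanSpace ℝ (Fin n) => y i)
      (EuclideanSpace.proj i : EuclideanSpace ℝ (Fin n) →L[ℝ] ℝ) x :=
  (EuclideanSpace.proj i : EuclideanSpace ℝ (Fin n) →L[ℝ] ℝ).hasFDerivAt

theorem norm_sq_eq_sum (x : E3) : ‖x‖ ^ 2 = x 0 ^ 2 + x 1 ^ 2 + x 2 ^ 2 := by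
  rw [EuclideanSpace.norm_sq_eq]
  simp [Fin.sum_univ_three]

/-! ### Spherically symmetric conformally flat metrics -/

/-- The metric `c(|x|)² δ`. -/
def conformalMetric (c : ℝ → ℝ) : MetricField := fun x => c ‖x‖ ^ 2 • 1

theorem conformalMetric_apply (c : ℝ → ℝ) (x : E3) (i j : Fin 3) :
    conformalMetric c x i j = c ‖x‖ ^ 2 * (1 : Matrix (Fin 3) (Fin 3) ℝ) i j := by
  simp [conformalMetric]

theorem gInner_conformalMetric (c : ℝ → ℝ) (x v w : E3) :
    gInner (conformalMetric c) x v w = c ‖x‖ ^ 2 * inner ℝ v w := by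
  simp only [gInner, conformalMetric_apply, Matrix.one_apply, Fin.sum_univ_three,
    PiLp.inner_apply, RCLike.inner_apply, conj_trivial]
  simp
  ring

theorem conformalMetric_inv {c : ℝ → ℝ} {x : E3} (hc : c ‖x‖ ≠ 0) :
    (conformalMetric c x)⁻¹ = (c ‖x‖ ^ 2)⁻¹ • 1 := by
  apply Matrix.inv_eq_left_inv
  rw [conformalMetric, smul_mul_smul, mul_one, inv_mul_cancel₀ (pow_ne_zero 2 hc), one_smul]

theorem conformalMetric_inv_apply {c : ℝ → ℝ} {x : E3} (hc : c ‖x‖ ≠ 0) (i j : Fin 3) :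
    (conformalMetric c x)⁻¹ i j = (c ‖x‖ ^ 2)⁻¹ * (1 : Matrix (Fin 3) (Fin 3) ℝ) i j := by
  simp [conformalMetric_inv hc]

theorem volumeDensity_conformalMetric {c : ℝ → ℝ} {x : E3} (hc : 0 ≤ c ‖x‖) :
    volumeDensity (conformalMetric c) x = c ‖x‖ ^ 3 := by
  rw [volumeDensity, conformalMetric, Matrix.det_smul, Matrix.det_one, mul_one, Fintype.card_fin,
    ← pow_mul, show 2 * 3 = 3 * 2 from rfl, pow_mul, Real.sqrt_sq (by positivity)]

theorem pd_conformalMetric {c : ℝ → ℝ} {c' : ℝ} {x : E3} (hx : x ≠ 0) (h : HasDerivAt c c' ‖x‖)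
    (i j l : Fin 3) : pd i (fun y => conformalMetric c y j l) x =
      2 * c ‖x‖ * c' * (x i / ‖x‖) * (1 : Matrix (Fin 3) (Fin 3) ℝ) j l := by
  have h2 : HasDerivAt (fun r => c r ^ 2 * (1 : Matrix (Fin 3) (Fin 3) ℝ) j l)
      (2 * c ‖x‖ * c' * (1 : Matrix (Fin 3) (Fin 3) ℝ) j l) ‖x‖ := by
    refine ((h.pow 2).mul_const _).congr_deriv ?_
    simp
  simp only [conformalMetric_apply]
  rw [pd_radial (F := fun r => c r ^ 2 * (1 : Matrix (Fin 3) (Fin 3) ℝ) j l) hx h2]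
  ring

theorem christoffel_conformalMetric {c : ℝ → ℝ} {c' : ℝ} {x : E3} (hx : x ≠ 0)
    (hc : c ‖x‖ ≠ 0) (h : HasDerivAt c c' ‖x‖) (k i j : Fin 3) :
    christoffel (conformalMetric c) k i j x = c' / (‖x‖ * c ‖x‖) *
      ((1 : Matrix (Fin 3) (Fin 3) ℝ) k i * x j + (1 : Matrix (Fin 3) (Fin 3) ℝ) k j * x i -
        (1 : Matrix (Fin 3) (Fin 3) ℝ) i j * x k) := by
  have hr : ‖x‖ ≠ 0 := norm_ne_zero_iff.2 hx
  simp only [christoffel, pd_conformalMetric hx h, conformalMetric_inv_apply hc]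
  have : ∀ l, ((c ‖x‖ ^ 2)⁻¹ * (1 : Matrix (Fin 3) (Fin 3) ℝ) k l) *
      (2 * c ‖x‖ * c' * (x i / ‖x‖) * (1 : Matrix (Fin 3) (Fin 3) ℝ) j l +
        2 * c ‖x‖ * c' * (x j / ‖x‖) * (1 : Matrix (Fin 3) (Fin 3) ℝ) i l -
        2 * c ‖x‖ * c' * (x l / ‖x‖) * (1 : Matrix (Fin 3) (Fin 3) ℝ) i j) =
      (1 : Matrix (Fin 3) (Fin 3) ℝ) k l * (2 * c' / (‖x‖ * c ‖x‖) *
        ((1 : Matrix (Fin 3) (Fin 3) ℝ) l i * x j + (1 : Matrix (Fin 3) (Fin 3) ℝ) l j * x i -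
        (1 : Matrix (Fin 3) (Fin 3) ℝ) i j * x l)) := by
    intro l
    have e1 : (1 : Matrix (Fin 3) (Fin 3) ℝ) j l = (1 : Matrix (Fin 3) (Fin 3) ℝ) l j := by
      simp [Matrix.one_apply, eq_comm]
    have e2 : (1 : Matrix (Fin 3) (Fin 3) ℝ) i l = (1 : Matrix (Fin 3) (Fin 3) ℝ) l i := by
      simp [Matrix.one_apply, eq_comm]
    rw [e1, e2]
    field_simp
    ring
  simp only [this]
  simp only [Matrix.one_apply, ite_mul, one_mul, zero_mul, Finset.sum_ite_eq, Finset.mem_univ,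
    if_true]
  ring

/-- The scalar curvature of `c(|x|)² δ`. -/
theorem scalarCurvature_conformalMetric {c c₁ c₂ : ℝ → ℝ} (hpos : ∀ r, 0 < r → 0 < c r)
    (h₁ : ∀ r, 0 < r → HasDerivAt c (c₁ r) r) (h₂ : ∀ r, 0 < r → HasDerivAt c₁ (c₂ r) r)
    {x : E3} (hx : x ≠ 0) :
    scalarCurvature (conformalMetric c) x =
      -(4 * c₂ ‖x‖ / c ‖x‖ - 2 * c₁ ‖x‖ ^ 2 / c ‖x‖ ^ 2 + 8 * c₁ ‖x‖ / (‖x‖ * c ‖x‖)) /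
        c ‖x‖ ^ 2 := by
  have hr : 0 < ‖x‖ := norm_pos_iff.2 hx
  have hc := hpos _ hr
  -- `L` is `(log c)'/r`, so that the gradient of `log c` is `L x` and each Christoffel symbol is
  -- `L` times a linear function of `x`.
  set L : ℝ → ℝ := fun r => c₁ r / (r * c r) with hL
  set L' : ℝ := (c₂ ‖x‖ * (‖x‖ * c ‖x‖) - c₁ ‖x‖ * (c ‖x‖ + ‖x‖ * c₁ ‖x‖)) /
    (‖x‖ * c ‖x‖) ^ 2 with hL'
  have hLd : HasDerivAt L L' ‖x‖ := by
    refine ((h₂ _ hr).div ((hasDerivAt_id _).mul (h₁ _ hr))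
      (by simpa using ⟨hx, hc.ne'⟩)).congr_deriv ?_
    simp [hL']
  have hev : ∀ᶠ y : E3 in 𝓝 x, y ≠ 0 := isOpen_ne.eventually_mem hx
  have hpd : ∀ l k i j : Fin 3, pd l (christoffel (conformalMetric c) k i j) x =
      L' * (x l / ‖x‖) * ((1 : Matrix (Fin 3) (Fin 3) ℝ) k i * x j +
        (1 : Matrix (Fin 3) (Fin 3) ℝ) k j * x i - (1 : Matrix (Fin 3) (Fin 3) ℝ) i j * x k) +
      L ‖x‖ * ((1 : Matrix (Fin 3) (Fin 3) ℝ) k i * (1 : Matrix (Fin 3) (Fin 3) ℝ) j l +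
        (1 : Matrix (Fin 3) (Fin 3) ℝ) k j * (1 : Matrix (Fin 3) (Fin 3) ℝ) i l -
        (1 : Matrix (Fin 3) (Fin 3) ℝ) i j * (1 : Matrix (Fin 3) (Fin 3) ℝ) k l) := by
    intro l k i j
    have e : christoffel (conformalMetric c) k i j =ᶠ[𝓝 x] fun y => L ‖y‖ *
        ((1 : Matrix (Fin 3) (Fin 3) ℝ) k i * y j + (1 : Matrix (Fin 3) (Fin 3) ℝ) k j * y i -
        (1 : Matrix (Fin 3) (Fin 3) ℝ) i j * y k) := by
      filter_upwards [hev] with y hy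
      have hy' : 0 < ‖y‖ := norm_pos_iff.2 hy
      rw [christoffel_conformalMetric hy (hpos _ hy').ne' (h₁ _ hy')]
    have hd : HasFDerivAt (fun y : E3 => (1 : Matrix (Fin 3) (Fin 3) ℝ) k i * y j +
        (1 : Matrix (Fin 3) (Fin 3) ℝ) k j * y i - (1 : Matrix (Fin 3) (Fin 3) ℝ) i j * y k) _ x :=
      (((hasFDerivAt_coord j x).const_mul ((1 : Matrix (Fin 3) (Fin 3) ℝ) k i)).add
      ((hasFDerivAt_coord i x).const_mul ((1 : Matrix (Fin 3) (Fin 3) ℝ) k j))).sub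
      ((hasFDerivAt_coord k x).const_mul ((1 : Matrix (Fin 3) (Fin 3) ℝ) i j))
    rw [pd_congr e, pd_radial_mul hx hLd hd.differentiableAt]
    congr 2
    refine (pd_eq_of_hasFDerivAt hd).trans ?_
    simp only [_root_.sub_apply, _root_.add_apply, _root_.smul_apply, smul_eq_mul,
      PiLp.proj_apply, PiLp.single_apply]
    simp only [Matrix.one_apply]
  have hΓ := fun k i j => christoffel_conformalMetric hx hc.ne' (h₁ _ hr) k i j
  -- This is `R = -c⁻² (4 Δf + 2 |∇f|²)` for `f = log c`, with `Δf = 3L + rL'` and `|∇f|² = r²L²`.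
  have key : scalarCurvature (conformalMetric c) x =
      (c ‖x‖ ^ 2)⁻¹ * (-12 * L ‖x‖ - 4 * (L' / ‖x‖) * (x 0 ^ 2 + x 1 ^ 2 + x 2 ^ 2)
        - 2 * L ‖x‖ ^ 2 * (x 0 ^ 2 + x 1 ^ 2 + x 2 ^ 2)) := by
    have hL0 : c₁ ‖x‖ / (‖x‖ * c ‖x‖) = L ‖x‖ := rfl
    simp only [scalarCurvature, conformalMetric_inv_apply hc.ne', ricci, hpd, hΓ, hL0]
    generalize L ‖x‖ = l
    simp only [Fin.sum_univ_three, Matrix.one_apply, Fin.isValue]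
    simp
    ring
  rw [key, ← norm_sq_eq_sum, hL', hL]
  field_simp
  ring

/-! ### The second derivative test -/

/-- With a positive second derivative the point would also be a local minimum; then `f` is locally
constant and the second derivative is zero after all. -/
theorem IsLocalMax.deriv_deriv_nonpos {f : ℝ → ℝ} {x : ℝ} (h : IsLocalMax f x)
    (hf : ContinuousAt f x) : deriv (deriv f) x ≤ 0 := by
  by_contra! hpos
  have hmin := isLocalMin_of_deriv_deriv_pos hpos h.deriv_eq_zero hf
  have hconst : f =ᶠ[𝓝 x] fun _ => f x := by
    filter_upwards [h, hmin] with y h1 h2 using le_antisymm h1 h2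
  have h1 : deriv f =ᶠ[𝓝 x] fun _ => 0 := by
    simpa using hconst.deriv
  rw [h1.deriv_eq] at hpos
  simp at hpos

theorem fderiv_eq_sum_pd {n : ℕ} (f : EuclideanSpace ℝ (Fin n) → ℝ)
    (x w : EuclideanSpace ℝ (Fin n)) : fderiv ℝ f x w = ∑ a, w a * pd a f x := by
  conv_lhs => rw [← (EuclideanSpace.basisFun (Fin n) ℝ).sum_repr w]
  simp [pd]

theorem differentiableAt_pd {n : ℕ} {f : EuclideanSpace ℝ (Fin n) → ℝ}
    {x : EuclideanSpace ℝ (Fin n)} (hf : ContDiffAt ℝ 2 f x) (a : Fin n) :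
    DifferentiableAt ℝ (pd a f) x := by
  have h : ContDiffAt ℝ 1 (fderiv ℝ f) x := hf.fderiv_right (by norm_num)
  exact (h.differentiableAt (by norm_num)).clm_apply (differentiableAt_const _)

/-- The double sum is the second derivative at `t = 0` of `f (x + t w)`, which reduces the claim to
one variable. -/
theorem IsLocalMax.sum_pd_pd_nonpos {n : ℕ} {f : EuclideanSpace ℝ (Fin n) → ℝ}
    {x : EuclideanSpace ℝ (Fin n)} (h : IsLocalMax f x) (hf : ContDiffAt ℝ 2 f x)
    (w : EuclideanSpace ℝ (Fin n)) : ∑ a, ∑ b, w a * w b * pd a (pd b f) x ≤ 0 := by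
  have hline : ∀ t : ℝ, HasDerivAt (fun t : ℝ => x + t • w) w t := fun t => by
    simpa using ((hasDerivAt_id t).smul_const w).const_add x
  have hx : x + (0 : ℝ) • w = x := by simp
  have hcont : ContinuousAt (fun t : ℝ => x + t • w) 0 := (hline 0).continuousAt
  have htend : Tendsto (fun t : ℝ => x + t • w) (𝓝 0) (𝓝 x) := by
    simpa [ContinuousAt] using hcont
  have hmax : IsLocalMax (fun t : ℝ => f (x + t • w)) 0 := by
    filter_upwards [htend.eventually h] with t ht
    simpa using ht
  have hd1 : deriv (fun t : ℝ => f (x + t • w)) =ᶠ[𝓝 0]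
      fun t => ∑ b, w b * pd b f (x + t • w) := by
    filter_upwards [htend.eventually (hf.eventually (by simp))] with t ht
    rw [← fderiv_eq_sum_pd]
    exact ((ht.differentiableAt (by norm_num)).hasFDerivAt.comp_hasDerivAt t (hline t)).deriv
  have hd2 : HasDerivAt (fun t : ℝ => ∑ b, w b * pd b f (x + t • w))
      (∑ b, w b * fderiv ℝ (pd b f) x w) 0 := by
    refine HasDerivAt.fun_sum fun b _ => HasDerivAt.const_mul _ ?_
    have : HasFDerivAt (pd b f) (fderiv ℝ (pd b f) x) (x + (0 : ℝ) • w) := by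
      rw [hx]; exact (differentiableAt_pd hf b).hasFDerivAt
    exact this.comp_hasDerivAt 0 (hline 0)
  have hle := IsLocalMax.deriv_deriv_nonpos hmax (by
    refine ContinuousAt.comp (g := f) ?_ hcont
    rw [hx]; exact hf.continuousAt)
  rw [hd1.deriv_eq, hd2.deriv] at hle
  refine le_of_eq_of_le ?_ hle
  rw [Finset.sum_comm]
  refine Finset.sum_congr rfl fun b _ => ?_
  rw [fderiv_eq_sum_pd, Finset.mul_sum]
  exact Finset.sum_congr rfl fun a _ => by ring

/-! ### Minimal surfaces in spherically symmetric metrics -/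

section Patch

variable {X : EuclideanSpace ℝ (Fin 2) → E3} {v : EuclideanSpace ℝ (Fin 2)}

theorem surfaceTangent_eq (h : DifferentiableAt ℝ X v) (a : Fin 2) :
    surfaceTangent X a v = fderiv ℝ X v (EuclideanSpace.single a 1) := by
  ext i
  have h2 : HasFDerivAt (fun u => X u i)
      ((EuclideanSpace.proj i : E3 →L[ℝ] ℝ).comp (fderiv ℝ X v)) v :=
    (hasFDerivAt_coord i (X v)).comp v h.hasFDerivAt
  simp [surfaceTangent, pd_eq_of_hasFDerivAt h2]

theorem fderiv_apply_eq_surfaceTangent (h : DifferentiableAt ℝ X v)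
    (w : EuclideanSpace ℝ (Fin 2)) :
    fderiv ℝ X v w = w 0 • surfaceTangent X 0 v + w 1 • surfaceTangent X 1 v := by
  conv_lhs => rw [← (EuclideanSpace.basisFun (Fin 2) ℝ).sum_repr w]
  simp [surfaceTangent_eq h]

/-- The Euclidean second derivative `∂_a ∂_b X`. -/
def secondDerivative (X : EuclideanSpace ℝ (Fin 2) → E3) (a b : Fin 2)
    (v : EuclideanSpace ℝ (Fin 2)) : E3 :=
  WithLp.toLp 2 fun k => pd a (pd b fun u => X u k) v

theorem contDiffAt_coord {n : WithTop ℕ∞} (h : ContDiffAt ℝ n X v) (k : Fin 3) :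
    ContDiffAt ℝ n (fun u => X u k) v :=
  (EuclideanSpace.proj k : E3 →L[ℝ] ℝ).contDiff.contDiffAt.comp v h

theorem pd_norm_sq (h : DifferentiableAt ℝ X v) (b : Fin 2) :
    pd b (fun u => ‖X u‖ ^ 2) v = 2 * inner ℝ (X v) (surfaceTangent X b v) := by
  rw [pd_eq_of_hasFDerivAt h.hasFDerivAt.norm_sq, surfaceTangent_eq h]
  simp

theorem pd_pd_norm_sq (h : ContDiffAt ℝ 2 X v) (a b : Fin 2) :
    pd a (pd b fun u => ‖X u‖ ^ 2) v =
      2 * (inner ℝ (surfaceTangent X a v) (surfaceTangent X b v) +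
        inner ℝ (X v) (secondDerivative X a b v)) := by
  have e : pd b (fun u => ‖X u‖ ^ 2) =ᶠ[𝓝 v]
      fun u => ∑ k, 2 * (X u k * pd b (fun u => X u k) u) := by
    filter_upwards [h.eventually (by simp)] with u hu
    rw [pd_norm_sq (hu.differentiableAt (by norm_num))]
    simp only [PiLp.inner_apply, RCLike.inner_apply, conj_trivial, surfaceTangent, Finset.mul_sum]
    exact Finset.sum_congr rfl fun k _ => by ring
  have hX : ∀ k, HasFDerivAt (fun u => X u k) (fderiv ℝ (fun u => X u k) v) v := fun k =>
    ((contDiffAt_coord h k).differentiableAt (by norm_num)).hasFDerivAt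
  have hpd : ∀ k, HasFDerivAt (pd b fun u => X u k) (fderiv ℝ (pd b fun u => X u k) v) v :=
    fun k => (differentiableAt_pd (contDiffAt_coord h k) b).hasFDerivAt
  have hsum : HasFDerivAt (fun u => ∑ k, 2 * (X u k * pd b (fun u => X u k) u)) _ v :=
    HasFDerivAt.fun_sum fun k _ => ((hX k).mul (hpd k)).const_mul 2
  rw [pd_congr e, pd_eq_of_hasFDerivAt hsum]
  simp only [PiLp.inner_apply, RCLike.inner_apply, conj_trivial, surfaceTangent, secondDerivative,
    ← Finset.sum_add_distrib, Finset.mul_sum]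
  simp only [_root_.sum_apply, _root_.add_apply, _root_.smul_apply, smul_eq_mul]
  exact Finset.sum_congr rfl fun k _ => by simp only [pd]; ring

/-- Where the surface is tangent to a coordinate sphere, the position vector is normal to it, so
this is the unnormalized second fundamental form. Both uses are of this kind: patches inside a
sphere, and the point farthest from the origin. -/
theorem gInner_surfaceHessian {c : ℝ → ℝ} {c' : ℝ} (hx : X v ≠ 0) (hc : c ‖X v‖ ≠ 0)
    (hd : HasDerivAt c c' ‖X v‖) (ht : ∀ a, inner ℝ (X v) (surfaceTangent X a v) = 0)
    (a b : Fin 2) :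
    gInner (conformalMetric c) (X v) (surfaceHessian (conformalMetric c) X a b v) (X v) =
      c ‖X v‖ ^ 2 * (inner ℝ (X v) (secondDerivative X a b v) -
        ‖X v‖ * c' / c ‖X v‖ * inner ℝ (surfaceTangent X a v) (surfaceTangent X b v)) := by
  have hr : ‖X v‖ ≠ 0 := norm_ne_zero_iff.2 hx
  have hΓ : inner ℝ (surfaceHessian (conformalMetric c) X a b v) (X v) =
      inner ℝ (X v) (secondDerivative X a b v) + c' / (‖X v‖ * c ‖X v‖) *
        (2 * inner ℝ (X v) (surfaceTangent X a v) * inner ℝ (X v) (surfaceTangent X b v) -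
          ‖X v‖ ^ 2 * inner ℝ (surfaceTangent X a v) (surfaceTangent X b v)) := by
    simp only [surfaceHessian, christoffel_conformalMetric hx hc hd, norm_sq_eq_sum]
    simp only [secondDerivative, surfaceTangent, PiLp.inner_apply, RCLike.inner_apply,
      conj_trivial]
    generalize c' / (‖X v‖ * c ‖X v‖) = l
    simp only [Fin.sum_univ_three, Matrix.one_apply, Fin.isValue]
    simp
    ring
  rw [gInner_conformalMetric, hΓ, ht a]
  field_simp
  ring

/-- The tangent plane lies in the orthogonal complement of the position vector and has the same
dimension two, so the normal line is spanned by the position vector. -/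
theorem eq_smul_of_orthogonal_tangents (h : DifferentiableAt ℝ X v) (hx : X v ≠ 0)
    (hinj : Function.Injective (fderiv ℝ X v))
    (ht : ∀ a, inner ℝ (X v) (surfaceTangent X a v) = 0) {N : E3}
    (hN : ∀ a, inner ℝ (surfaceTangent X a v) N = 0) : ∃ t : ℝ, N = t • X v := by
  have hle : (fderiv ℝ X v).toLinearMap.range ≤ (ℝ ∙ X v)ᗮ := by
    rintro _ ⟨w, rfl⟩
    rw [Submodule.mem_orthogonal_singleton_iff_inner_right]
    change inner ℝ (X v) (fderiv ℝ X v w) = 0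
    rw [fderiv_apply_eq_surfaceTangent h, inner_add_right, inner_smul_right, inner_smul_right,
      ht, ht]
    simp
  have hfin : Module.finrank ℝ (fderiv ℝ X v).toLinearMap.range = Module.finrank ℝ (ℝ ∙ X v)ᗮ := by
    have h1 : Module.finrank ℝ E3 = 2 + 1 := by simp
    have : Fact (Module.finrank ℝ E3 = 2 + 1) := ⟨h1⟩
    rw [LinearMap.finrank_range_of_inj hinj, Submodule.finrank_orthogonal_span_singleton (n := 2) hx]
    simp
  have heq := Submodule.eq_of_le_of_finrank_eq hle hfin
  have hmem : N ∈ (ℝ ∙ X v)ᗮᗮ := by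
    rw [← heq, Submodule.mem_orthogonal]
    rintro _ ⟨w, rfl⟩
    change inner ℝ (fderiv ℝ X v w) N = 0
    rw [fderiv_apply_eq_surfaceTangent h, inner_add_left, inner_smul_left, inner_smul_left,
      hN, hN]
    simp
  rw [Submodule.orthogonal_orthogonal, Submodule.mem_span_singleton] at hmem
  obtain ⟨t, ht⟩ := hmem
  exact ⟨t, ht.symm⟩

/-- A patch of a coordinate sphere of radius `r` is totally geodesic if `(r c)' = 0` there. -/
theorem isMinimalPatch_of_mapsTo_sphere {c : ℝ → ℝ} {c' r : ℝ} (hr : 0 < r) (hc : c r ≠ 0)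
    (hd : HasDerivAt c c' r) (hcrit : c r + r * c' = 0) {V : Set (EuclideanSpace ℝ (Fin 2))}
    (hV : IsOpen V) (hX : ContDiffOn ℝ ∞ X V)
    (hinj : ∀ v ∈ V, Function.Injective (fderiv ℝ X v))
    (hmaps : ∀ v ∈ V, ‖X v‖ = r) : IsMinimalPatch (conformalMetric c) V X := by
  refine ⟨hV, hX, hinj, fun v hv N hN => ?_⟩
  have hXv : ContDiffAt ℝ 2 X v := contDiffAt_infty.1 (hX.contDiffAt (hV.mem_nhds hv)) 2
  have hdiff : DifferentiableAt ℝ X v := hXv.differentiableAt (by norm_num)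
  have hnorm : ‖X v‖ = r := hmaps v hv
  have hx : X v ≠ 0 := by rw [← norm_ne_zero_iff, hnorm]; exact hr.ne'
  have hev : ∀ u ∈ V, (fun u => ‖X u‖ ^ 2) =ᶠ[𝓝 u] fun _ => r ^ 2 := fun u hu => by
    filter_upwards [hV.mem_nhds hu] with y hy
    rw [hmaps y hy]
  have hpd0 : ∀ u ∈ V, ∀ b, pd b (fun u => ‖X u‖ ^ 2) u = 0 := fun u hu b => by
    rw [pd_congr (hev u hu)]; simp [pd]
  have ht : ∀ a, inner ℝ (X v) (surfaceTangent X a v) = 0 := fun a => by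
    have := hpd0 v hv a
    rw [pd_norm_sq hdiff] at this
    linarith
  -- The second derivatives of the constant `‖X‖²` vanish. Since `r c' / c = -1`, this expression is
  -- exactly the bracket in `gInner_surfaceHessian`.
  have h2 : ∀ a b, inner ℝ (surfaceTangent X a v) (surfaceTangent X b v) +
      inner ℝ (X v) (secondDerivative X a b v) = 0 := fun a b => by
    have h0 : pd a (pd b fun u => ‖X u‖ ^ 2) v = 0 := by
      have : pd b (fun u => ‖X u‖ ^ 2) =ᶠ[𝓝 v] fun _ => 0 := by
        filter_upwards [hV.mem_nhds hv] with y hy using hpd0 y hy b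
      rw [pd_congr this]; simp [pd]
    rw [pd_pd_norm_sq hXv] at h0
    linarith
  obtain ⟨t, rfl⟩ := eq_smul_of_orthogonal_tangents hdiff hx (hinj v hv) ht (N := N) (fun a => by
    have := hN a
    rw [gInner_conformalMetric, hnorm] at this
    exact (mul_eq_zero.1 this).resolve_left (pow_ne_zero 2 hc))
  refine Finset.sum_eq_zero fun a _ => Finset.sum_eq_zero fun b _ => ?_
  have hH := gInner_surfaceHessian (c := c) (c' := c') hx (by rwa [hnorm]) (by rwa [hnorm]) ht a b
  rw [gInner_conformalMetric] at hH ⊢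
  rw [inner_smul_right, mul_left_comm (_ ^ 2) t, hH, hnorm,
    show r * c' / c r = -1 by rw [div_eq_iff hc]; linarith]
  have := h2 a b
  rw [show inner ℝ (X v) (secondDerivative X a b v) - -1 *
    inner ℝ (surfaceTangent X a v) (surfaceTangent X b v) = 0 by linarith]
  ring

end Patch

theorem sum_inv_mul_fin_two {F M : Matrix (Fin 2) (Fin 2) ℝ} :
    ∑ a, ∑ b, F⁻¹ a b * M a b =
      (F 1 1 * M 0 0 - F 0 1 * M 0 1 - F 1 0 * M 1 0 + F 0 0 * M 1 1) / F.det := by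
  rw [Matrix.inv_def, Matrix.adjugate_fin_two]
  simp [Fin.sum_univ_two, Ring.inverse_eq_inv']
  ring

/-- The trace of a negative semidefinite form with respect to a positive definite one is
nonpositive; `M` need not be symmetric. -/
theorem sum_inv_mul_nonpos {F M : Matrix (Fin 2) (Fin 2) ℝ} (hsymm : F 1 0 = F 0 1)
    (h0 : 0 < F 0 0) (hdet : 0 < F.det)
    (hM : ∀ w : EuclideanSpace ℝ (Fin 2), ∑ a, ∑ b, w a * w b * M a b ≤ 0) :
    ∑ a, ∑ b, F⁻¹ a b * M a b ≤ 0 := by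
  rw [sum_inv_mul_fin_two]
  refine div_nonpos_of_nonpos_of_nonneg ?_ hdet.le
  have hM0 := hM !₂[1, 0]
  -- This vector is `F`-orthogonal to the first basis vector: `F 0 0` times the numerator of the
  -- trace is the value of `M` on it plus `F.det * M 0 0`.
  have hM1 := hM !₂[-F 0 1, F 0 0]
  simp [Fin.sum_univ_two] at hM0 hM1
  rw [Matrix.det_fin_two, hsymm] at hdet
  rw [hsymm]
  have : F 0 0 * (F 1 1 * M 0 0 - F 0 1 * M 0 1 - F 0 1 * M 1 0 + F 0 0 * M 1 1) ≤ 0 := by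
    nlinarith [mul_nonneg hdet.le (neg_nonneg.2 hM0)]
  nlinarith

/-- A compact minimal surface cannot touch from inside a coordinate sphere on which
`(r c)' > 0`; hence it lies in the innermost sphere if `(r c)' > 0` outside. -/
theorem IsCompactMinimalSurface.subset_sphere {c c₁ : ℝ → ℝ} {a : ℝ} (ha : 0 < a)
    (hc : ∀ r, 0 < r → 0 < c r) (hd : ∀ r, 0 < r → HasDerivAt c (c₁ r) r)
    (hmono : ∀ r, a < r → 0 < c r + r * c₁ r) {S : Set E3} (hSa : S ⊆ exterior a)
    (hS : IsCompactMinimalSurface (conformalMetric c) S) : S ⊆ Metric.sphere 0 a := by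
  intro y hy
  -- Maximum principle at a point of the surface farthest from the origin.
  obtain ⟨p, hpS, hpmax⟩ := hS.1.exists_isMaxOn ⟨y, hy⟩ continuous_norm.continuousOn
  suffices h : ‖p‖ ≤ a by
    have h1 : ‖y‖ ≤ ‖p‖ := hpmax hy
    have h2 : a ≤ ‖y‖ := hSa hy
    rw [mem_sphere_zero_iff_norm]
    linarith
  by_contra! hpa
  obtain ⟨V, X, hX, ⟨v, hv, rfl⟩, hVS⟩ := hS.2 p hpS
  have hXv : ContDiffAt ℝ 2 X v := 
    contDiffAt_infty.1 (hX.smooth.contDiffAt (hX.isOpen.mem_nhds hv)) 2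
  have hdiff : DifferentiableAt ℝ X v := hXv.differentiableAt (by norm_num)
  have hr : 0 < ‖X v‖ := ha.trans hpa
  have hx : X v ≠ 0 := norm_pos_iff.1 hr
  have hcr := hc _ hr
  have hmax : IsLocalMax (fun u => ‖X u‖ ^ 2) v := by
    filter_upwards [hX.isOpen.mem_nhds hv] with u hu
    have : ‖X u‖ ≤ ‖X v‖ := hpmax (hVS ⟨u, hu, rfl⟩)
    gcongr
  have hsq : ContDiffAt ℝ 2 (fun u => ‖X u‖ ^ 2) v := hXv.norm_sq ℝ
  have ht : ∀ a, inner ℝ (X v) (surfaceTangent X a v) = 0 := fun a => by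
    have h0 : pd a (fun u => ‖X u‖ ^ 2) v = 0 := by rw [pd, hmax.fderiv_eq_zero]; rfl
    rw [pd_norm_sq hdiff] at h0
    linarith
  set F := firstFundamentalForm (conformalMetric c) X v with hF
  have hFab : ∀ a b, F a b = c ‖X v‖ ^ 2 *
      inner ℝ (surfaceTangent X a v) (surfaceTangent X b v) := fun a b => by
    simp [hF, firstFundamentalForm, gInner_conformalMetric]
  have hindep : ∀ s t : ℝ, s • surfaceTangent X 0 v + t • surfaceTangent X 1 v = 0 →
      s = 0 ∧ t = 0 := fun s t hst => by
    have h1 := fderiv_apply_eq_surfaceTangent hdiff !₂[s, t]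
    simp only [Matrix.cons_val_zero, Matrix.cons_val_one] at h1
    rw [hst] at h1
    have h2 := hX.immersion v hv (h1.trans (map_zero _).symm)
    exact ⟨by simpa using congrArg (fun w : EuclideanSpace ℝ (Fin 2) => w 0) h2,
      by simpa using congrArg (fun w : EuclideanSpace ℝ (Fin 2) => w 1) h2⟩
  have hsymm : inner ℝ (surfaceTangent X 1 v) (surfaceTangent X 0 v) =
    inner ℝ (surfaceTangent X 0 v) (surfaceTangent X 1 v) := real_inner_comm _ _
  have hT0 : 0 < inner ℝ (surfaceTangent X 0 v) (surfaceTangent X 0 v) := by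
    refine real_inner_self_pos.2 fun h0 => ?_
    have := hindep 1 0 (by simp [h0])
    simp at this
  have hgram : 0 < inner ℝ (surfaceTangent X 0 v) (surfaceTangent X 0 v) *
      inner ℝ (surfaceTangent X 1 v) (surfaceTangent X 1 v) -
      inner ℝ (surfaceTangent X 0 v) (surfaceTangent X 1 v) ^ 2 := by
    set A := inner ℝ (surfaceTangent X 0 v) (surfaceTangent X 0 v)
    set B := inner ℝ (surfaceTangent X 0 v) (surfaceTangent X 1 v) with hB
    have hpos : 0 < inner ℝ ((-B) • surfaceTangent X 0 v + A • surfaceTangent X 1 v)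
        ((-B) • surfaceTangent X 0 v + A • surfaceTangent X 1 v) := by
      refine real_inner_self_pos.2 fun h0 => hT0.ne' (hindep _ _ h0).2
    simp only [inner_add_left, inner_add_right, inner_smul_left, inner_smul_right, conj_trivial,
      hsymm, ← hB] at hpos
    have : 0 < A * (A * inner ℝ (surfaceTangent X 1 v) (surfaceTangent X 1 v) - B ^ 2) := by
      refine hpos.trans_eq ?_
      ring
    exact pos_of_mul_pos_right this hT0.le
  have hdet : 0 < F.det := by
    rw [Matrix.det_fin_two]
    simp only [hFab, hsymm]
    have := mul_pos (pow_pos hcr 4) hgram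
    refine this.trans_eq ?_
    ring
  have hMle := sum_inv_mul_nonpos (F := F) (M := Matrix.of fun a b =>
    pd a (pd b fun u => ‖X u‖ ^ 2) v) (by rw [hFab, hFab, hsymm])
    (by rw [hFab]; positivity) hdet (fun w => IsLocalMax.sum_pd_pd_nonpos hmax hsq w)
  -- Minimality is tested only with the position vector, which is normal at the farthest point.
  have hmin := hX.meanCurvature_eq_zero v hv (X v) (fun a => by
    rw [gInner_conformalMetric, real_inner_comm, ht, mul_zero])
  have hH := gInner_surfaceHessian (c := c) hx hcr.ne' (hd _ hr) ht
  simp only [hH, ← hF] at hmin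
  have htr : ∑ a, ∑ b, F⁻¹ a b * F a b = 2 := by
    rw [sum_inv_mul_fin_two, div_eq_iff hdet.ne', Matrix.det_fin_two,
      show F 1 0 = F 0 1 by rw [hFab, hFab, hsymm]]
    ring
  -- Minimality eliminates the second derivatives of `X` from the trace of the Hessian of `‖X‖²`.
  -- What remains is a positive multiple of `(r c)'`, although the Hessian at a maximum has
  -- nonpositive trace.
  have hcomb : ∑ a, ∑ b, F⁻¹ a b * (Matrix.of fun a b => pd a (pd b fun u => ‖X u‖ ^ 2) v) a b =
      4 * (1 + ‖X v‖ * c₁ ‖X v‖ / c ‖X v‖) / c ‖X v‖ ^ 2 := by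
    have e : ∀ a b, F⁻¹ a b * (Matrix.of fun a b => pd a (pd b fun u => ‖X u‖ ^ 2) v) a b =
        2 / c ‖X v‖ ^ 2 * (F⁻¹ a b * (c ‖X v‖ ^ 2 * (inner ℝ (X v) (secondDerivative X a b v) -
        ‖X v‖ * c₁ ‖X v‖ / c ‖X v‖ * inner ℝ (surfaceTangent X a v) (surfaceTangent X b v)))) +
        2 * (1 + ‖X v‖ * c₁ ‖X v‖ / c ‖X v‖) / c ‖X v‖ ^ 2 * (F⁻¹ a b * F a b) := fun a b => by
      rw [Matrix.of_apply, pd_pd_norm_sq hXv, hFab]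
      field_simp
      ring
    simp only [e, Finset.sum_add_distrib, ← Finset.mul_sum, htr, hmin]
    ring
  rw [hcomb] at hMle
  have h1 : 0 < 1 + ‖X v‖ * c₁ ‖X v‖ / c ‖X v‖ := by
    have := div_pos (hmono _ hpa) hcr
    rwa [add_div, div_self hcr.ne'] at this
  have : 0 < 4 * (1 + ‖X v‖ * c₁ ‖X v‖ / c ‖X v‖) / c ‖X v‖ ^ 2 := by positivity
  linarith

/-- A coordinate sphere on which `(r c)' = 0` is an embedded minimal surface. -/
theorem isCompactEmbeddedMinimalSurface_sphere {c : ℝ → ℝ} {c' r : ℝ} (hr : 0 < r) (hc : c r ≠ 0)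
    (hd : HasDerivAt c c' r) (hcrit : c r + r * c' = 0) :
    IsCompactEmbeddedMinimalSurface (conformalMetric c) (Metric.sphere 0 r) := by
  refine ⟨isCompact_sphere 0 r, fun p hp => ?_⟩
  rw [mem_sphere_zero_iff_norm] at hp
  -- An orthonormal basis with `p` at the pole: the patch is the open hemisphere around `p`, a graph
  -- over a disc, and orthogonal projection is its inverse.
  obtain ⟨e, he⟩ : ∃ e : OrthonormalBasis (Fin 3) ℝ E3, e 2 = r⁻¹ • p := by
    have hon : Orthonormal ℝ (({2} : Set (Fin 3)).domRestrict fun _ : Fin 3 => r⁻¹ • p) := by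
      refine ⟨fun _ => ?_, fun i j hij => absurd (Subsingleton.elim i j) hij⟩
      simp [norm_smul, hp, abs_of_pos hr, hr.ne']
    obtain ⟨e, he⟩ := hon.exists_orthonormalBasis_extension_of_card_eq (by simp)
    exact ⟨e, he 2 rfl⟩
  set z : EuclideanSpace ℝ (Fin 2) → ℝ := fun v => Real.sqrt (r ^ 2 - ‖v‖ ^ 2) with hz
  set X : EuclideanSpace ℝ (Fin 2) → E3 := fun v => v 0 • e 0 + v 1 • e 1 + z v • e 2 with hX
  set Y : E3 → EuclideanSpace ℝ (Fin 2) := fun x => !₂[inner ℝ (e 0) x, inner ℝ (e 1) x] with hY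
  have hcoord : ∀ v, inner ℝ (e 0) (X v) = v 0 ∧ inner ℝ (e 1) (X v) = v 1 ∧
      inner ℝ (e 2) (X v) = z v := fun v => by
    simp [hX, inner_add_right, inner_smul_right]
  have hYX : ∀ v, Y (X v) = v := fun v => by
    ext i
    fin_cases i
    · simpa [hY] using (hcoord v).1
    · simpa [hY] using (hcoord v).2.1
  have hYcont : ContDiff ℝ ∞ Y := by
    rw [contDiff_euclidean]
    intro i
    fin_cases i
    · simpa [hY] using (contDiff_const.inner ℝ contDiff_id)
    · simpa [hY] using (contDiff_const.inner ℝ contDiff_id)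
  have hnorm : ∀ x : E3, ‖x‖ ^ 2 =
      inner ℝ (e 0) x ^ 2 + inner ℝ (e 1) x ^ 2 + inner ℝ (e 2) x ^ 2 := fun x => by
    have := e.sum_sq_norm_inner_right x
    simpa [Fin.sum_univ_three, sq_abs] using this.symm
  have hpos : ∀ v ∈ Metric.ball (0 : EuclideanSpace ℝ (Fin 2)) r, 0 < r ^ 2 - ‖v‖ ^ 2 :=
    fun v hv => by
      rw [mem_ball_zero_iff] at hv
      nlinarith [norm_nonneg v]
  have hv2 : ∀ v : EuclideanSpace ℝ (Fin 2), ‖v‖ ^ 2 = v 0 ^ 2 + v 1 ^ 2 := fun v => by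
    rw [EuclideanSpace.norm_sq_eq]; simp [Fin.sum_univ_two]
  have hXnorm : ∀ v ∈ Metric.ball (0 : EuclideanSpace ℝ (Fin 2)) r, ‖X v‖ = r := fun v hv => by
    have h1 : ‖X v‖ ^ 2 = r ^ 2 := by
      rw [hnorm, (hcoord v).1, (hcoord v).2.1, (hcoord v).2.2, hz, Real.sq_sqrt (hpos v hv).le,
        hv2]
      ring
    exact (sq_eq_sq₀ (norm_nonneg _) hr.le).1 h1
  have hXsmooth : ContDiffOn ℝ ∞ X (Metric.ball 0 r) := by
    have hc0 : ∀ i : Fin 2, ContDiff ℝ ∞ fun v : EuclideanSpace ℝ (Fin 2) => v i := fun i =>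
      (EuclideanSpace.proj i : EuclideanSpace ℝ (Fin 2) →L[ℝ] ℝ).contDiff
    have hzs : ContDiffOn ℝ ∞ z (Metric.ball 0 r) :=
      ContDiffOn.sqrt (contDiff_const.sub (contDiff_norm_sq ℝ)).contDiffOn
        fun v hv => (hpos v hv).ne'
    exact (((hc0 0).smul contDiff_const).add ((hc0 1).smul contDiff_const)).contDiffOn.add
      (hzs.smul contDiffOn_const)
  have hinj : ∀ v ∈ Metric.ball (0 : EuclideanSpace ℝ (Fin 2)) r,
      Function.Injective (fderiv ℝ X v) := fun v hv => by
    have h1 : HasFDerivAt X (fderiv ℝ X v) v :=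
      ((hXsmooth.contDiffAt (Metric.isOpen_ball.mem_nhds hv)).differentiableAt
        (by simp)).hasFDerivAt
    have h2 := (hYcont.differentiable (by simp) (X v)).hasFDerivAt.comp v h1
    have h3 : (fderiv ℝ Y (X v)).comp (fderiv ℝ X v) = ContinuousLinearMap.id ℝ _ := by
      refine h2.unique ?_
      have : Y ∘ X = id := funext hYX
      rw [this]
      exact hasFDerivAt_id v
    intro w w' hw
    have h4 := congrArg (fderiv ℝ Y (X v)) hw
    have h5 := fun w => congrArg (fun A => A w) h3
    simpa using (h5 w).symm.trans (h4.trans (h5 w'))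
  refine ⟨Metric.ball 0 r, X, isMinimalPatch_of_mapsTo_sphere hr hc hd hcrit Metric.isOpen_ball
    hXsmooth hinj hXnorm, {x | 0 < inner ℝ (e 2) x}, ?_, ?_, ?_, Y, hYcont.continuous.continuousOn,
    fun v _ => hYX v⟩
  · exact isOpen_lt continuous_const (by fun_prop)
  · change 0 < inner ℝ (e 2) p
    rw [he, inner_smul_left, real_inner_self_eq_norm_sq, hp]
    simp only [conj_trivial]
    positivity
  · ext x
    constructor
    · rintro ⟨v, hv, rfl⟩
      refine ⟨by rw [mem_sphere_zero_iff_norm]; exact hXnorm v hv, ?_⟩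
      change 0 < inner ℝ (e 2) (X v)
      rw [(hcoord v).2.2]
      exact Real.sqrt_pos.2 (hpos v hv)
    · rintro ⟨hx, hx2⟩
      rw [mem_sphere_zero_iff_norm] at hx
      replace hx2 : 0 < inner ℝ (e 2) x := hx2
      have hYn : ‖Y x‖ ^ 2 = inner ℝ (e 0) x ^ 2 + inner ℝ (e 1) x ^ 2 := by
        rw [hv2]; simp [hY]
      have hxn := hnorm x
      rw [hx] at hxn
      have hzx : z (Y x) = inner ℝ (e 2) x := by
        rw [hz]
        simp only
        rw [hYn, show r ^ 2 - (inner ℝ (e 0) x ^ 2 + inner ℝ (e 1) x ^ 2) = inner ℝ (e 2) x ^ 2 by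
          linarith, Real.sqrt_sq hx2.le]
      refine ⟨Y x, ?_, ?_⟩
      · rw [mem_ball_zero_iff]
        refine lt_of_pow_lt_pow_left₀ 2 hr.le ?_
        rw [hYn]
        have := pow_pos hx2 2
        linarith
      · have h1 := e.sum_repr' x
        rw [Fin.sum_univ_three] at h1
        refine Eq.trans ?_ h1
        change Y x 0 • e 0 + Y x 1 • e 1 + z (Y x) • e 2 = _
        rw [hzx]
        simp [hY]

/-! ### Decay of radial functions -/

theorem abs_coord_le_norm (x : E3) (i : Fin 3) : |x i| ≤ ‖x‖ := by
  simpa using PiLp.norm_apply_le x i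

theorem abs_one_apply_le (i j : Fin 3) : |(1 : Matrix (Fin 3) (Fin 3) ℝ) i j| ≤ 1 := by
  rw [Matrix.one_apply]
  split_ifs <;> simp

theorem pd_coord (i k : Fin 3) (x : E3) :
    pd k (fun y : E3 => y i) x = (1 : Matrix (Fin 3) (Fin 3) ℝ) i k := by
  rw [pd_eq_of_hasFDerivAt (hasFDerivAt_coord i x)]
  simp [Matrix.one_apply]

theorem eventually_norm_gt {x : E3} {R : ℝ} (hx : R < ‖x‖) : ∀ᶠ y : E3 in 𝓝 x, R < ‖y‖ :=
  (isOpen_lt continuous_const continuous_norm).eventually_mem hx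

theorem InitialData.DecaysTwo.congr {p : ℕ} {f f' : E3 → ℝ} (h : InitialData.DecaysTwo p f) {R₀ : ℝ}
    (hff : ∀ x : E3, R₀ < ‖x‖ → f' x = f x) : InitialData.DecaysTwo p f' := by
  obtain ⟨C, R, hR, hC⟩ := h
  refine ⟨C, max R (R₀ + 1), by positivity, fun x hx => ?_⟩
  have hx1 : R₀ < ‖x‖ := by linarith [le_max_right R (R₀ + 1)]
  have hev : ∀ y : E3, R₀ < ‖y‖ → f' =ᶠ[𝓝 y] f := fun y hy => by
    filter_upwards [eventually_norm_gt hy] with z hz using hff z hz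
  have hpd : ∀ l, ∀ y : E3, R₀ < ‖y‖ → pd l f' y = pd l f y := fun l y hy => pd_congr (hev y hy)
  obtain ⟨h0, h1, h2⟩ := hC x ((le_max_left _ _).trans hx)
  refine ⟨by rwa [hff x hx1], fun k => by rw [hpd k x hx1]; exact h1 k, fun k l => ?_⟩
  have : pd l f' =ᶠ[𝓝 x] pd l f := by
    filter_upwards [eventually_norm_gt hx1] with z hz using hpd l z hz
  rw [pd_congr this]
  exact h2 k l

theorem decaysTwo_zero (p : ℕ) : InitialData.DecaysTwo p fun _ => 0 :=
  have h : ∀ l : Fin 3, pd l (fun _ : E3 => (0 : ℝ)) = fun _ => 0 := fun l => by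
    ext x; simp [pd]
  ⟨0, 1, one_pos, fun x _ => by simp [h]⟩

section Decay

variable {ψ ψ₁ ψ₂ : ℝ → ℝ} {C R : ℝ} {p : ℕ}

theorem decaysTwo_radial (hR : 0 < R) (h₁ : ∀ r, R < r → HasDerivAt ψ (ψ₁ r) r)
    (h₂ : ∀ r, R < r → HasDerivAt ψ₁ (ψ₂ r) r) (b₀ : ∀ r, R < r → |ψ r| ≤ C / r ^ p)
    (b₁ : ∀ r, R < r → |ψ₁ r| ≤ C / r ^ (p + 1)) (b₂ : ∀ r, R < r → |ψ₂ r| ≤ C / r ^ (p + 2)) :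
    InitialData.DecaysTwo p fun x => ψ ‖x‖ := by
  -- The second partial derivatives are bounded by `|ψ₂| + 2|ψ₁|/r`, whence the factor 3. The shift
  -- by 1 turns `≤` into the strict inequality of the hypotheses.
  refine ⟨3 * C, R + 1, by linarith, fun x hx => ?_⟩
  have hx1 : R < ‖x‖ := by linarith
  have hr : 0 < ‖x‖ := hR.trans hx1
  have hne : ∀ y : E3, R < ‖y‖ → y ≠ 0 := fun y hy => norm_pos_iff.1 (hR.trans hy)
  have hpd : ∀ l, ∀ y : E3, R < ‖y‖ → pd l (fun x => ψ ‖x‖) y = ψ₁ ‖y‖ / ‖y‖ * y l :=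
    fun l y hy => by rw [pd_radial (hne y hy) (h₁ _ hy)]; ring
  have hC : 0 ≤ C / ‖x‖ ^ p := (abs_nonneg _).trans (b₀ _ hx1)
  have hC1 : 0 ≤ C / ‖x‖ ^ (p + 1) := (abs_nonneg _).trans (b₁ _ hx1)
  have hC2 : 0 ≤ C / ‖x‖ ^ (p + 2) := (abs_nonneg _).trans (b₂ _ hx1)
  refine ⟨?_, fun k => ?_, fun k l => ?_⟩
  · rw [mul_div_assoc]
    linarith [b₀ _ hx1]
  · rw [hpd k x hx1, abs_mul, abs_div, abs_norm, mul_div_assoc]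
    have := b₁ _ hx1
    calc |ψ₁ ‖x‖| / ‖x‖ * |x k| ≤ |ψ₁ ‖x‖| / ‖x‖ * ‖x‖ := by
          gcongr; exact abs_coord_le_norm x k
      _ = |ψ₁ ‖x‖| := by field_simp
      _ ≤ _ := by linarith
  · have hev : pd l (fun x => ψ ‖x‖) =ᶠ[𝓝 x] fun y => ψ₁ ‖y‖ / ‖y‖ * y l := by
      filter_upwards [eventually_norm_gt hx1] with y hy using hpd l y hy
    have hd : HasDerivAt (fun r => ψ₁ r / r) (ψ₂ ‖x‖ / ‖x‖ - ψ₁ ‖x‖ / ‖x‖ ^ 2) ‖x‖ := by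
      refine ((h₂ _ hx1).div (hasDerivAt_id _) hr.ne').congr_deriv ?_
      simp only [id]
      field_simp
    rw [pd_congr hev, pd_radial_mul (hne x hx1) hd (hasFDerivAt_coord l x).differentiableAt,
      pd_coord]
    have e1 := b₁ _ hx1
    have e2 := b₂ _ hx1
    have e3 : |ψ₁ ‖x‖| / ‖x‖ ≤ C / ‖x‖ ^ (p + 2) := by
      rw [div_le_iff₀ hr]
      refine e1.trans_eq ?_
      field_simp
      ring
    have key : |(ψ₂ ‖x‖ / ‖x‖ - ψ₁ ‖x‖ / ‖x‖ ^ 2) * (x k / ‖x‖) * x l +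
        ψ₁ ‖x‖ / ‖x‖ * (1 : Matrix (Fin 3) (Fin 3) ℝ) l k| ≤
        (|ψ₂ ‖x‖| / ‖x‖ + |ψ₁ ‖x‖| / ‖x‖ ^ 2) * (‖x‖ / ‖x‖) * ‖x‖ + |ψ₁ ‖x‖| / ‖x‖ * 1 := by
      refine (abs_add_le _ _).trans ?_
      simp only [abs_mul, abs_div, abs_norm]
      gcongr
      · refine (abs_sub _ _).trans_eq ?_
        simp [abs_div]
      · exact abs_coord_le_norm x k
      · exact abs_coord_le_norm x l
      · exact abs_one_apply_le l k
    refine key.trans ?_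
    have : (|ψ₂ ‖x‖| / ‖x‖ + |ψ₁ ‖x‖| / ‖x‖ ^ 2) * (‖x‖ / ‖x‖) * ‖x‖ + |ψ₁ ‖x‖| / ‖x‖ * 1 =
        |ψ₂ ‖x‖| + 2 * (|ψ₁ ‖x‖| / ‖x‖) := by field_simp; ring
    rw [this, mul_div_assoc]
    linarith

theorem decaysTwo_radial_mul_coord (hR : 0 < R) (h₁ : ∀ r, R < r → HasDerivAt ψ (ψ₁ r) r)
    (h₂ : ∀ r, R < r → HasDerivAt ψ₁ (ψ₂ r) r) (b₀ : ∀ r, R < r → |ψ r| ≤ C / r ^ (p + 1))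
    (b₁ : ∀ r, R < r → |ψ₁ r| ≤ C / r ^ (p + 2)) (b₂ : ∀ r, R < r → |ψ₂ r| ≤ C / r ^ (p + 3))
    (i : Fin 3) : InitialData.DecaysTwo p fun x => ψ ‖x‖ * x i := by
  -- The worst case is again the second derivatives, bounded by `|ψ₂| r + 4|ψ₁|`.
  refine ⟨5 * C, R + 1, by linarith, fun x hx => ?_⟩
  have hx1 : R < ‖x‖ := by linarith
  have hr : 0 < ‖x‖ := hR.trans hx1
  have hne : ∀ y : E3, R < ‖y‖ → y ≠ 0 := fun y hy => norm_pos_iff.1 (hR.trans hy)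
  have hpd : ∀ l, ∀ y : E3, R < ‖y‖ → pd l (fun x => ψ ‖x‖ * x i) y =
      ψ₁ ‖y‖ / ‖y‖ * (y l * y i) + ψ ‖y‖ * (1 : Matrix (Fin 3) (Fin 3) ℝ) i l :=
    fun l y hy => by
      rw [pd_radial_mul (hne y hy) (h₁ _ hy) (hasFDerivAt_coord i y).differentiableAt, pd_coord]
      ring
  have e0 : |ψ ‖x‖| * ‖x‖ ≤ C / ‖x‖ ^ p := by
    rw [← le_div_iff₀ hr]
    refine (b₀ _ hx1).trans_eq ?_
    field_simp
    ring
  have e0' : |ψ ‖x‖| ≤ C / ‖x‖ ^ (p + 1) := b₀ _ hx1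
  have e1 : |ψ₁ ‖x‖| * ‖x‖ ≤ C / ‖x‖ ^ (p + 1) := by
    rw [← le_div_iff₀ hr]
    refine (b₁ _ hx1).trans_eq ?_
    field_simp
    ring
  have e1' : |ψ₁ ‖x‖| ≤ C / ‖x‖ ^ (p + 2) := b₁ _ hx1
  have e2 : |ψ₂ ‖x‖| * ‖x‖ ≤ C / ‖x‖ ^ (p + 2) := by
    rw [← le_div_iff₀ hr]
    refine (b₂ _ hx1).trans_eq ?_
    field_simp
    ring
  have hC : 0 ≤ C / ‖x‖ ^ p := le_trans (by positivity) e0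
  have hC1 : 0 ≤ C / ‖x‖ ^ (p + 1) := le_trans (by positivity) e1
  have hC2 : 0 ≤ C / ‖x‖ ^ (p + 2) := le_trans (by positivity) e2
  have hxi := abs_coord_le_norm x i
  refine ⟨?_, fun k => ?_, fun k l => ?_⟩
  · rw [abs_mul, mul_div_assoc]
    have : |ψ ‖x‖| * |x i| ≤ |ψ ‖x‖| * ‖x‖ := by gcongr
    linarith
  · rw [hpd k x hx1, mul_div_assoc]
    have hxk := abs_coord_le_norm x k
    calc |ψ₁ ‖x‖ / ‖x‖ * (x k * x i) + ψ ‖x‖ * (1 : Matrix (Fin 3) (Fin 3) ℝ) i k|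
        ≤ |ψ₁ ‖x‖| / ‖x‖ * (‖x‖ * ‖x‖) + |ψ ‖x‖| * 1 := by
          refine (abs_add_le _ _).trans ?_
          simp only [abs_mul, abs_div, abs_norm]
          gcongr
          exact abs_one_apply_le i k
      _ = |ψ₁ ‖x‖| * ‖x‖ + |ψ ‖x‖| := by field_simp
      _ ≤ _ := by linarith
  · have hev : pd l (fun x => ψ ‖x‖ * x i) =ᶠ[𝓝 x] fun y =>
        ψ₁ ‖y‖ / ‖y‖ * (y l * y i) + ψ ‖y‖ * (1 : Matrix (Fin 3) (Fin 3) ℝ) i l := by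
      filter_upwards [eventually_norm_gt hx1] with y hy using hpd l y hy
    have hd : HasDerivAt (fun r => ψ₁ r / r) (ψ₂ ‖x‖ / ‖x‖ - ψ₁ ‖x‖ / ‖x‖ ^ 2) ‖x‖ := by
      refine ((h₂ _ hx1).div (hasDerivAt_id _) hr.ne').congr_deriv ?_
      simp only [id]
      field_simp
    have hval : HasFDerivAt (fun y : E3 => ψ₁ ‖y‖ / ‖y‖ * (y l * y i) +
        ψ ‖y‖ * (1 : Matrix (Fin 3) (Fin 3) ℝ) i l) _ x :=
      ((hasFDerivAt_radial (hne x hx1) hd).mul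
        ((hasFDerivAt_coord l x).mul (hasFDerivAt_coord i x))).add
        ((hasFDerivAt_radial (hne x hx1) (h₁ _ hx1)).mul_const
          ((1 : Matrix (Fin 3) (Fin 3) ℝ) i l))
    rw [pd_congr hev, pd_eq_of_hasFDerivAt hval]
    simp only [_root_.add_apply, _root_.smul_apply, smul_eq_mul,
      PiLp.proj_apply, PiLp.single_apply, innerSL_apply_apply, EuclideanSpace.inner_single_right,
      one_mul, conj_trivial, ← Matrix.one_apply]
    have hxl := abs_coord_le_norm x l
    have hxk := abs_coord_le_norm x k
    have key : |ψ₁ ‖x‖ / ‖x‖ * (x l * (1 : Matrix (Fin 3) (Fin 3) ℝ) i k +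
          x i * (1 : Matrix (Fin 3) (Fin 3) ℝ) l k) +
        x l * x i * ((ψ₂ ‖x‖ / ‖x‖ - ψ₁ ‖x‖ / ‖x‖ ^ 2) / ‖x‖ * x k) +
        (1 : Matrix (Fin 3) (Fin 3) ℝ) i l * (ψ₁ ‖x‖ / ‖x‖ * x k)| ≤
        |ψ₁ ‖x‖| / ‖x‖ * (‖x‖ * 1 + ‖x‖ * 1) +
        ‖x‖ * ‖x‖ * ((|ψ₂ ‖x‖| / ‖x‖ + |ψ₁ ‖x‖| / ‖x‖ ^ 2) / ‖x‖ * ‖x‖) +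
        1 * (|ψ₁ ‖x‖| / ‖x‖ * ‖x‖) := by
      refine (abs_add_le _ _).trans (add_le_add ((abs_add_le _ _).trans (add_le_add ?_ ?_)) ?_)
      · rw [abs_mul, abs_div, abs_norm]
        gcongr
        refine (abs_add_le _ _).trans ?_
        rw [abs_mul, abs_mul]
        gcongr <;> exact abs_one_apply_le _ _
      · simp only [abs_mul, abs_div, abs_norm]
        gcongr
        refine (abs_sub _ _).trans_eq ?_
        simp [abs_div]
      · simp only [abs_mul, abs_div, abs_norm]
        gcongr
        exact abs_one_apply_le _ _
    refine key.trans ?_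
    have : |ψ₁ ‖x‖| / ‖x‖ * (‖x‖ * 1 + ‖x‖ * 1) +
        ‖x‖ * ‖x‖ * ((|ψ₂ ‖x‖| / ‖x‖ + |ψ₁ ‖x‖| / ‖x‖ ^ 2) / ‖x‖ * ‖x‖) +
        1 * (|ψ₁ ‖x‖| / ‖x‖ * ‖x‖) = |ψ₂ ‖x‖| * ‖x‖ + 4 * |ψ₁ ‖x‖| := by field_simp; ring
    rw [this, mul_div_assoc]
    linarith

end Decay

theorem isClosed_exterior (a : ℝ) : IsClosed (exterior a) :=
  isClosed_le continuous_const continuous_norm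

/-- The exponent 4 exceeds the dimension, and away from the origin `‖x‖` is comparable to `1 + ‖x‖`.
-/
theorem integrableOn_exterior_of_abs_le {f : E3 → ℝ} {a C : ℝ} (ha : 0 < a)
    (hf : ContinuousOn f (exterior a)) (hC : ∀ x ∈ exterior a, |f x| ≤ C / ‖x‖ ^ 4) :
    IntegrableOn f (exterior a) := by
  have hint : Integrable fun x : E3 => (C * (1 / a + 1) ^ 4) * (1 + ‖x‖) ^ (-(4 : ℝ)) :=
    (integrable_one_add_norm (by simp; norm_num)).const_mul _
  refine hint.integrableOn.mono' (hf.aestronglyMeasurable (isClosed_exterior a).measurableSet) ?_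
  refine (ae_restrict_iff' (isClosed_exterior a).measurableSet).2 (ae_of_all _ fun x hx => ?_)
  have hxa : a ≤ ‖x‖ := hx
  have hr : 0 < ‖x‖ := ha.trans_le hxa
  have hC0 : 0 ≤ C := by
    have := (abs_nonneg _).trans (hC x hx)
    rwa [le_div_iff₀ (by positivity), zero_mul] at this
  refine (hC x hx).trans ?_
  rw [Real.rpow_neg (by positivity), show (4 : ℝ) = ((4 : ℕ) : ℝ) by norm_num, Real.rpow_natCast,
    ← div_eq_mul_inv, div_le_div_iff₀ (by positivity) (by positivity), mul_assoc, ← mul_pow]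
  have : 1 + ‖x‖ ≤ (1 / a + 1) * ‖x‖ := by
    rw [add_mul, one_mul, div_mul_eq_mul_div, one_mul]
    have := (one_le_div ha).2 hxa
    linarith
  gcongr

/-! ### Integrals over coordinate spheres -/

theorem sphereIntegral_eq_of_const {r c : ℝ} {f : E3 → ℝ} (hr : 0 ≤ r)
    (hf : ∀ x, ‖x‖ = r → f x = c) : sphereIntegral r f = 4 * Real.pi * r ^ 2 * c := by
  have h : ∀ w : Metric.sphere (0 : E3) 1, f (r • (w : E3)) = c := fun w => hf _ (by
    simp [norm_smul, abs_of_nonneg hr])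
  have hvol : (volume : Measure E3).toSphere.real Set.univ = 4 * Real.pi := by
    rw [measureReal_def, Measure.toSphere_apply_univ, EuclideanSpace.volume_ball_fin_three]
    rw [ENNReal.toReal_mul, ENNReal.toReal_mul, ENNReal.toReal_ofReal (by positivity)]
    simp
    ring
  simp only [sphereIntegral, h]
  rw [integral_const, hvol, smul_eq_mul]
  ring

section Conformal

variable {c : ℝ → ℝ} {x : E3}

theorem conormalSq_conformalMetric (hx : x ≠ 0) (hc : c ‖x‖ ≠ 0) :
    conormalSq (conformalMetric c) x = (c ‖x‖ ^ 2)⁻¹ := by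
  have hr : ‖x‖ ≠ 0 := norm_ne_zero_iff.2 hx
  have e : conormalSq (conformalMetric c) x =
      (c ‖x‖ ^ 2)⁻¹ * ((x 0 ^ 2 + x 1 ^ 2 + x 2 ^ 2) / ‖x‖ ^ 2) := by
    simp only [conormalSq, conformalMetric_inv_apply hc, Matrix.one_apply, Fin.sum_univ_three,
      Fin.isValue]
    simp
    ring
  rw [e, ← norm_sq_eq_sum, div_self (pow_ne_zero 2 hr), mul_one]

theorem sphereAreaDensity_conformalMetric (hx : x ≠ 0) (hc : 0 < c ‖x‖) :
    sphereAreaDensity (conformalMetric c) x = c ‖x‖ ^ 2 := by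
  rw [sphereAreaDensity, volumeDensity_conformalMetric hc.le, conormalSq_conformalMetric hx hc.ne',
    Real.sqrt_inv, Real.sqrt_sq hc.le]
  field_simp

theorem sphereNormal_conformalMetric (hx : x ≠ 0) (hc : 0 < c ‖x‖) :
    sphereNormal (conformalMetric c) x = (c ‖x‖ * ‖x‖)⁻¹ • x := by
  have hr : ‖x‖ ≠ 0 := norm_ne_zero_iff.2 hx
  ext i
  simp only [sphereNormal, conormalSq_conformalMetric hx hc.ne', Real.sqrt_inv,
    Real.sqrt_sq hc.le, conformalMetric_inv_apply hc.ne', Matrix.one_apply]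
  simp
  field_simp

theorem sphereArea_conformalMetric {r : ℝ} (hr : 0 < r) (hc : 0 < c r) :
    sphereArea (conformalMetric c) r = 4 * Real.pi * (r * c r) ^ 2 := by
  rw [sphereArea, sphereIntegral_eq_of_const (c := c r ^ 2) hr.le]
  · ring
  · rintro x rfl
    exact sphereAreaDensity_conformalMetric (norm_pos_iff.1 hr) hc

theorem sphereCharge_conformalMetric {r e : ℝ} {X : E3 → E3} (hr : 0 < r) (hc : 0 < c r)
    (hX : ∀ x, ‖x‖ = r → X x = e • x) :
    sphereCharge (conformalMetric c) X r = e * (r * c r) ^ 3 := by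
  rw [sphereCharge, sphereIntegral_eq_of_const (c := c r ^ 3 * e * r) hr.le]
  · field_simp
  · intro x hxr
    have hx : x ≠ 0 := by rw [← norm_ne_zero_iff, hxr]; exact hr.ne'
    rw [sphereNormal_conformalMetric hx (by rwa [hxr]),
      sphereAreaDensity_conformalMetric hx (by rwa [hxr]), gInner_conformalMetric, hX x hxr,
      inner_smul_left, inner_smul_right, real_inner_self_eq_norm_sq, hxr]
    simp only [conj_trivial]
    field_simp

theorem admIntegral_conformalMetric {r c' : ℝ} (hr : 0 < r) (hc : HasDerivAt c c' r) :
    1 / (16 * Real.pi) * sphereIntegral r (fun x =>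
      ∑ i, ∑ j, (pd j (fun y => conformalMetric c y i j) x -
        pd i (fun y => conformalMetric c y j j) x) * (x i / ‖x‖)) = -(r ^ 2 * c r * c') := by
  rw [sphereIntegral_eq_of_const (c := -4 * c r * c') hr.le]
  · field_simp
    norm_num
  · rintro x rfl
    have hx : x ≠ 0 := norm_pos_iff.1 hr
    simp only [pd_conformalMetric hx hc]
    have e : ‖x‖ ^ 2 / ‖x‖ ^ 2 = 1 := div_self (pow_ne_zero 2 hr.ne')
    calc _ = -4 * c ‖x‖ * c' * ((x 0 ^ 2 + x 1 ^ 2 + x 2 ^ 2) / ‖x‖ ^ 2) := by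
          simp only [Fin.sum_univ_three, Matrix.one_apply, Fin.isValue]
          simp
          ring
      _ = _ := by rw [← norm_sq_eq_sum, e, mul_one]

/-- A radial field with `√(det g) X = q x / |x|³` is divergence free. -/
theorem divergence_conformalMetric_eq_zero {X : E3 → E3} {q : ℝ} (hx : x ≠ 0)
    (hX : ∀ᶠ y in 𝓝 x, volumeDensity (conformalMetric c) y • X y = (q / ‖y‖ ^ 3) • y) :
    divergence (conformalMetric c) X x = 0 := by
  have hr : ‖x‖ ≠ 0 := norm_ne_zero_iff.2 hx
  have hd : HasDerivAt (fun r : ℝ => q / r ^ 3) (-3 * q / ‖x‖ ^ 4) ‖x‖ := by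
    refine ((hasDerivAt_const _ q).div (hasDerivAt_pow 3 _) (pow_ne_zero 3 hr)).congr_deriv ?_
    field_simp
    ring
  have hpd : ∀ i, pd i (fun y => volumeDensity (conformalMetric c) y * X y i) x =
      -3 * q / ‖x‖ ^ 5 * x i ^ 2 + q / ‖x‖ ^ 3 := fun i => by
    have e : (fun y => volumeDensity (conformalMetric c) y * X y i) =ᶠ[𝓝 x]
        fun y => q / ‖y‖ ^ 3 * y i := by
      filter_upwards [hX] with y hy
      simpa using congrArg (fun z : E3 => z i) hy
    rw [pd_congr e, pd_radial_mul (F := fun r => q / r ^ 3) hx hd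
      (hasFDerivAt_coord i x).differentiableAt, pd_coord]
    simp
    field_simp
  have hsum : ∑ i, pd i (fun y => volumeDensity (conformalMetric c) y * X y i) x = 0 := by
    simp only [hpd, Fin.sum_univ_three]
    have : -3 * q / ‖x‖ ^ 5 * x 0 ^ 2 + q / ‖x‖ ^ 3 + (-3 * q / ‖x‖ ^ 5 * x 1 ^ 2 + q / ‖x‖ ^ 3) +
        (-3 * q / ‖x‖ ^ 5 * x 2 ^ 2 + q / ‖x‖ ^ 3) =
        -3 * q / ‖x‖ ^ 5 * (x 0 ^ 2 + x 1 ^ 2 + x 2 ^ 2) + 3 * (q / ‖x‖ ^ 3) := by ring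
    rw [this, ← norm_sq_eq_sum]
    field_simp
    ring
  rw [divergence, hsum, zero_div]

end Conformal

/-! ### Isometries between spherically symmetric conformally flat metrics -/

/-- `G` is differentiated only within `t`, because `F x` might a priori lie on the boundary of `t`.
-/
theorem fderivWithin_comp_eq_id {E : Type*} [NormedAddCommGroup E] [NormedSpace ℝ E]
    {F G : E → E} {A B : E →L[ℝ] E} {s t : Set E} {x : E} (hF : HasFDerivAt F A x)
    (hG : HasFDerivWithinAt G B t (F x)) (hs : s ∈ 𝓝 x) (hmaps : Set.MapsTo F s t)
    (hinv : Set.LeftInvOn G F s) : B ∘L A = ContinuousLinearMap.id ℝ E := by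
  have h := hG.comp_hasFDerivAt x hF (by filter_upwards [hs] with y hy using hmaps hy)
  have hid : G ∘ F =ᶠ[𝓝 x] id := by filter_upwards [hs] with y hy using hinv hy
  exact h.unique ((hasFDerivAt_id x).congr_of_eventuallyEq hid)

theorem exterior_mem_nhds_iff {a : ℝ} (ha : 0 < a) {x : E3} : exterior a ∈ 𝓝 x ↔ a < ‖x‖ := by
  have h : exterior a = (Metric.ball (0 : E3) a)ᶜ := by ext y; simp [exterior]
  rw [h, ← mem_interior_iff_mem_nhds, interior_compl, closure_ball _ ha.ne']
  simp

/-- The left inverse makes the derivative of `F` at an interior point injective, hence bijective. So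
`F` is open there, and the image point is interior as well. -/
theorem lt_norm_of_leftInvOn {a a' : ℝ} (ha : 0 < a) (ha' : 0 < a') {F G : E3 → E3}
    (hF : ContDiffOn ℝ ∞ F (exterior a)) (hG : ContDiffOn ℝ ∞ G (exterior a'))
    (hmaps : Set.MapsTo F (exterior a) (exterior a')) (hinv : Set.LeftInvOn G F (exterior a))
    {x : E3} (hx : a < ‖x‖) : a' < ‖F x‖ := by
  have hnhds := (exterior_mem_nhds_iff ha).2 hx
  have hFx : ContDiffAt ℝ 1 F x := contDiffAt_infty.1 (hF.contDiffAt hnhds) 1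
  have hstrict := hFx.hasStrictFDerivAt (by norm_num)
  have hG' := ((hG.differentiableOn (by simp)) (F x) (hmaps hx.le)).hasFDerivWithinAt
  have hcomp := fderivWithin_comp_eq_id hstrict.hasFDerivAt hG' hnhds hmaps hinv
  have hinj : Function.Injective (fderiv ℝ F x) := by
    refine Function.LeftInverse.injective (g := fderivWithin ℝ G (exterior a') (F x)) fun v => ?_
    exact congrArg (fun A => A v) hcomp
  have hsurj : Function.Surjective (fderiv ℝ F x) :=
    LinearMap.injective_iff_surjective (f := (fderiv ℝ F x).toLinearMap).1 hinj
  have hmap := hstrict.map_nhds_eq_of_surj (LinearMap.range_eq_top.2 hsurj)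
  rw [← exterior_mem_nhds_iff ha', ← hmap]
  exact mem_map.2 (mem_of_superset hnhds hmaps)

/-- `F : {|x| ≥ a} → {|x| ≥ a'}` is a diffeomorphism with inverse `G` and an isometry of the
interiors for the metrics `c(|x|)² δ` and `c'(|x|)² δ`. -/
structure IsConformalIsometry (c : ℝ → ℝ) (a : ℝ) (c' : ℝ → ℝ) (a' : ℝ) (F G : E3 → E3) :
    Prop where
  smooth : ContDiffOn ℝ ∞ F (exterior a)
  smooth_inv : ContDiffOn ℝ ∞ G (exterior a')
  mapsTo : Set.MapsTo F (exterior a) (exterior a')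
  mapsTo_inv : Set.MapsTo G (exterior a') (exterior a)
  leftInvOn : Set.LeftInvOn G F (exterior a)
  rightInvOn : Set.LeftInvOn F G (exterior a')
  isometry : ∀ x : E3, a < ‖x‖ → ∀ v w : E3,
    c' ‖F x‖ ^ 2 * inner ℝ (fderiv ℝ F x v) (fderiv ℝ F x w) = c ‖x‖ ^ 2 * inner ℝ v w

section Isometry

variable {c c' : ℝ → ℝ} {a a' : ℝ} {F G : E3 → E3}

theorem InitialData.AreIsometric.exists_isConformalIsometry (ha : 0 < a)
    (h : InitialData.AreIsometric (conformalMetric c) a (conformalMetric c') a') :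
    ∃ F G, IsConformalIsometry c a c' a' F G := by
  obtain ⟨F, G, h1, h2, h3, h4, h5, h6, h7⟩ := h
  refine ⟨F, G, h1, h2, h3, h4, h5, h6, fun x hx v w => ?_⟩
  have := h7 x hx.le v w
  rwa [gInner_conformalMetric, gInner_conformalMetric,
    fderivWithin_of_mem_nhds ((exterior_mem_nhds_iff ha).2 hx)] at this

namespace IsConformalIsometry

theorem contDiffAt (h : IsConformalIsometry c a c' a' F G) (ha : 0 < a) {x : E3}
    (hx : a < ‖x‖) : ContDiffAt ℝ ∞ F x :=
  h.smooth.contDiffAt ((exterior_mem_nhds_iff ha).2 hx)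

theorem hasFDerivAt (h : IsConformalIsometry c a c' a' F G) (ha : 0 < a) {x : E3}
    (hx : a < ‖x‖) : HasFDerivAt F (fderiv ℝ F x) x :=
  ((h.contDiffAt ha hx).differentiableAt (by simp)).hasFDerivAt

theorem lt_norm (h : IsConformalIsometry c a c' a' F G) (ha : 0 < a) (ha' : 0 < a') {x : E3}
    (hx : a < ‖x‖) : a' < ‖F x‖ :=
  lt_norm_of_leftInvOn ha ha' h.smooth h.smooth_inv h.mapsTo h.leftInvOn hx

theorem symm (h : IsConformalIsometry c a c' a' F G) (ha : 0 < a) (ha' : 0 < a') :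
    IsConformalIsometry c' a' c a G F := by
  refine ⟨h.smooth_inv, h.smooth, h.mapsTo_inv, h.mapsTo, h.rightInvOn, h.leftInvOn,
    fun y hy v w => ?_⟩
  have hGy : a < ‖G y‖ :=
    lt_norm_of_leftInvOn ha' ha h.smooth_inv h.smooth h.mapsTo_inv h.rightInvOn hy
  have hnhds := (exterior_mem_nhds_iff ha').2 hy
  have hG := ((h.smooth_inv.contDiffAt hnhds).differentiableAt (by simp)).hasFDerivAt
  have hcomp := fderivWithin_comp_eq_id hG (h.hasFDerivAt ha hGy).hasFDerivWithinAt hnhds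
    (fun _ _ => Set.mem_univ _) h.rightInvOn
  have := h.isometry (G y) hGy (fderiv ℝ G y v) (fderiv ℝ G y w)
  have happ : ∀ v, fderiv ℝ F (G y) (fderiv ℝ G y v) = v := fun v =>
    congrArg (fun A => A v) hcomp
  rw [happ, happ, h.rightInvOn hy.le] at this
  exact this.symm

/-- If the image were interior, the inverse would send it to an interior point. -/
theorem norm_eq_of_norm_eq (h : IsConformalIsometry c a c' a' F G) (ha : 0 < a) (ha' : 0 < a')
    {x : E3} (hx : ‖x‖ = a) : ‖F x‖ = a' := by
  have hmem : x ∈ exterior a := hx.ge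
  refine le_antisymm ?_ (h.mapsTo hmem)
  by_contra! hlt
  have := (h.symm ha ha').lt_norm ha' ha hlt
  rw [h.leftInvOn hmem, hx] at this
  exact lt_irrefl _ this

theorem norm_fderiv (h : IsConformalIsometry c a c' a' F G) (hc : ∀ r, 0 < r → 0 < c r)
    (hc' : ∀ r, 0 < r → 0 < c' r) (ha : 0 < a) (ha' : 0 < a') {x : E3} (hx : a < ‖x‖) (v : E3) :
    c' ‖F x‖ * ‖fderiv ℝ F x v‖ = c ‖x‖ * ‖v‖ := by
  have h1 := h.isometry x hx v v
  rw [real_inner_self_eq_norm_sq, real_inner_self_eq_norm_sq, ← mul_pow, ← mul_pow] at h1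
  have hp := hc _ (ha.trans hx)
  have hp' := hc' _ (ha'.trans (h.lt_norm ha ha' hx))
  exact (sq_eq_sq₀ (by positivity) (by positivity)).1 h1

/-- Rescaled by `c'/c`, the derivative is a linear isometry and has determinant `±1`. This is the
preservation of volume. -/
theorem abs_det_fderiv (h : IsConformalIsometry c a c' a' F G) (hc : ∀ r, 0 < r → 0 < c r)
    (hc' : ∀ r, 0 < r → 0 < c' r) (ha : 0 < a) (ha' : 0 < a') {x : E3} (hx : a < ‖x‖) :
    |(fderiv ℝ F x).det| * c' ‖F x‖ ^ 3 = c ‖x‖ ^ 3 := by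
  have hp := hc _ (ha.trans hx)
  have hp' := hc' _ (ha'.trans (h.lt_norm ha ha' hx))
  let I : E3 →ₗᵢ[ℝ] E3 :=
    { toLinearMap := (c' ‖F x‖ / c ‖x‖) • (fderiv ℝ F x).toLinearMap
      norm_map' := fun v => by
        have := h.norm_fderiv hc hc' ha ha' hx v
        change ‖(c' ‖F x‖ / c ‖x‖) • fderiv ℝ F x v‖ = ‖v‖
        rw [norm_smul, Real.norm_of_nonneg (by positivity), div_mul_eq_mul_div, this]
        field_simp }
  have hI : I.toLinearMap.normDet = 1 := I.normDet_eq_one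
  rw [LinearMap.normDet_eq_abs_det] at hI
  change |LinearMap.det ((c' ‖F x‖ / c ‖x‖) • (fderiv ℝ F x).toLinearMap)| = 1 at hI
  rw [LinearMap.det_smul, abs_mul, abs_of_pos (by positivity)] at hI
  simp only [finrank_euclideanSpace, Fintype.card_fin] at hI
  change _ * |(fderiv ℝ F x).det| = 1 at hI
  rw [div_pow, div_mul_eq_mul_div, div_eq_iff (by positivity)] at hI
  linarith

/-- Isometries do not increase the distance to the boundary. -/
theorem dist_boundary_le (h : IsConformalIsometry c a c' a' F G) (hc : ∀ r, 0 < r → 0 < c r)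
    (hc' : ∀ r, 0 < r → 0 < c' r) (ha : 0 < a) (ha' : 0 < a') {T T' : ℝ → ℝ}
    (hT : ∀ r, 0 < r → HasDerivAt T (c r) r) (hT' : ∀ r, 0 < r → HasDerivAt T' (c' r) r)
    {x : E3} (hx : a ≤ ‖x‖) : T' ‖F x‖ - T' a' ≤ T ‖x‖ - T a := by
  have hr : 0 < ‖x‖ := ha.trans_le hx
  set u : E3 := ‖x‖⁻¹ • x with hu
  have hu1 : ‖u‖ = 1 := by rw [hu, norm_smul, norm_inv, norm_norm, inv_mul_cancel₀ hr.ne']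
  have hnorm : ∀ t : ℝ, 0 < t → ‖t • u‖ = t := fun t ht => by
    rw [norm_smul, hu1, mul_one, Real.norm_of_nonneg ht.le]
  have hxu : ‖x‖ • u = x := by rw [hu, smul_smul, mul_inv_cancel₀ hr.ne', one_smul]
  have hline : ∀ t : ℝ, HasDerivAt (fun t : ℝ => t • u) u t := fun t => by
    simpa using (hasDerivAt_id t).smul_const u
  have hpos : ∀ t ∈ Set.Icc a ‖x‖, 0 < t := fun t ht => ha.trans_le ht.1
  have hmem : ∀ t ∈ Set.Icc a ‖x‖, t • u ∈ exterior a := fun t ht => by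
    change a ≤ ‖t • u‖
    rw [hnorm t (hpos t ht)]
    exact ht.1
  have hFpos : ∀ t ∈ Set.Icc a ‖x‖, 0 < ‖F (t • u)‖ := fun t ht =>
    ha'.trans_le (h.mapsTo (hmem t ht))
  have hcont : ContinuousOn (fun t => T t - T' ‖F (t • u)‖) (Set.Icc a ‖x‖) := by
    refine ContinuousOn.sub (fun t ht => (hT t (hpos t ht)).continuousAt.continuousWithinAt) ?_
    have h1 : ContinuousOn (fun t : ℝ => ‖F (t • u)‖) (Set.Icc a ‖x‖) :=
      (h.smooth.continuousOn.comp (by fun_prop) hmem).norm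
    have h2 : ContinuousOn T' (Set.Ioi 0) := fun r hr =>
      (hT' r hr).continuousAt.continuousWithinAt
    exact h2.comp h1 hFpos
  -- `T` and `T'` measure radial length. Along the ray through `x` the image curve has `g'`-speed `c
  -- t`, and its radial distance cannot grow faster than that.
  have hderiv : ∀ t ∈ Set.Ioo a ‖x‖, ∃ d : ℝ, 0 ≤ d ∧
      HasDerivAt (fun t => T t - T' ‖F (t • u)‖) d t := fun t ht => by
    have htI := Set.Ioo_subset_Icc_self ht
    have ht0 := hpos t htI
    have hlt : a < ‖t • u‖ := by rw [hnorm t ht0]; exact ht.1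
    have hFt := hFpos t htI
    have h1 : HasDerivAt (fun t : ℝ => F (t • u)) (fderiv ℝ F (t • u) u) t :=
      (h.hasFDerivAt ha hlt).comp_hasDerivAt t (hline t)
    have h2 := (hasFDerivAt_norm_of_ne_zero (norm_pos_iff.1 hFt)).comp_hasDerivAt t h1
    have h3 := (hT' _ hFt).comp t h2
    refine ⟨_, ?_, (hT t ht0).sub h3⟩
    have h4 := h.norm_fderiv hc hc' ha ha' hlt u
    rw [hnorm t ht0, hu1, mul_one] at h4
    rw [sub_nonneg, ← h4]
    refine mul_le_mul_of_nonneg_left ?_ (hc' _ hFt).le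
    simp only [_root_.smul_apply, innerSL_apply_apply, smul_eq_mul]
    rw [inv_mul_le_iff₀ hFt]
    exact real_inner_le_norm _ _
  have hmono : MonotoneOn (fun t => T t - T' ‖F (t • u)‖) (Set.Icc a ‖x‖) := by
    refine monotoneOn_of_deriv_nonneg (convex_Icc _ _) hcont ?_ ?_
    · rw [interior_Icc]
      intro t ht
      obtain ⟨d, -, hd⟩ := hderiv t ht
      exact hd.differentiableAt.differentiableWithinAt
    · rw [interior_Icc]
      intro t ht
      obtain ⟨d, hd0, hd⟩ := hderiv t ht
      rwa [hd.deriv]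
  have := hmono (Set.left_mem_Icc.2 hx) (Set.right_mem_Icc.2 hx) hx
  simp only [hxu] at this
  rw [h.norm_eq_of_norm_eq ha ha' (hnorm a ha)] at this
  linarith

/-- The reverse inequality is the same estimate for the inverse isometry. -/
theorem dist_boundary_eq (h : IsConformalIsometry c a c' a' F G) (hc : ∀ r, 0 < r → 0 < c r)
    (hc' : ∀ r, 0 < r → 0 < c' r) (ha : 0 < a) (ha' : 0 < a') {T T' : ℝ → ℝ}
    (hT : ∀ r, 0 < r → HasDerivAt T (c r) r) (hT' : ∀ r, 0 < r → HasDerivAt T' (c' r) r)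
    {x : E3} (hx : a ≤ ‖x‖) : T' ‖F x‖ - T' a' = T ‖x‖ - T a := by
  refine le_antisymm (h.dist_boundary_le hc hc' ha ha' hT hT' hx) ?_
  have := (h.symm ha ha').dist_boundary_le hc' hc ha' ha hT' hT (x := F x) (h.mapsTo hx)
  rwa [h.leftInvOn hx] at this

end IsConformalIsometry

end Isometry

theorem exists_hasDerivAt_of_continuousOn {f : ℝ → ℝ} (hf : ContinuousOn f (Set.Ioi 0)) :
    ∃ T : ℝ → ℝ, ∀ r, 0 < r → HasDerivAt T (f r) r := by
  refine ⟨fun r => ∫ t in (1 : ℝ)..r, f t, fun r hr => ?_⟩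
  refine intervalIntegral.integral_hasDerivAt_right ?_
    (hf.stronglyMeasurableAtFilter isOpen_Ioi r hr) (hf.continuousAt (Ioi_mem_nhds hr))
  refine ContinuousOn.intervalIntegrable (hf.mono fun t ht => ?_)
  exact lt_of_lt_of_le (lt_min one_pos hr) ht.1

theorem setIntegral_annulus {f W : ℝ → ℝ} {a R : ℝ} (ha : 0 < a) (hR : a ≤ R)
    (hf : ContinuousOn f (Set.Ioi 0)) (hW : ∀ r, 0 < r → HasDerivAt W (r ^ 2 * f r) r) :
    ∫ x in {x : E3 | a < ‖x‖ ∧ ‖x‖ < R}, f ‖x‖ = 4 * Real.pi * (W R - W a) := by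
  have hmeas : MeasurableSet {x : E3 | a < ‖x‖ ∧ ‖x‖ < R} :=
    (measurableSet_lt measurable_const measurable_norm).inter
      (measurableSet_lt measurable_norm measurable_const)
  have e : ∀ x : E3, Set.indicator {x : E3 | a < ‖x‖ ∧ ‖x‖ < R} (fun x => f ‖x‖) x =
      Set.indicator (Set.Ioo a R) f ‖x‖ := fun x => by
    simp only [Set.indicator, Set.mem_ofPred_eq, Set.mem_Ioo]
  rw [← integral_indicator hmeas]
  simp only [e]
  rw [integral_fun_norm_addHaar volume (Set.indicator (Set.Ioo a R) f)]
  have hvol : (volume : Measure E3).real (Metric.ball 0 1) = Real.pi * 4 / 3 := by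
    rw [measureReal_def, EuclideanSpace.volume_ball_fin_three, ENNReal.toReal_mul,
      ENNReal.toReal_ofReal (by positivity)]
    simp
  have e2 : ∀ y : ℝ, y ^ (3 - 1) • Set.indicator (Set.Ioo a R) f y =
      Set.indicator (Set.Ioo a R) (fun y => y ^ 2 * f y) y := fun y => by
    by_cases hy : y ∈ Set.Ioo a R <;> simp [hy]
  have hI : ∫ y in Set.Ioi (0 : ℝ), Set.indicator (Set.Ioo a R) (fun y => y ^ 2 * f y) y =
      W R - W a := by
    have hsub : Set.uIcc a R ⊆ Set.Ioi 0 := fun t ht => by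
      rw [Set.uIcc_of_le hR] at ht
      exact ha.trans_le ht.1
    rw [setIntegral_indicator measurableSet_Ioo,
      Set.inter_eq_right.2 (show Set.Ioo a R ⊆ Set.Ioi 0 from fun t ht => ha.trans ht.1),
      ← integral_Ioc_eq_integral_Ioo, ← intervalIntegral.integral_of_le hR]
    refine intervalIntegral.integral_eq_sub_of_hasDerivAt (fun t ht => hW t (hsub ht)) ?_
    exact ContinuousOn.intervalIntegrable
      ((continuousOn_pow 2).mul (hf.mono hsub))
  simp only [finrank_euclideanSpace, Fintype.card_fin, hvol, e2, hI]
  simp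
  ring

/-- An isometry matches coordinate spheres with the same area radius `r c(r)` and the same
derivative of the area radius in the normal direction. -/
theorem IsConformalIsometry.exists_areaRadius_eq {c c' c₁ c₁' : ℝ → ℝ} {a a' : ℝ} {F G : E3 → E3}
    (h : IsConformalIsometry c a c' a' F G) (hc : ∀ r, 0 < r → 0 < c r)
    (hc' : ∀ r, 0 < r → 0 < c' r) (hd : ∀ r, 0 < r → HasDerivAt c (c₁ r) r)
    (hd' : ∀ r, 0 < r → HasDerivAt c' (c₁' r) r) (ha : 0 < a) (ha' : 0 < a') {R : ℝ}
    (hR : a < R) : ∃ ρ, 0 < ρ ∧ ρ * c' ρ = R * c R ∧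
      ρ * (c' ρ + ρ * c₁' ρ) = R * (c R + R * c₁ R) := by
  have hcont : ContinuousOn c (Set.Ioi 0) := fun r hr => (hd r hr).continuousAt.continuousWithinAt
  have hcont' : ContinuousOn c' (Set.Ioi 0) := fun r hr =>
    (hd' r hr).continuousAt.continuousWithinAt
  obtain ⟨T, hT⟩ := exists_hasDerivAt_of_continuousOn hcont
  obtain ⟨T', hT'⟩ := exists_hasDerivAt_of_continuousOn hcont'
  obtain ⟨W, hW⟩ := exists_hasDerivAt_of_continuousOn
    (f := fun r => r ^ 2 * c r ^ 3) ((continuousOn_pow 2).mul (hcont.pow 3))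
  obtain ⟨W', hW'⟩ := exists_hasDerivAt_of_continuousOn
    (f := fun r => r ^ 2 * c' r ^ 3) ((continuousOn_pow 2).mul (hcont'.pow 3))
  have hmono : ∀ {c T : ℝ → ℝ}, (∀ r, 0 < r → 0 < c r) → (∀ r, 0 < r → HasDerivAt T (c r) r) →
      StrictMonoOn T (Set.Ioi 0) := fun hc hT => by
    refine strictMonoOn_of_deriv_pos (convex_Ioi 0)
      (fun r hr => (hT r hr).continuousAt.continuousWithinAt) fun r hr => ?_
    rw [interior_Ioi] at hr
    rw [(hT r hr).deriv]
    exact hc r hr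
  have hTm := hmono hc hT
  have hTm' := hmono hc' hT'
  obtain ⟨e, he⟩ : ∃ e : E3, ‖e‖ = 1 := ⟨EuclideanSpace.single 0 1, by simp⟩
  -- By `dist_boundary_eq`, `‖F x‖` depends only on `‖x‖`, so any unit vector `e` defines the same
  -- `φ`. No rotational symmetry of `F` is needed.
  set φ : ℝ → ℝ := fun r => ‖F (r • e)‖ with hφ
  have hnorm : ∀ t : ℝ, 0 < t → ‖t • e‖ = t := fun t ht => by
    rw [norm_smul, he, mul_one, Real.norm_of_nonneg ht.le]
  have hdist : ∀ x : E3, a ≤ ‖x‖ → T' ‖F x‖ - T' a' = T ‖x‖ - T a := fun x hx =>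
    h.dist_boundary_eq hc hc' ha ha' hT hT' hx
  have hφlt : ∀ r, a < r → a' < φ r := fun r hr =>
    h.lt_norm ha ha' (by rwa [hnorm r (ha.trans hr)])
  have hφT : ∀ r, a < r → T' (φ r) - T' a' = T r - T a := fun r hr => by
    have := hdist (r • e) (by rw [hnorm r (ha.trans hr)]; exact hr.le)
    rwa [hnorm r (ha.trans hr)] at this
  have himage : ∀ r, a < r → F '' {x : E3 | a < ‖x‖ ∧ ‖x‖ < r} =
      {y : E3 | a' < ‖y‖ ∧ ‖y‖ < φ r} := fun r hr => by
    have hφr := hφlt r hr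
    ext y
    constructor
    · rintro ⟨x, ⟨hx1, hx2⟩, rfl⟩
      have hFx := h.lt_norm ha ha' hx1
      refine ⟨hFx, ?_⟩
      rw [← hTm'.lt_iff_lt (ha'.trans hFx) (ha'.trans hφr)]
      have h1 := (hTm.lt_iff_lt (ha.trans hx1) (ha.trans hr)).2 hx2
      linarith [hφT r hr, hdist x hx1.le]
    · rintro ⟨hy1, hy2⟩
      have hGy := (h.symm ha ha').lt_norm ha' ha hy1
      refine ⟨G y, ⟨hGy, ?_⟩, h.rightInvOn hy1.le⟩
      rw [← hTm.lt_iff_lt (ha.trans hGy) (ha.trans hr)]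
      have h1 := (hTm'.lt_iff_lt (ha'.trans hy1) (ha'.trans hφr)).2 hy2
      have h2 := hdist (G y) hGy.le
      rw [h.rightInvOn hy1.le] at h2
      linarith [hφT r hr]
  -- Up to the factor `4π`, both sides are the volumes of corresponding annuli.
  have hφW : ∀ r, a < r → W' (φ r) - W' a' = W r - W a := fun r hr => by
    have hmeas : MeasurableSet {x : E3 | a < ‖x‖ ∧ ‖x‖ < r} :=
      (measurableSet_lt measurable_const measurable_norm).inter
        (measurableSet_lt measurable_norm measurable_const)
    have h1 := integral_image_eq_integral_abs_det_fderiv_smul volume hmeas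
      (fun x hx => (h.hasFDerivAt ha hx.1).hasFDerivWithinAt)
      (h.leftInvOn.injOn.mono fun x hx => hx.1.le) (fun y => c' ‖y‖ ^ 3)
    rw [himage r hr, setIntegral_annulus ha' (hφlt r hr).le (f := fun r => c' r ^ 3)
      (hcont'.pow 3) hW'] at h1
    have h2 : ∫ x in {x : E3 | a < ‖x‖ ∧ ‖x‖ < r}, |(fderiv ℝ F x).det| • c' ‖F x‖ ^ 3 =
        ∫ x in {x : E3 | a < ‖x‖ ∧ ‖x‖ < r}, c ‖x‖ ^ 3 :=
      setIntegral_congr_fun hmeas fun x hx => h.abs_det_fderiv hc hc' ha ha' hx.1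
    rw [h2, setIntegral_annulus ha hr.le (f := fun r => c r ^ 3) (hcont.pow 3) hW] at h1
    exact mul_left_cancel₀ (by positivity) h1
  have hev : ∀ᶠ r in 𝓝 R, a < r := Ioi_mem_nhds hR
  have hR0 : 0 < R := ha.trans hR
  have hφ0 : ∀ r, a < r → 0 < φ r := fun r hr => ha'.trans (hφlt r hr)
  have hφd : ∀ r, a < r → ∃ d, HasDerivAt φ d r ∧ c' (φ r) * d = c r := fun r hr => by
    have hr0 : 0 < r := ha.trans hr
    have hlt : a < ‖r • e‖ := by rwa [hnorm r hr0]
    have h1 : HasDerivAt (fun t : ℝ => F (t • e)) (fderiv ℝ F (r • e) e) r :=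
      (h.hasFDerivAt ha hlt).comp_hasDerivAt r (by
        simpa using (hasDerivAt_id r).smul_const e)
    have h2 := (hasFDerivAt_norm_of_ne_zero (norm_pos_iff.1 (hφ0 r hr))).comp_hasDerivAt r h1
    refine ⟨_, h2, ?_⟩
    have h3 := (hT' _ (hφ0 r hr)).comp r h2
    have h4 : HasDerivAt (T' ∘ φ) (c r) r := by
      refine ((hT r hr0).sub_const (T a - T' a')).congr_of_eventuallyEq ?_
      filter_upwards [Ioi_mem_nhds hr] with t ht
      have := hφT t ht
      simp only [Function.comp_apply]
      linarith
    exact h3.unique h4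
  -- Differentiating volume and distance gives `φ² c'(φ)³ φ' = r² c³` and `c'(φ) φ' = c`; the
  -- quotient says that the squared area radii agree.
  have hS : ∀ r, a < r → φ r * c' (φ r) = r * c r := fun r hr => by
    have hr0 : 0 < r := ha.trans hr
    obtain ⟨d, hd1, hd2⟩ := hφd r hr
    have h3 := (hW' _ (hφ0 r hr)).comp r hd1
    have h4 : HasDerivAt (W' ∘ φ) (r ^ 2 * c r ^ 3) r := by
      refine ((hW r hr0).sub_const (W a - W' a')).congr_of_eventuallyEq ?_
      filter_upwards [Ioi_mem_nhds hr] with t ht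
      have := hφW t ht
      simp only [Function.comp_apply]
      linarith
    have h5 : φ r ^ 2 * c' (φ r) ^ 3 * d = r ^ 2 * c r ^ 3 := h3.unique h4
    have hcr := hc r hr0
    have hcr' := hc' _ (hφ0 r hr)
    have hφr := hφ0 r hr
    have h6 : (φ r * c' (φ r)) ^ 2 = (r * c r) ^ 2 := by
      have : (φ r * c' (φ r)) ^ 2 * c r = (r * c r) ^ 2 * c r := by
        rw [← hd2]
        rw [← hd2] at h5
        linear_combination h5
      exact mul_right_cancel₀ hcr.ne' this
    exact (sq_eq_sq₀ (by positivity) (by positivity)).1 h6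
  obtain ⟨d, hd1, hd2⟩ := hφd R hR
  have hφR := hφ0 R hR
  refine ⟨φ R, hφR, hS R hR, ?_⟩
  have h1 : HasDerivAt (fun r => φ r * c' (φ r)) _ R := hd1.mul ((hd' _ hφR).comp R hd1)
  have h2 : HasDerivAt (fun r => φ r * c' (φ r)) (1 * c R + R * c₁ R) R := by
    refine ((hasDerivAt_id R).mul (hd R hR0)).congr_of_eventuallyEq ?_
    filter_upwards [hev] with t ht using hS t ht
  have h3 := h1.unique h2
  have hcR := hc R hR0
  -- This comes from `φ c'(φ) = R c` and `c'(φ) φ' = c`. It converts the derivative of the identity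
  -- of area radii into the scale-invariant form of the claim.
  have hd0 : R * d = φ R := by
    have h4 := hS R hR
    rw [← hd2] at h4
    have := hc' _ hφR
    refine mul_right_cancel₀ this.ne' ?_
    linarith
  linear_combination R * h3 - (c' (φ R) + φ R * c₁' (φ R)) * hd0

/-! ### Area radius profiles -/

section Profile

variable {S S₁ S₂ : ℝ → ℝ}

theorem hasDerivAt_profile_div {r : ℝ} (hr : 0 < r) (h : HasDerivAt S (S₁ r) r) :
    HasDerivAt (fun r => S r / r) (S₁ r / r - S r / r ^ 2) r := by
  refine (h.div (hasDerivAt_id r) hr.ne').congr_deriv ?_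
  simp only [id]
  field_simp

theorem hasDerivAt_profile_div_deriv {r : ℝ} (hr : 0 < r) (h : HasDerivAt S (S₁ r) r)
    (h₂ : HasDerivAt S₁ (S₂ r) r) : HasDerivAt (fun r => S₁ r / r - S r / r ^ 2)
      (S₂ r / r - 2 * S₁ r / r ^ 2 + 2 * S r / r ^ 3) r := by
  refine ((h₂.div (hasDerivAt_id r) hr.ne').sub
    (h.div (hasDerivAt_pow 2 r) (pow_ne_zero 2 hr.ne'))).congr_deriv ?_
  simp only [id]
  field_simp
  ring

/-- `R S⁴ / 2` for the scalar curvature `R` of the metric with area radius `S`, expressed through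
the values of `r`, `S`, `S'` and `S''`. -/
def curvatureCharge (r s s₁ s₂ : ℝ) : ℝ := s ^ 2 + r ^ 2 * s₁ ^ 2 - 2 * r * s * (s₁ + r * s₂)

theorem scalarCurvature_profile (hpos : ∀ r, 0 < r → 0 < S r)
    (h₁ : ∀ r, 0 < r → HasDerivAt S (S₁ r) r) (h₂ : ∀ r, 0 < r → HasDerivAt S₁ (S₂ r) r)
    {x : E3} (hx : x ≠ 0) : scalarCurvature (conformalMetric fun r => S r / r) x =
      2 * curvatureCharge ‖x‖ (S ‖x‖) (S₁ ‖x‖) (S₂ ‖x‖) / S ‖x‖ ^ 4 := by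
  have hr : 0 < ‖x‖ := norm_pos_iff.2 hx
  have hS := hpos _ hr
  rw [scalarCurvature_conformalMetric (fun r hr => div_pos (hpos r hr) hr)
    (fun r hr => hasDerivAt_profile_div hr (h₁ r hr))
    (fun r hr => hasDerivAt_profile_div_deriv hr (h₁ r hr) (h₂ r hr)) hx, curvatureCharge]
  field_simp
  ring

end Profile

/-! ### The Reissner–Nordström profile. -/

/-- The area radius of the Reissner-Nordström slice as a function of the isotropic radius. -/
def rnRadius (m q r : ℝ) : ℝ := r + m + (m ^ 2 - q ^ 2) / (4 * r)

def rnRadiusDeriv (m q r : ℝ) : ℝ := 1 - (m ^ 2 - q ^ 2) / (4 * r ^ 2)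

def rnRadiusDerivTwo (m q r : ℝ) : ℝ := (m ^ 2 - q ^ 2) / (2 * r ^ 3)

theorem reissnerNordstrom_metric (m q : ℝ) :
    (reissnerNordstrom m q).metric = conformalMetric fun r => rnRadius m q r / r := rfl

section RN

variable {m q r : ℝ}

theorem hasDerivAt_rnRadius (hr : 0 < r) :
    HasDerivAt (rnRadius m q) (rnRadiusDeriv m q r) r := by
  have h : HasDerivAt (fun r : ℝ => 4 * r) (4 * 1) r := (hasDerivAt_id r).const_mul 4
  refine (((hasDerivAt_id r).add_const m).add
    ((hasDerivAt_const r (m ^ 2 - q ^ 2)).div h (by positivity))).congr_deriv ?_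
  simp only [rnRadiusDeriv]
  field_simp
  ring

theorem hasDerivAt_rnRadiusDeriv (hr : 0 < r) :
    HasDerivAt (rnRadiusDeriv m q) (rnRadiusDerivTwo m q r) r := by
  have h : HasDerivAt (fun r : ℝ => 4 * r ^ 2) (4 * (2 * r)) r := by
    simpa using (hasDerivAt_pow 2 r).const_mul 4
  refine (((hasDerivAt_const r (m ^ 2 - q ^ 2)).div h (by positivity)).const_sub 1).congr_deriv ?_
  simp only [rnRadiusDerivTwo]
  field_simp
  ring

theorem sq_sub_sq_pos (h : |q| < m) : 0 < m ^ 2 - q ^ 2 := by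
  have h1 := sq_abs q
  have h2 := abs_nonneg q
  nlinarith

theorem add_le_rnRadius (h : |q| < m) (hr : 0 < r) : r + m ≤ rnRadius m q r := by
  have := div_pos (sq_sub_sq_pos h) (by positivity : 0 < 4 * r)
  rw [rnRadius]
  linarith

theorem rnRadius_pos (h : |q| < m) (hr : 0 < r) : 0 < rnRadius m q r := by
  have := add_le_rnRadius h hr
  have := abs_nonneg q
  linarith

/-- This is equality in the charged energy condition: `R = 2q²/s⁴ = 2|E|²`. -/
theorem curvatureCharge_rn (hr : 0 < r) :
    curvatureCharge r (rnRadius m q r) (rnRadiusDeriv m q r) (rnRadiusDerivTwo m q r) = q ^ 2 := by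
  simp only [curvatureCharge, rnRadius, rnRadiusDeriv, rnRadiusDerivTwo]
  field_simp
  ring

/-- For arc length `t` in the normal direction, `r s' = s ds/dt`, so this is `(ds/dt)² = 1 - 2m/s +
q²/s²`. The relation is geometric and serves to recognize mass and charge under isometries. -/
theorem mul_rnRadiusDeriv_sq (hr : 0 < r) : (r * rnRadiusDeriv m q r) ^ 2 =
    rnRadius m q r ^ 2 - 2 * m * rnRadius m q r + q ^ 2 := by
  simp only [rnRadius, rnRadiusDeriv]
  field_simp
  ring

theorem rnHorizon_pos (h : |q| < m) : 0 < rnHorizon m q := by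
  have := Real.sqrt_pos.2 (sq_sub_sq_pos h)
  rw [rnHorizon]
  linarith

theorem rnHorizon_sq (h : |q| < m) : 4 * rnHorizon m q ^ 2 = m ^ 2 - q ^ 2 := by
  rw [rnHorizon, div_pow, Real.sq_sqrt (sq_sub_sq_pos h).le]
  ring

theorem rnRadius_rnHorizon (h : |q| < m) :
    rnRadius m q (rnHorizon m q) = m + Real.sqrt (m ^ 2 - q ^ 2) := by
  have h1 := rnHorizon_pos h
  rw [rnRadius, ← rnHorizon_sq h, show Real.sqrt (4 * rnHorizon m q ^ 2) = 2 * rnHorizon m q by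
    rw [show 4 * rnHorizon m q ^ 2 = (2 * rnHorizon m q) ^ 2 by ring,
      Real.sqrt_sq (by positivity)]]
  field_simp
  ring

theorem rnRadiusDeriv_rnHorizon (h : |q| < m) : rnRadiusDeriv m q (rnHorizon m q) = 0 := by
  have h1 := rnHorizon_pos h
  rw [rnRadiusDeriv, ← rnHorizon_sq h]
  field_simp
  ring

theorem rnRadiusDeriv_mono (h : |q| < m) {r r' : ℝ} (hr : 0 < r) (hrr : r ≤ r') :
    rnRadiusDeriv m q r ≤ rnRadiusDeriv m q r' := by
  have := sq_sub_sq_pos h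
  rw [rnRadiusDeriv, rnRadiusDeriv]
  gcongr

theorem rnRadiusDeriv_pos (h : |q| < m) (hr : rnHorizon m q < r) : 0 < rnRadiusDeriv m q r := by
  have h1 := rnHorizon_pos h
  have h2 : 0 < r := h1.trans hr
  rw [rnRadiusDeriv, ← rnHorizon_sq h, sub_pos, div_lt_one (by positivity)]
  gcongr

theorem continuousOn_rnRadius : ContinuousOn (rnRadius m q) (Set.Ioi 0) := fun _ hr =>
  (hasDerivAt_rnRadius hr).continuousAt.continuousWithinAt

theorem continuousOn_rnRadiusDeriv : ContinuousOn (rnRadiusDeriv m q) (Set.Ioi 0) := fun _ hr =>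
  (hasDerivAt_rnRadiusDeriv hr).continuousAt.continuousWithinAt

theorem continuousOn_rnRadiusDerivTwo : ContinuousOn (rnRadiusDerivTwo m q) (Set.Ioi 0) := by
  unfold rnRadiusDerivTwo
  refine ContinuousOn.div (by fun_prop) (by fun_prop) fun r hr => ?_
  have : 0 < r := hr
  positivity

theorem contDiffAt_rnRadius (hr : r ≠ 0) : ContDiffAt ℝ ∞ (rnRadius m q) r := by
  unfold rnRadius
  refine (contDiffAt_id.add contDiffAt_const).add (contDiffAt_const.div ?_ (by positivity))
  exact contDiffAt_const.mul contDiffAt_id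

/-! ### Decay of the Reissner-Nordström fields -/

theorem decaysTwo_rn_metric (h : |q| < m) :
    InitialData.DecaysTwo 1 fun x => (rnRadius m q ‖x‖ / ‖x‖) ^ 2 - 1 := by
  set k := (m ^ 2 - q ^ 2) / 4 with hk
  have hm : 0 < m := (abs_nonneg q).trans_lt h
  have hk0 : 0 < k := div_pos (sq_sub_sq_pos h) (by norm_num)
  set A := m + k with hA
  have hA0 : 0 < A := by positivity
  have hc : ∀ r : ℝ, 1 < r → rnRadius m q r / r = 1 + (m / r + k / r ^ 2) := fun r hr => by
    have : 0 < r := by linarith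
    simp only [rnRadius, hk]
    field_simp
    ring
  have hd1 : ∀ r : ℝ, 1 < r →
      HasDerivAt (fun r : ℝ => 1 + (m / r + k / r ^ 2)) (-m / r ^ 2 - 2 * k / r ^ 3) r :=
    fun r hr => by
      have h0 : r ≠ 0 := by positivity
      refine (((hasDerivAt_const r m).div (hasDerivAt_id r) h0).add
        ((hasDerivAt_const r k).div (hasDerivAt_pow 2 r) (pow_ne_zero 2 h0))).const_add 1
        |>.congr_deriv ?_
      simp only [id]
      field_simp
      ring
  have hd2 : ∀ r : ℝ, 1 < r →
      HasDerivAt (fun r : ℝ => -m / r ^ 2 - 2 * k / r ^ 3) (2 * m / r ^ 3 + 6 * k / r ^ 4) r :=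
    fun r hr => by
      have h0 : r ≠ 0 := by positivity
      refine (((hasDerivAt_const r (-m)).div (hasDerivAt_pow 2 r) (pow_ne_zero 2 h0)).sub
        ((hasDerivAt_const r (2 * k)).div (hasDerivAt_pow 3 r) (pow_ne_zero 3 h0))).congr_deriv ?_
      field_simp
      ring
  have b0 : ∀ r : ℝ, 1 < r → 0 ≤ m / r + k / r ^ 2 ∧ m / r + k / r ^ 2 ≤ A / r := fun r hr => by
    refine ⟨by positivity, ?_⟩
    rw [hA, add_div]
    gcongr
    nlinarith
  have b1 : ∀ r : ℝ, 1 < r → |-m / r ^ 2 - 2 * k / r ^ 3| ≤ 2 * A / r ^ 2 := fun r hr => by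
    have e : -m / r ^ 2 - 2 * k / r ^ 3 = -(m / r ^ 2 + 2 * k / r ^ 3) := by ring
    rw [e, abs_neg, abs_of_nonneg (by positivity),
      show 2 * A / r ^ 2 = 2 * m / r ^ 2 + 2 * k / r ^ 2 by rw [hA]; ring]
    gcongr
    · linarith
    · exact hr.le
    · norm_num
  have b2 : ∀ r : ℝ, 1 < r → |2 * m / r ^ 3 + 6 * k / r ^ 4| ≤ 6 * A / r ^ 3 := fun r hr => by
    rw [abs_of_nonneg (by positivity),
      show 6 * A / r ^ 3 = 6 * m / r ^ 3 + 6 * k / r ^ 3 by rw [hA]; ring]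
    gcongr
    · linarith
    · exact hr.le
    · norm_num
  have hone : ∀ r : ℝ, 1 < r → |1 + (m / r + k / r ^ 2)| ≤ 1 + A := fun r hr => by
    obtain ⟨h1, h2⟩ := b0 r hr
    have : A / r ≤ A := div_le_self hA0.le hr.le
    rw [abs_of_nonneg (by linarith)]
    linarith
  have key := decaysTwo_radial (p := 1) (R := 1) (C := 12 * A * (1 + A) + 8 * A ^ 2) one_pos
    (ψ := fun r => (1 + (m / r + k / r ^ 2)) ^ 2 - 1)
    (ψ₁ := fun r => 2 * ((1 + (m / r + k / r ^ 2)) * (-m / r ^ 2 - 2 * k / r ^ 3)))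
    (ψ₂ := fun r => 2 * ((-m / r ^ 2 - 2 * k / r ^ 3) * (-m / r ^ 2 - 2 * k / r ^ 3) +
      (1 + (m / r + k / r ^ 2)) * (2 * m / r ^ 3 + 6 * k / r ^ 4)))
    (fun r hr => (((hd1 r hr).pow 2).sub_const 1).congr_deriv (by
      simp only [Nat.cast_ofNat, pow_one, Nat.add_one_sub_one]; ring))
    (fun r hr => ((hd1 r hr).mul (hd2 r hr)).const_mul 2) ?_ ?_ ?_
  · exact key.congr (R₀ := 1) fun x hx => by rw [hc _ hx]
  · intro r hr
    obtain ⟨h1, h2⟩ := b0 r hr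
    have h3 : A / r ≤ A := div_le_self hA0.le hr.le
    rw [show (1 + (m / r + k / r ^ 2)) ^ 2 - 1 =
      (m / r + k / r ^ 2) * (2 + (m / r + k / r ^ 2)) by ring, abs_of_nonneg (by positivity)]
    calc (m / r + k / r ^ 2) * (2 + (m / r + k / r ^ 2)) ≤ A / r * (2 + A) := by
          gcongr
          linarith
      _ = (2 * A + A ^ 2) / r ^ 1 := by ring
      _ ≤ _ := div_le_div_of_nonneg_right (by nlinarith) (by positivity)
  · intro r hr
    rw [abs_mul, abs_mul, abs_of_pos (by norm_num : (0 : ℝ) < 2)]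
    calc 2 * (|1 + (m / r + k / r ^ 2)| * |-m / r ^ 2 - 2 * k / r ^ 3|)
        ≤ 2 * ((1 + A) * (2 * A / r ^ 2)) := by
          gcongr
          · exact hone r hr
          · exact b1 r hr
      _ = (4 * A * (1 + A)) / r ^ (1 + 1) := by ring
      _ ≤ _ := by gcongr; nlinarith
  · intro r hr
    rw [abs_mul, abs_of_pos (by norm_num : (0 : ℝ) < 2)]
    calc 2 * |(-m / r ^ 2 - 2 * k / r ^ 3) * (-m / r ^ 2 - 2 * k / r ^ 3) +
          (1 + (m / r + k / r ^ 2)) * (2 * m / r ^ 3 + 6 * k / r ^ 4)|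
        ≤ 2 * (2 * A / r ^ 2 * (2 * A / r ^ 2) + (1 + A) * (6 * A / r ^ 3)) := by
          refine mul_le_mul_of_nonneg_left ((abs_add_le _ _).trans ?_) (by norm_num)
          rw [abs_mul, abs_mul]
          gcongr
          · exact b1 r hr
          · exact b1 r hr
          · exact hone r hr
          · exact b2 r hr
      _ = 8 * A ^ 2 / r ^ 4 + 12 * A * (1 + A) / r ^ 3 := by ring
      _ ≤ 8 * A ^ 2 / r ^ 3 + 12 * A * (1 + A) / r ^ 3 := by
          gcongr
          · exact hr.le
          · norm_num
      _ = _ := by ring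

theorem decaysTwo_rn_electric (h : |q| < m) (i : Fin 3) :
    InitialData.DecaysTwo 2 fun x => q / rnRadius m q ‖x‖ ^ 3 * x i := by
  have hm : 0 < m := (abs_nonneg q).trans_lt h
  have hk0 := sq_sub_sq_pos h
  have hkr : ∀ r : ℝ, 1 + (m ^ 2 - q ^ 2) < r → m ^ 2 - q ^ 2 ≤ r ^ 2 := fun r hr => by nlinarith
  have hr0 : ∀ r : ℝ, 1 + (m ^ 2 - q ^ 2) < r → 0 < r := fun r hr => by linarith
  have hs : ∀ r : ℝ, 1 + (m ^ 2 - q ^ 2) < r → r ≤ rnRadius m q r := fun r hr => by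
    linarith [add_le_rnRadius h (hr0 r hr)]
  have hs1 : ∀ r : ℝ, 1 + (m ^ 2 - q ^ 2) < r → |rnRadiusDeriv m q r| ≤ 1 := fun r hr => by
    have hr' := hr0 r hr
    have h1 : (m ^ 2 - q ^ 2) / (4 * r ^ 2) ≤ 1 := by
      rw [div_le_one (by positivity)]
      nlinarith [hkr r hr]
    have h2 : 0 ≤ (m ^ 2 - q ^ 2) / (4 * r ^ 2) := by positivity
    rw [rnRadiusDeriv, abs_le]
    constructor <;> linarith
  have hs2 : ∀ r : ℝ, 1 + (m ^ 2 - q ^ 2) < r → |rnRadiusDerivTwo m q r| ≤ 1 / r := fun r hr => by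
    have hr' := hr0 r hr
    rw [rnRadiusDerivTwo, abs_of_nonneg (by positivity), div_le_div_iff₀ (by positivity) hr']
    nlinarith [mul_le_mul_of_nonneg_right (hkr r hr) hr'.le, pow_pos hr' 3]
  -- Beyond this `R` one has `m² - q² ≤ r²`, hence `|s'| ≤ 1` and `|s''| ≤ 1/r`; the constant is `15
  -- = 3 (1 + 4)` from the second derivative of `q/s³`.
  refine decaysTwo_radial_mul_coord (p := 2) (R := 1 + (m ^ 2 - q ^ 2)) (C := 15 * |q|)
    (by linarith) (ψ := fun r => q / rnRadius m q r ^ 3)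
    (ψ₁ := fun r => -3 * q * (rnRadiusDeriv m q r / rnRadius m q r ^ 4))
    (ψ₂ := fun r => -3 * q * (rnRadiusDerivTwo m q r / rnRadius m q r ^ 4 -
      4 * rnRadiusDeriv m q r ^ 2 / rnRadius m q r ^ 5)) ?_ ?_ ?_ ?_ ?_ i
  · intro r hr
    have hsp := rnRadius_pos h (hr0 r hr)
    refine ((hasDerivAt_const r q).div ((hasDerivAt_rnRadius (hr0 r hr)).pow 3)
      (pow_ne_zero 3 hsp.ne')).congr_deriv ?_
    simp
    field_simp
  · intro r hr
    have hsp := rnRadius_pos h (hr0 r hr)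
    refine (((hasDerivAt_rnRadiusDeriv (hr0 r hr)).div ((hasDerivAt_rnRadius (hr0 r hr)).pow 4)
      (pow_ne_zero 4 hsp.ne')).const_mul (-3 * q)).congr_deriv ?_
    simp
    field_simp
    simp
  · intro r hr
    have hr' := hr0 r hr
    have hsr := hs r hr
    rw [abs_div, abs_of_pos (pow_pos (rnRadius_pos h hr') 3)]
    gcongr
    linarith [abs_nonneg q]
  · intro r hr
    have hr' := hr0 r hr
    have hsr := hs r hr
    rw [abs_mul, abs_div, abs_of_pos (pow_pos (rnRadius_pos h hr') 4), abs_mul]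
    calc |(-3 : ℝ)| * |q| * (|rnRadiusDeriv m q r| / rnRadius m q r ^ 4)
        ≤ 3 * |q| * (1 / r ^ 4) := by
          gcongr
          · norm_num
          · exact hs1 r hr
      _ = 3 * |q| / r ^ (2 + 2) := by ring
      _ ≤ _ := by gcongr; norm_num
  · intro r hr
    have hr' := hr0 r hr
    have hsr := hs r hr
    have hsp := rnRadius_pos h hr'
    rw [abs_mul, abs_mul]
    calc |(-3 : ℝ)| * |q| * |rnRadiusDerivTwo m q r / rnRadius m q r ^ 4 -
          4 * rnRadiusDeriv m q r ^ 2 / rnRadius m q r ^ 5|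
        ≤ 3 * |q| * (1 / r / r ^ 4 + 4 * 1 ^ 2 / r ^ 5) := by
          refine mul_le_mul (by norm_num) ((abs_sub _ _).trans ?_) (abs_nonneg _) (by positivity)
          rw [abs_div, abs_div, abs_mul, abs_pow (rnRadiusDeriv m q r), abs_of_pos (pow_pos hsp 4),
            abs_of_pos (pow_pos hsp 5), abs_of_pos (by norm_num : (0 : ℝ) < 4)]
          gcongr
          · exact hs2 r hr
          · exact hs1 r hr
      _ = 15 * |q| / r ^ (2 + 3) := by field_simp; ring

theorem tendsto_rn_mass : Tendsto (fun r => -(r ^ 2 * (rnRadius m q r / r) *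
    (rnRadiusDeriv m q r / r - rnRadius m q r / r ^ 2))) atTop (𝓝 m) := by
  have e : (fun r => (1 + m * r⁻¹ + (m ^ 2 - q ^ 2) / 4 * r⁻¹ ^ 2) *
      (m + (m ^ 2 - q ^ 2) / 2 * r⁻¹)) =ᶠ[atTop] fun r => -(r ^ 2 * (rnRadius m q r / r) *
    (rnRadiusDeriv m q r / r - rnRadius m q r / r ^ 2)) := by
    filter_upwards [eventually_gt_atTop 0] with r hr
    simp only [rnRadius, rnRadiusDeriv]
    field_simp
    ring
  refine Tendsto.congr' e ?_
  have h := tendsto_inv_atTop_zero (𝕜 := ℝ)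
  have := ((tendsto_const_nhds (x := (1 : ℝ)).add (h.const_mul m)).add
    ((h.pow 2).const_mul ((m ^ 2 - q ^ 2) / 4))).mul
    ((tendsto_const_nhds (x := m)).add (h.const_mul ((m ^ 2 - q ^ 2) / 2)))
  simpa using this

/-! ### Small perturbations of the Reissner-Nordström profile -/

theorem exists_bound_of_continuousOn_Icc {f : ℝ → ℝ} {b b' : ℝ} (hb : 0 < b)
    (hf : ContinuousOn f (Set.Ioi 0)) : ∃ C, 0 ≤ C ∧ ∀ r ∈ Set.Icc b b', |f r| ≤ C := by
  obtain ⟨C, hC⟩ := isCompact_Icc.exists_bound_of_continuousOn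
    (hf.mono fun r (hr : r ∈ Set.Icc b b') => hb.trans_le hr.1)
  exact ⟨max C 0, le_max_right _ _, fun r hr => (hC r hr).trans (le_max_left _ _)⟩

/-- Small perturbations `S = s + δ η` of the area radius `s`, with `η` supported in `[b, b']`,
are increasing, and become compatible with the energy condition after the electric field is
multiplied with `1 - K δ χ`, where `χ = 1` on `[b, b']`. -/
theorem exists_perturbation_constants {η η₁ η₂ χ : ℝ → ℝ} {b b' : ℝ} (hq : q ≠ 0) (h : |q| < m)
    (hb : rnHorizon m q < b) (hη : Continuous η) (hη₁ : Continuous η₁) (hη₂ : Continuous η₂)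
    (hsupp : ∀ r, r ∉ Set.Icc b b' → η r = 0 ∧ η₁ r = 0 ∧ η₂ r = 0)
    (hη01 : ∀ r, 0 ≤ η r ∧ η r ≤ 1) (hχ01 : ∀ r, 0 ≤ χ r ∧ χ r ≤ 1)
    (hχ : ∀ r ∈ Set.Icc b b', χ r = 1) :
    ∃ K δ₀ : ℝ, 0 < δ₀ ∧ ∀ δ, 0 < δ → δ ≤ δ₀ →
      (∀ r, rnHorizon m q < r → 0 < rnRadiusDeriv m q r + δ * η₁ r) ∧
      ∀ r, 0 < r → ((1 - K * δ * χ r) * (q / rnRadius m q r ^ 3)) ^ 2 *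
        (rnRadius m q r + δ * η r) ^ 6 ≤ curvatureCharge r (rnRadius m q r + δ * η r)
          (rnRadiusDeriv m q r + δ * η₁ r) (rnRadiusDerivTwo m q r + δ * η₂ r) := by
  have hm : 0 < m := (abs_nonneg q).trans_lt h
  have ha := rnHorizon_pos h
  have hb0 : 0 < b := ha.trans hb
  have hq2 : 0 < q ^ 2 := by positivity
  have hcs := continuousOn_rnRadius (m := m) (q := q)
  have hcs₁ := continuousOn_rnRadiusDeriv (m := m) (q := q)
  have hcs₂ := continuousOn_rnRadiusDerivTwo (m := m) (q := q)
  have hid : ContinuousOn (fun r : ℝ => r) (Set.Ioi 0) := continuousOn_id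
  -- `A` and `B` bound the coefficients of `δ` and `δ²` in the expansion of `curvatureCharge` about
  -- the Reissner–Nordström profile.
  obtain ⟨A, hA0, hA⟩ := exists_bound_of_continuousOn_Icc (b := b) (b' := b')
    (f := fun r => 2 * (rnRadius m q r * η r) + 2 * (r ^ 2 * (rnRadiusDeriv m q r * η₁ r)) -
      2 * (r * (rnRadius m q r * (η₁ r + r * η₂ r) +
        η r * (rnRadiusDeriv m q r + r * rnRadiusDerivTwo m q r)))) hb0 (by fun_prop)
  obtain ⟨B, hB0, hB⟩ := exists_bound_of_continuousOn_Icc (b := b) (b' := b')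
    (f := fun r => η r ^ 2 + r ^ 2 * η₁ r ^ 2 - 2 * (r * (η r * (η₁ r + r * η₂ r)))) hb0
    (by fun_prop)
  obtain ⟨D, hD0, hD⟩ := exists_bound_of_continuousOn_Icc (b := b) (b' := b') (f := η₁) hb0
    hη₁.continuousOn
  -- Since `s ≥ m` and `η ≤ 1`, `(S/s)⁶ ≤ (1 + δ/m)⁶ ≤ 1 + 63 δ/m`, where `63 = 2⁶ - 1`.
  set C := A + B + 63 / m with hC
  have hC0 : 0 ≤ C := by positivity
  -- With `q² K = q² C + C`, the terms of first order in `q² (1 - K δ)(1 + C δ)` add up to `-C δ`,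
  -- which covers the loss in `curvatureCharge`.
  set K := C + C / q ^ 2 with hK
  have hK0 : 0 ≤ K := by positivity
  have hd0 : 0 < rnRadiusDeriv m q b := rnRadiusDeriv_pos h hb
  -- The four bounds serve `δ² ≤ δ`, `δ/m ≤ 1`, `K δ ≤ 1` and the positivity of `S'`; for the last,
  -- `s'` is increasing and so at least `s' b` on `[b, b']`.
  refine ⟨K, min (min 1 m) (min (1 / (K + 1)) (rnRadiusDeriv m q b / (2 * (D + 1)))),
    by positivity, fun δ hδ hle => ?_⟩
  have hδ1 : δ ≤ 1 := hle.trans ((min_le_left _ _).trans (min_le_left _ _))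
  have hδm : δ ≤ m := hle.trans ((min_le_left _ _).trans (min_le_right _ _))
  have hδK : K * δ ≤ 1 := by
    have : δ ≤ 1 / (K + 1) := hle.trans ((min_le_right _ _).trans (min_le_left _ _))
    rw [le_div_iff₀ (by positivity)] at this
    linarith
  have hδD : D * δ < rnRadiusDeriv m q b := by
    have : δ ≤ _ := hle.trans ((min_le_right _ _).trans (min_le_right _ _))
    rw [le_div_iff₀ (by positivity)] at this
    nlinarith [mul_nonneg hD0 hδ.le]
  have hKχ : ∀ r, 0 ≤ 1 - K * δ * χ r ∧ 1 - K * δ * χ r ≤ 1 := fun r => by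
    obtain ⟨h0, h1⟩ := hχ01 r
    have h2 : 0 ≤ K * δ := by positivity
    constructor <;> nlinarith
  constructor
  · intro r hr
    by_cases hrb : r ∈ Set.Icc b b'
    · have h1 := rnRadiusDeriv_mono h hb0 hrb.1
      have h2 := hD r hrb
      have h3 : -(D * δ) ≤ δ * η₁ r := by
        have := neg_le_of_abs_le h2
        nlinarith
      linarith
    · rw [(hsupp r hrb).2.1, mul_zero, add_zero]
      exact rnRadiusDeriv_pos h hr
  · intro r hr
    have hs := rnRadius_pos h hr
    by_cases hrb : r ∈ Set.Icc b b'
    · have hQ : q ^ 2 - (A + B) * δ ≤ curvatureCharge r (rnRadius m q r + δ * η r)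
          (rnRadiusDeriv m q r + δ * η₁ r) (rnRadiusDerivTwo m q r + δ * η₂ r) := by
        have h1 := neg_le_of_abs_le (hA r hrb)
        have h2 := neg_le_of_abs_le (hB r hrb)
        rw [← curvatureCharge_rn (m := m) (q := q) hr]
        simp only [curvatureCharge]
        have h3 := mul_le_mul_of_nonneg_left h1 hδ.le
        have h4 := mul_le_mul_of_nonneg_left h2 (sq_nonneg δ)
        have h5 : δ ^ 2 * B ≤ δ * B := by nlinarith [mul_nonneg hδ.le hB0]
        linarith
      refine le_trans ?_ hQ
      rw [hχ r hrb, mul_one]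
      set x := δ / m with hx
      have hx0 : 0 ≤ x := by positivity
      have hx1 : x ≤ 1 := (div_le_one hm).2 hδm
      have hratio : (rnRadius m q r + δ * η r) / rnRadius m q r ≤ 1 + x := by
        rw [add_div, div_self hs.ne', hx]
        gcongr
        · nlinarith [(hη01 r).2]
        · linarith [add_le_rnRadius h hr]
      have hratio0 : 0 ≤ (rnRadius m q r + δ * η r) / rnRadius m q r := by
        have := (hη01 r).1
        positivity
      have h6 : ((rnRadius m q r + δ * η r) / rnRadius m q r) ^ 6 ≤ 1 + C * δ := by
        calc _ ≤ (1 + x) ^ 6 := by gcongr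
          _ ≤ 1 + 63 * x := by
            have e : (1 + x) ^ 6 = 1 + 6 * x + 15 * x ^ 2 + 20 * x ^ 3 + 15 * x ^ 4 + 6 * x ^ 5 +
              x ^ 6 := by ring
            have hp : ∀ n : ℕ, n ≠ 0 → x ^ n ≤ x := fun n hn => pow_le_of_le_one hx0 hx1 hn
            rw [e]
            linarith [hp 2 (by simp), hp 3 (by simp), hp 4 (by simp), hp 5 (by simp),
              hp 6 (by simp)]
          _ = 1 + 63 / m * δ := by rw [hx]; ring
          _ ≤ _ := by
            rw [hC]
            gcongr
            linarith
      -- One of the two factors `1 - K δ` is enough.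
      have hsq : (1 - K * δ) ^ 2 ≤ 1 - K * δ := by nlinarith [mul_nonneg hK0 hδ.le]
      calc ((1 - K * δ) * (q / rnRadius m q r ^ 3)) ^ 2 * (rnRadius m q r + δ * η r) ^ 6
          = q ^ 2 * (1 - K * δ) ^ 2 * ((rnRadius m q r + δ * η r) / rnRadius m q r) ^ 6 := by
            field_simp
        _ ≤ q ^ 2 * (1 - K * δ) * (1 + C * δ) := by gcongr
        _ ≤ q ^ 2 - C * δ := by
            have e : q ^ 2 * (1 - K * δ) * (1 + C * δ) =
                q ^ 2 - C * δ - q ^ 2 * (K * C * δ ^ 2) := by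
              have hKq : q ^ 2 * K = q ^ 2 * C + C := by rw [hK]; field_simp
              linear_combination (-δ) * hKq
            rw [e]
            have : 0 ≤ q ^ 2 * (K * C * δ ^ 2) := by positivity
            linarith
        _ ≤ q ^ 2 - (A + B) * δ := by
            have : A + B ≤ C := by rw [hC]; linarith [show 0 ≤ 63 / m by positivity]
            nlinarith
    · obtain ⟨h0, h1, h2⟩ := hsupp r hrb
      rw [h0, h1, h2, mul_zero, add_zero, add_zero, add_zero, curvatureCharge_rn hr]
      calc ((1 - K * δ * χ r) * (q / rnRadius m q r ^ 3)) ^ 2 * rnRadius m q r ^ 6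
          = q ^ 2 * (1 - K * δ * χ r) ^ 2 := by field_simp
        _ ≤ q ^ 2 * 1 ^ 2 := by
            gcongr
            · exact (hKχ r).1
            · exact (hKχ r).2
        _ = q ^ 2 := by ring

end RN

/-! ### Derivative bounds for compactly supported functions -/

theorem exists_iteratedFDeriv_bound {V : Type*} [NormedAddCommGroup V] [NormedSpace ℝ V]
    {f : E3 → V} (hf : ContDiff ℝ ∞ f) (hc : HasCompactSupport f) (k : ℕ) :
    ∃ C, 0 ≤ C ∧ ∀ l ≤ k, ∀ x, ‖iteratedFDeriv ℝ l f x‖ ≤ C := by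
  have h : ∀ l : ℕ, ∃ C, 0 ≤ C ∧ ∀ x, ‖iteratedFDeriv ℝ l f x‖ ≤ C := fun l => by
    obtain ⟨C, hC⟩ := (hf.continuous_iteratedFDeriv (m := l)
      (by exact_mod_cast le_top)).bounded_above_of_compact_support (hc.iteratedFDeriv l)
    exact ⟨max C 0, le_max_right _ _, fun x => (hC x).trans (le_max_left _ _)⟩
  choose C hC0 hC using h
  refine ⟨∑ l ∈ Finset.range (k + 1), C l, Finset.sum_nonneg fun l _ => hC0 l,
    fun l hl x => (hC l x).trans ?_⟩
  exact Finset.single_le_sum (fun i _ => hC0 i) (Finset.mem_range.2 (by omega))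

theorem contDiffAt_radial {ψ : ℝ → ℝ} {x : E3} (hx : x ≠ 0) (h : ContDiffAt ℝ ∞ ψ ‖x‖) :
    ContDiffAt ℝ ∞ (fun y : E3 => ψ ‖y‖) x :=
  h.comp x (contDiffAt_norm ℝ hx)

/-- The norm is not smooth at the origin, but the profile vanishes near it. -/
theorem contDiff_radial_of_support {ψ : ℝ → ℝ} {b : ℝ} (hb : 0 < b)
    (h : ∀ r, 0 < r → ContDiffAt ℝ ∞ ψ r) (h0 : ∀ r, r < b → ψ r = 0) :
    ContDiff ℝ ∞ fun y : E3 => ψ ‖y‖ := by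
  rw [contDiff_iff_contDiffAt]
  intro x
  by_cases hx : x = 0
  · have : (fun y : E3 => ψ ‖y‖) =ᶠ[𝓝 x] fun _ => 0 := by
      have hlt : ∀ᶠ y : E3 in 𝓝 x, ‖y‖ < b :=
        (isOpen_lt continuous_norm continuous_const).eventually_mem (by simpa [hx] using hb)
      filter_upwards [hlt] with y hy using h0 _ hy
    exact contDiffAt_const.congr_of_eventuallyEq this
  · exact contDiffAt_radial hx (h _ (norm_pos_iff.2 hx))

theorem hasCompactSupport_radial {ψ : ℝ → ℝ} {b' : ℝ} (h0 : ∀ r, b' < r → ψ r = 0) :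
    HasCompactSupport fun y : E3 => ψ ‖y‖ :=
  HasCompactSupport.intro (isCompact_closedBall 0 b') fun x hx => h0 _ (by
    simpa using hx)

/-! ### The perturbed data and their properties. -/

/-- The area radius of the Reissner-Nordström slice is changed by `δ η`, and the electric field is
multiplied with `1 - K δ χ`. -/
def perturbedData (m q : ℝ) (η χ : ℝ → ℝ) (K δ : ℝ) : InitialData where
  metric := conformalMetric fun r => (rnRadius m q r + δ * η r) / r
  electric x := ((1 - K * δ * χ ‖x‖) * (q / rnRadius m q ‖x‖ ^ 3)) • x
  magnetic _ := 0

theorem perturbedData_metric (m q : ℝ) (η χ : ℝ → ℝ) (K δ : ℝ) :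
    (perturbedData m q η χ K δ).metric =
      conformalMetric fun r => (rnRadius m q r + δ * η r) / r := rfl

/-- Smooth profiles `η` and `χ`, with `η' = η₁` and `η'' = η₂`, that are supported in an annulus
`b ≤ |x| ≤ b'` outside the horizon. -/
structure IsPerturbationProfile (m q b b' : ℝ) (η η₁ η₂ χ : ℝ → ℝ) : Prop where
  subextremal : |q| < m
  horizon_lt : rnHorizon m q < b
  smooth : ContDiff ℝ ∞ η
  smooth_cutoff : ContDiff ℝ ∞ χ
  hasDerivAt : ∀ r, HasDerivAt η (η₁ r) r
  hasDerivAt_two : ∀ r, HasDerivAt η₁ (η₂ r) r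
  continuous_two : Continuous η₂
  support : ∀ r, r ∉ Set.Icc b b' → η r = 0 ∧ η₁ r = 0 ∧ η₂ r = 0 ∧ χ r = 0
  nonneg : ∀ r, 0 ≤ η r

theorem perturbedData_isSphericallySymmetric (m q : ℝ) (η χ : ℝ → ℝ) (K δ a : ℝ) :
    (perturbedData m q η χ K δ).IsSphericallySymmetric a := by
  intro A x _
  refine ⟨fun v w => ?_, ?_, ?_⟩
  · simp only [perturbedData, gInner_conformalMetric, LinearIsometryEquiv.norm_map,
      LinearIsometryEquiv.inner_map_map]
  · simp only [perturbedData, LinearIsometryEquiv.norm_map, map_smul]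
  · simp [perturbedData]

namespace IsPerturbationProfile

variable {m q b b' K δ : ℝ} {η η₁ η₂ χ : ℝ → ℝ}

theorem mass_pos (h : IsPerturbationProfile m q b b' η η₁ η₂ χ) : 0 < m :=
  (abs_nonneg q).trans_lt h.subextremal

theorem pos (h : IsPerturbationProfile m q b b' η η₁ η₂ χ) : 0 < b :=
  (rnHorizon_pos h.subextremal).trans h.horizon_lt

theorem continuous_one (h : IsPerturbationProfile m q b b' η η₁ η₂ χ) : Continuous η₁ :=
  continuous_iff_continuousAt.2 fun r => (h.hasDerivAt_two r).continuousAt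

theorem le_radius (h : IsPerturbationProfile m q b b' η η₁ η₂ χ) (hδ : 0 ≤ δ) {r : ℝ}
    (hr : 0 < r) : r ≤ rnRadius m q r + δ * η r := by
  have h1 := add_le_rnRadius h.subextremal hr
  have h2 := mul_nonneg hδ (h.nonneg r)
  linarith [h.mass_pos]

theorem radius_pos (h : IsPerturbationProfile m q b b' η η₁ η₂ χ) (hδ : 0 ≤ δ) :
    ∀ r, 0 < r → 0 < rnRadius m q r + δ * η r :=
  fun _ hr => hr.trans_le (h.le_radius hδ hr)

theorem hasDerivAt_radius (h : IsPerturbationProfile m q b b' η η₁ η₂ χ) (δ : ℝ) :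
    ∀ r, 0 < r → HasDerivAt (fun r => rnRadius m q r + δ * η r)
      (rnRadiusDeriv m q r + δ * η₁ r) r :=
  fun r hr => (hasDerivAt_rnRadius hr).add ((h.hasDerivAt r).const_mul δ)

theorem hasDerivAt_radius_two (h : IsPerturbationProfile m q b b' η η₁ η₂ χ) (δ : ℝ) :
    ∀ r, 0 < r → HasDerivAt (fun r => rnRadiusDeriv m q r + δ * η₁ r)
      (rnRadiusDerivTwo m q r + δ * η₂ r) r :=
  fun r hr => (hasDerivAt_rnRadiusDeriv hr).add ((h.hasDerivAt_two r).const_mul δ)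

theorem support_of_gt (h : IsPerturbationProfile m q b b' η η₁ η₂ χ) {r : ℝ} (hr : b' < r) :
    η r = 0 ∧ η₁ r = 0 ∧ η₂ r = 0 ∧ χ r = 0 :=
  h.support r fun h' => absurd h'.2 hr.not_ge

theorem support_of_lt (h : IsPerturbationProfile m q b b' η η₁ η₂ χ) {r : ℝ} (hr : r < b) :
    η r = 0 ∧ η₁ r = 0 ∧ η₂ r = 0 ∧ χ r = 0 :=
  h.support r fun h' => absurd h'.1 hr.not_ge

theorem eq_reissnerNordstrom (h : IsPerturbationProfile m q b b' η η₁ η₂ χ) {x : E3}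
    (hx : ‖x‖ ∉ Set.Icc b b') :
    (perturbedData m q η χ K δ).metric x = (reissnerNordstrom m q).metric x ∧
      (perturbedData m q η χ K δ).electric x = (reissnerNordstrom m q).electric x := by
  obtain ⟨h0, -, -, hχ⟩ := h.support _ hx
  constructor
  · rw [reissnerNordstrom_metric]
    simp [perturbedData, conformalMetric, h0]
  · simp [perturbedData, reissnerNordstrom, hχ, rnAreaRadius, rnRadius]

theorem contDiffAt_rn_div (h : IsPerturbationProfile m q b b' η η₁ η₂ χ) {r : ℝ} (hr : 0 < r) :
    ContDiffAt ℝ ∞ (fun r => q / rnRadius m q r ^ 3) r :=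
  contDiffAt_const.div ((contDiffAt_rnRadius hr.ne').pow 3)
    (pow_ne_zero 3 (rnRadius_pos h.subextremal hr).ne')

/-- The differences of the fields are `δ` and `δ²` times fixed smooth compactly supported fields. It
matters that `K` is fixed before `δ₀`. -/
theorem exists_isCkClose (h : IsPerturbationProfile m q b b' η η₁ η₂ χ) (a K : ℝ) (k : ℕ)
    {ε : ℝ} (hε : 0 < ε) : ∃ δ₀, 0 < δ₀ ∧ ∀ δ, 0 < δ → δ ≤ δ₀ →
      (perturbedData m q η χ K δ).IsCkClose (reissnerNordstrom m q) a k ε := by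
  have hs : ∀ r : ℝ, 0 < r → ContDiffAt ℝ ∞ (rnRadius m q) r := fun r hr =>
    contDiffAt_rnRadius hr.ne'
  have hpow : ∀ r : ℝ, 0 < r → ContDiffAt ℝ ∞ (fun r : ℝ => r ^ 2) r := fun r _ =>
    contDiffAt_id.pow 2
  have bound : ∀ ψ : ℝ → ℝ, (∀ r, 0 < r → ContDiffAt ℝ ∞ ψ r) → (∀ r, r ∉ Set.Icc b b' → ψ r = 0) →
      (ContDiff ℝ ∞ fun y : E3 => ψ ‖y‖) ∧ HasCompactSupport fun y : E3 => ψ ‖y‖ :=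
    fun ψ h1 h2 => ⟨contDiff_radial_of_support h.pos h1 fun r hr =>
      h2 r fun h' => absurd h'.1 hr.not_ge, hasCompactSupport_radial fun r hr =>
      h2 r fun h' => absurd h'.2 hr.not_ge⟩
  obtain ⟨hf₁, hc₁⟩ := bound (fun r => 2 * (rnRadius m q r * η r) / r ^ 2)
    (fun r hr => (contDiffAt_const.mul ((hs r hr).mul h.smooth.contDiffAt)).div (hpow r hr)
      (pow_ne_zero 2 hr.ne')) fun r hr => by simp [(h.support r hr).1]
  obtain ⟨hf₂, hc₂⟩ := bound (fun r => η r ^ 2 / r ^ 2)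
    (fun r hr => (h.smooth.contDiffAt.pow 2).div (hpow r hr) (pow_ne_zero 2 hr.ne'))
    fun r hr => by simp [(h.support r hr).1]
  obtain ⟨hf₃, hc₃⟩ := bound (fun r => K * (χ r * (q / rnRadius m q r ^ 3)))
    (fun r hr => contDiffAt_const.mul (h.smooth_cutoff.contDiffAt.mul (h.contDiffAt_rn_div hr)))
    fun r hr => by simp [(h.support r hr).2.2.2]
  have hg₃ : ContDiff ℝ ∞ fun y : E3 => (K * (χ ‖y‖ * (q / rnRadius m q ‖y‖ ^ 3))) • y :=
    hf₃.smul contDiff_id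
  have hs₃ : HasCompactSupport fun y : E3 => (K * (χ ‖y‖ * (q / rnRadius m q ‖y‖ ^ 3))) • y :=
    hc₃.smul_right
  obtain ⟨C₁, hC₁0, hC₁⟩ := exists_iteratedFDeriv_bound hf₁ hc₁ k
  obtain ⟨C₂, hC₂0, hC₂⟩ := exists_iteratedFDeriv_bound hf₂ hc₂ k
  obtain ⟨C₃, hC₃0, hC₃⟩ := exists_iteratedFDeriv_bound hg₃ hs₃ k
  have hC : 0 < C₁ + C₂ + C₃ + 1 := by positivity
  refine ⟨min 1 (ε / (2 * (C₁ + C₂ + C₃ + 1))), by positivity, fun δ hδ hle x hx l hl => ?_⟩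
  have hδ1 : δ ≤ 1 := hle.trans (min_le_left _ _)
  have hδC : δ * (C₁ + C₂ + C₃ + 1) < ε := by
    have : δ ≤ _ := hle.trans (min_le_right _ _)
    rw [le_div_iff₀ (by positivity)] at this
    linarith
  have hl' : ((l : ℕ∞) : WithTop ℕ∞) ≤ ∞ := by exact_mod_cast le_top
  have hlt : ∀ {t C : ℝ}, 0 ≤ C → C ≤ C₁ + C₂ + C₃ → t ≤ δ * C → t < ε := fun {t C} _ hC ht => by
    have : δ * C ≤ δ * (C₁ + C₂ + C₃) := by gcongr
    linarith
  refine ⟨fun i j => ?_, ?_, ?_⟩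
  · set I := (1 : Matrix (Fin 3) (Fin 3) ℝ) i j with hI
    have e : (fun y => (perturbedData m q η χ K δ).metric y i j -
        (reissnerNordstrom m q).metric y i j) =
        (δ * I) • (fun y : E3 => 2 * (rnRadius m q ‖y‖ * η ‖y‖) / ‖y‖ ^ 2) +
          (δ ^ 2 * I) • fun y : E3 => η ‖y‖ ^ 2 / ‖y‖ ^ 2 := by
      ext y
      rw [reissnerNordstrom_metric]
      simp only [perturbedData, conformalMetric_apply, Pi.add_apply, Pi.smul_apply, smul_eq_mul,
        ← hI]
      ring
    have hf₁' := (hf₁.of_le hl').contDiffAt (x := x)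
    have hf₂' := (hf₂.of_le hl').contDiffAt (x := x)
    have hg₁ : ContDiffAt ℝ l ((δ * I) • fun y : E3 =>
        2 * (rnRadius m q ‖y‖ * η ‖y‖) / ‖y‖ ^ 2) x := contDiffAt_const.smul hf₁'
    have hg₂ : ContDiffAt ℝ l ((δ ^ 2 * I) • fun y : E3 => η ‖y‖ ^ 2 / ‖y‖ ^ 2) x :=
      contDiffAt_const.smul hf₂'
    rw [e, iteratedFDeriv_add_apply hg₁ hg₂,
      iteratedFDeriv_const_smul_apply hf₁', iteratedFDeriv_const_smul_apply hf₂']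
    have hI1 : |I| ≤ 1 := abs_one_apply_le i j
    refine hlt (C := C₁ + C₂) (by positivity) (by linarith) ((norm_add_le _ _).trans ?_)
    rw [norm_smul, norm_smul, Real.norm_eq_abs, Real.norm_eq_abs, abs_mul, abs_mul,
      abs_of_pos hδ, abs_of_pos (pow_pos hδ 2)]
    calc δ * |I| * _ + δ ^ 2 * |I| * _ ≤ δ * 1 * C₁ + δ * 1 * C₂ := by
          gcongr
          · exact hC₁ l hl x
          · nlinarith
          · exact hC₂ l hl x
      _ = δ * (C₁ + C₂) := by ring
  · have e : (fun y => (perturbedData m q η χ K δ).electric y -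
        (reissnerNordstrom m q).electric y) =
        (-δ) • fun y : E3 => (K * (χ ‖y‖ * (q / rnRadius m q ‖y‖ ^ 3))) • y := by
      ext1 y
      change _ - (q / rnRadius m q ‖y‖ ^ 3) • y = _
      simp only [perturbedData, Pi.smul_apply, smul_smul, ← sub_smul]
      congr 1
      ring
    rw [e, iteratedFDeriv_const_smul_apply
      ((hg₃.of_le hl').contDiffAt (x := x)), norm_smul, norm_neg,
      Real.norm_of_nonneg hδ.le]
    refine hlt hC₃0 (by linarith) ?_
    gcongr
    exact hC₃ l hl x
  · simpa [perturbedData, reissnerNordstrom, iteratedFDeriv_fun_zero] using hε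

theorem isRegular (h : IsPerturbationProfile m q b b' η η₁ η₂ χ) (hδ : 0 ≤ δ) {a : ℝ}
    (ha : 0 < a) : (perturbedData m q η χ K δ).IsRegular a := by
  have hr : ∀ x ∈ exterior a, 0 < ‖x‖ := fun x hx => ha.trans_le hx
  refine ⟨fun x hx i j => ?_, fun x hx => ?_, fun x _ => contDiffAt_const, fun x hx => ?_⟩
  · simp only [perturbedData, conformalMetric_apply]
    refine ContDiffAt.mul (ContDiffAt.pow (contDiffAt_radial (norm_pos_iff.1 (hr x hx))
      (ψ := fun r => (rnRadius m q r + δ * η r) / r) ?_) 2) contDiffAt_const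
    exact ((contDiffAt_rnRadius (hr x hx).ne').add
      (contDiffAt_const.mul h.smooth.contDiffAt)).div contDiffAt_id (hr x hx).ne'
  · refine ContDiffAt.smul (contDiffAt_radial (norm_pos_iff.1 (hr x hx))
      (ψ := fun r => (1 - K * δ * χ r) * (q / rnRadius m q r ^ 3)) ?_) contDiffAt_id
    exact (contDiffAt_const.sub (contDiffAt_const.mul h.smooth_cutoff.contDiffAt)).mul
      (h.contDiffAt_rn_div (hr x hx))
  · have := h.radius_pos hδ _ (hr x hx)
    exact Matrix.PosDef.one.smul (pow_pos (div_pos this (hr x hx)) 2)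

theorem isStronglyAsymptoticallyFlat (h : IsPerturbationProfile m q b b' η η₁ η₂ χ) (hδ : 0 ≤ δ)
    {a : ℝ} (ha : 0 < a) : (perturbedData m q η χ K δ).IsStronglyAsymptoticallyFlat a := by
  have hfar : ∀ x : E3, b' < ‖x‖ → ‖x‖ ∉ Set.Icc b b' := fun x hx h' => absurd h'.2 hx.not_ge
  refine ⟨fun i j => ?_, fun i => ?_, fun i => ?_, ?_⟩
  · by_cases hij : i = j
    · subst hij
      refine (decaysTwo_rn_metric h.subextremal).congr (R₀ := b') fun x hx => ?_
      rw [(h.eq_reissnerNordstrom (hfar x hx)).1, reissnerNordstrom_metric,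
        conformalMetric_apply, Matrix.one_apply_eq, mul_one]
    · refine (decaysTwo_zero 1).congr (R₀ := 0) fun x _ => ?_
      simp [perturbedData, conformalMetric_apply, Matrix.one_apply_ne hij]
  · refine (decaysTwo_rn_electric h.subextremal i).congr (R₀ := b') fun x hx => ?_
    rw [(h.eq_reissnerNordstrom (hfar x hx)).2]
    rfl
  · exact decaysTwo_zero 2
  · have hη := h.smooth.continuous
    have hη₁ := h.continuous_one
    have hη₂ := h.continuous_two
    have hs := continuousOn_rnRadius (m := m) (q := q)
    have hs₁ := continuousOn_rnRadiusDeriv (m := m) (q := q)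
    have hs₂ := continuousOn_rnRadiusDerivTwo (m := m) (q := q)
    set Q : ℝ → ℝ := fun r => curvatureCharge r (rnRadius m q r + δ * η r)
      (rnRadiusDeriv m q r + δ * η₁ r) (rnRadiusDerivTwo m q r + δ * η₂ r) with hQ
    have hQc : ContinuousOn Q (Set.Ioi 0) := by
      have hid : ContinuousOn (fun r : ℝ => r) (Set.Ioi 0) := continuousOn_id
      simp only [hQ, curvatureCharge]
      fun_prop
    obtain ⟨C, hC0, hC⟩ := exists_bound_of_continuousOn_Icc (b := b) (b' := b') h.pos hQc
    -- `Q` is bounded by compactness on `[b, b']` and equals `q²` elsewhere. With `S ≥ r`, the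
    -- curvature density `2Q/(S r³)` is then `O(r⁻⁴)`.
    have hQb : ∀ r, 0 < r → |Q r| ≤ C + q ^ 2 := fun r hr => by
      by_cases hrb : r ∈ Set.Icc b b'
      · linarith [hC r hrb, sq_nonneg q]
      · obtain ⟨h0, h1, h2, -⟩ := h.support r hrb
        simp only [hQ, h0, h1, h2, mul_zero, add_zero, curvatureCharge_rn hr, abs_sq]
        linarith
    have hval : ∀ x ∈ exterior a, scalarCurvature (perturbedData m q η χ K δ).metric x *
        volumeDensity (perturbedData m q η χ K δ).metric x =
        2 * Q ‖x‖ / ((rnRadius m q ‖x‖ + δ * η ‖x‖) * ‖x‖ ^ 3) := fun x hx => by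
      have hr : 0 < ‖x‖ := ha.trans_le hx
      have hS := h.radius_pos hδ _ hr
      change scalarCurvature (conformalMetric fun r => (rnRadius m q r + δ * η r) / r) x *
        volumeDensity (conformalMetric fun r => (rnRadius m q r + δ * η r) / r) x = _
      rw [scalarCurvature_profile (h.radius_pos hδ) (h.hasDerivAt_radius δ)
        (h.hasDerivAt_radius_two δ) (norm_pos_iff.1 hr),
        volumeDensity_conformalMetric (c := fun r => (rnRadius m q r + δ * η r) / r)
          (div_pos hS hr).le]
      simp only [hQ]
      field_simp
    have hcont : ContinuousOn (fun r => 2 * Q r / ((rnRadius m q r + δ * η r) * r ^ 3))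
        (Set.Ioi 0) := by
      refine ContinuousOn.div (by fun_prop) (by fun_prop) fun r hr => ?_
      exact (mul_pos (h.radius_pos hδ r hr) (pow_pos hr 3)).ne'
    refine integrableOn_exterior_of_abs_le (C := 2 * (C + q ^ 2)) ha ?_ fun x hx => ?_
    · refine ContinuousOn.congr ?_ hval
      exact hcont.comp continuous_norm.continuousOn fun x hx => ha.trans_le hx
    · rw [hval x hx]
      have hr : 0 < ‖x‖ := ha.trans_le hx
      have hS := h.radius_pos hδ _ hr
      rw [abs_div, abs_mul, abs_of_pos (by norm_num : (0 : ℝ) < 2),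
        abs_of_pos (mul_pos hS (pow_pos hr 3)), show ‖x‖ ^ 4 = ‖x‖ * ‖x‖ ^ 3 by ring]
      gcongr
      · exact hQb _ hr
      · exact h.le_radius hδ hr

theorem hasOutermostMinimalBoundary (h : IsPerturbationProfile m q b b' η η₁ η₂ χ) (hδ : 0 ≤ δ)
    (hmono : ∀ r, rnHorizon m q < r → 0 < rnRadiusDeriv m q r + δ * η₁ r) :
    (perturbedData m q η χ K δ).HasOutermostMinimalBoundary (rnHorizon m q) := by
  have ha := rnHorizon_pos h.subextremal
  have hpos : ∀ r, 0 < r → 0 < (rnRadius m q r + δ * η r) / r := fun r hr =>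
    div_pos (h.radius_pos hδ r hr) hr
  have hd : ∀ r, 0 < r → HasDerivAt (fun r => (rnRadius m q r + δ * η r) / r)
      ((rnRadiusDeriv m q r + δ * η₁ r) / r - (rnRadius m q r + δ * η r) / r ^ 2) r :=
    fun r hr => hasDerivAt_profile_div (S₁ := fun r => rnRadiusDeriv m q r + δ * η₁ r) hr
      (h.hasDerivAt_radius δ r hr)
  -- Here `r c` is the area radius, so the mean curvature criterion `(r c)' > 0` becomes `S' > 0`.
  have hsum : ∀ r, 0 < r → (rnRadius m q r + δ * η r) / r +
      r * ((rnRadiusDeriv m q r + δ * η₁ r) / r - (rnRadius m q r + δ * η r) / r ^ 2) =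
      rnRadiusDeriv m q r + δ * η₁ r := fun r hr => by
    field_simp
    ring
  refine ⟨isCompactEmbeddedMinimalSurface_sphere
    (c := fun r => (rnRadius m q r + δ * η r) / r) ha (hpos _ ha).ne' (hd _ ha) ?_,
    fun S hS hmin => hmin.subset_sphere ha hpos hd (fun r hr => ?_) hS⟩
  · rw [hsum _ ha, rnRadiusDeriv_rnHorizon h.subextremal, (h.support_of_lt h.horizon_lt).2.1]
    simp
  · rw [hsum r (ha.trans hr)]
    exact hmono r hr

theorem hasADMMass (h : IsPerturbationProfile m q b b' η η₁ η₂ χ) :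
    (perturbedData m q η χ K δ).HasADMMass m := by
  refine (tendsto_rn_mass (m := m) (q := q)).congr' ?_
  filter_upwards [eventually_gt_atTop (max 0 b')] with r hr
  have hr0 : 0 < r := (le_max_left _ _).trans_lt hr
  obtain ⟨h0, h1, -⟩ := h.support_of_gt ((le_max_right _ _).trans_lt hr)
  rw [perturbedData_metric, admIntegral_conformalMetric hr0
    (hasDerivAt_profile_div (S₁ := fun r => rnRadiusDeriv m q r + δ * η₁ r) hr0
      (h.hasDerivAt_radius δ r hr0))]
  simp only [h0, h1, mul_zero, add_zero]

theorem hasTotalCharge (h : IsPerturbationProfile m q b b' η η₁ η₂ χ) (hδ : 0 ≤ δ) :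
    (perturbedData m q η χ K δ).HasTotalCharge |q| := by
  refine ⟨q, 0, ?_, ?_, by simp [Real.sqrt_sq_eq_abs]⟩
  · refine tendsto_const_nhds.congr' ?_
    filter_upwards [eventually_gt_atTop (max 0 b')] with r hr
    have hr0 : 0 < r := (le_max_left _ _).trans_lt hr
    obtain ⟨h0, -, -, h1⟩ := h.support_of_gt ((le_max_right _ _).trans_lt hr)
    have hs := rnRadius_pos h.subextremal hr0
    rw [perturbedData_metric, sphereCharge_conformalMetric (e := q / rnRadius m q r ^ 3)
      (c := fun r => (rnRadius m q r + δ * η r) / r) hr0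
      (div_pos (h.radius_pos hδ r hr0) hr0) fun x hx => ?_]
    · simp only [h0, mul_zero, add_zero]
      field_simp
    · simp [perturbedData, hx, h1]
  · refine tendsto_const_nhds.congr' ?_
    filter_upwards [eventually_gt_atTop 0] with r hr0
    rw [perturbedData_metric, sphereCharge_conformalMetric (e := 0)
      (c := fun r => (rnRadius m q r + δ * η r) / r) hr0
      (div_pos (h.radius_pos hδ r hr0) hr0) fun x hx => ?_]
    · simp
    · simp [perturbedData]

/-- For `E = e x` one has `|E|² = e² S²`; multiplication with `S⁴/2` turns the condition into
`henergy`. -/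
theorem chargedDominantEnergyCondition (h : IsPerturbationProfile m q b b' η η₁ η₂ χ)
    (hδ : 0 ≤ δ) {a : ℝ} (ha : 0 < a)
    (henergy : ∀ r, 0 < r → ((1 - K * δ * χ r) * (q / rnRadius m q r ^ 3)) ^ 2 *
      (rnRadius m q r + δ * η r) ^ 6 ≤ curvatureCharge r (rnRadius m q r + δ * η r)
        (rnRadiusDeriv m q r + δ * η₁ r) (rnRadiusDerivTwo m q r + δ * η₂ r)) :
    (perturbedData m q η χ K δ).ChargedDominantEnergyCondition a := by
  intro x hx
  have hr : 0 < ‖x‖ := ha.trans_le hx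
  have hS := h.radius_pos hδ _ hr
  have he := henergy _ hr
  simp only [perturbedData, gInner_conformalMetric]
  rw [scalarCurvature_profile (h.radius_pos hδ) (h.hasDerivAt_radius δ)
    (h.hasDerivAt_radius_two δ) (norm_pos_iff.1 hr), inner_zero_right, mul_zero, add_zero,
    inner_smul_left, inner_smul_right, real_inner_self_eq_norm_sq, conj_trivial,
    le_div_iff₀ (pow_pos hS 4)]
  refine le_trans (le_of_eq ?_) (mul_le_mul_of_nonneg_left he (by norm_num))
  field_simp

/-- Beyond `b'` the densitized field `√(det g) E` is the Coulomb field `q x/|x|³`. -/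
theorem hasCompactlySupportedDivergence (h : IsPerturbationProfile m q b b' η η₁ η₂ χ)
    (hδ : 0 ≤ δ) {a : ℝ} (ha : 0 < a) :
    InitialData.HasCompactlySupportedDivergence (perturbedData m q η χ K δ).metric
      (perturbedData m q η χ K δ).electric a := by
  rw [perturbedData_metric]
  refine ⟨Metric.closedBall 0 b', isCompact_closedBall 0 b', fun x hx hxK => ?_⟩
  have hr : 0 < ‖x‖ := ha.trans_le hx
  have hxb : b' < ‖x‖ := by simpa using hxK
  refine divergence_conformalMetric_eq_zero (q := q)
    (c := fun r => (rnRadius m q r + δ * η r) / r) (norm_pos_iff.1 hr) ?_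
  filter_upwards [eventually_norm_gt hr, eventually_norm_gt hxb] with y hy0 hy
  obtain ⟨h0, -, -, h1⟩ := h.support_of_gt hy
  have hs := rnRadius_pos h.subextremal hy0
  rw [volumeDensity_conformalMetric (c := fun r => (rnRadius m q r + δ * η r) / r)
    (div_pos (h.radius_pos hδ _ hy0) hy0).le]
  simp only [perturbedData, h0, h1, mul_zero, add_zero, sub_zero, one_mul, smul_smul]
  congr 1
  field_simp

theorem isPenroseDataWithCharges (h : IsPerturbationProfile m q b b' η η₁ η₂ χ) (hδ : 0 ≤ δ)
    (hmono : ∀ r, rnHorizon m q < r → 0 < rnRadiusDeriv m q r + δ * η₁ r)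
    (henergy : ∀ r, 0 < r → ((1 - K * δ * χ r) * (q / rnRadius m q r ^ 3)) ^ 2 *
      (rnRadius m q r + δ * η r) ^ 6 ≤ curvatureCharge r (rnRadius m q r + δ * η r)
        (rnRadiusDeriv m q r + δ * η₁ r) (rnRadiusDerivTwo m q r + δ * η₂ r)) :
    (perturbedData m q η χ K δ).IsPenroseDataWithCharges (rnHorizon m q) m |q|
      (m + Real.sqrt (m ^ 2 - q ^ 2)) := by
  have ha := rnHorizon_pos h.subextremal
  refine ⟨ha, h.isRegular hδ ha, h.isStronglyAsymptoticallyFlat hδ ha,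
    h.hasOutermostMinimalBoundary hδ hmono, add_pos_of_pos_of_nonneg h.mass_pos
    (Real.sqrt_nonneg _), ?_, h.hasADMMass, h.hasTotalCharge hδ,
    h.chargedDominantEnergyCondition hδ ha henergy, h.hasCompactlySupportedDivergence hδ ha,
    ⟨∅, isCompact_empty, fun x _ _ => by simp [divergence, perturbedData, pd]⟩⟩
  rw [perturbedData_metric, sphereArea_conformalMetric
    (c := fun r => (rnRadius m q r + δ * η r) / r) ha (div_pos (h.radius_pos hδ _ ha) ha),
    (h.support_of_lt h.horizon_lt).1, mul_zero, add_zero, mul_div_cancel₀ _ ha.ne',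
    rnRadius_rnHorizon h.subextremal]

/-- At a critical point of `η` with `η = 1` the perturbed geometry differs from every
Reissner-Nordström slice. -/
theorem not_areIsometric (h : IsPerturbationProfile m q b b' η η₁ η₂ χ) (hδ : 0 < δ) {r₀ : ℝ}
    (hr₀ : rnHorizon m q < r₀) (hη : η r₀ = 1) (hη₁ : η₁ r₀ = 0) {m' q' : ℝ} (hqm' : |q'| < m') :
    ¬ InitialData.AreIsometric (perturbedData m q η χ K δ).metric (rnHorizon m q)
      (reissnerNordstrom m' q').metric (rnHorizon m' q') := by
  intro hiso
  have ha := rnHorizon_pos h.subextremal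
  have ha' := rnHorizon_pos hqm'
  rw [reissnerNordstrom_metric, perturbedData_metric] at hiso
  obtain ⟨F, G, hFG⟩ := InitialData.AreIsometric.exists_isConformalIsometry ha hiso
  have key : ∀ r, rnHorizon m q < r → (r * (rnRadiusDeriv m q r + δ * η₁ r)) ^ 2 =
      (rnRadius m q r + δ * η r) ^ 2 - 2 * m' * (rnRadius m q r + δ * η r) + q' ^ 2 :=
    fun r hr => by
      have hr0 : 0 < r := ha.trans hr
      obtain ⟨ρ, hρ, h1, h2⟩ := hFG.exists_areaRadius_eq
        (c₁ := fun r => (rnRadiusDeriv m q r + δ * η₁ r) / r - (rnRadius m q r + δ * η r) / r ^ 2)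
        (c₁' := fun r => rnRadiusDeriv m' q' r / r - rnRadius m' q' r / r ^ 2)
        (fun r hr => div_pos (h.radius_pos hδ.le r hr) hr)
        (fun r hr => div_pos (rnRadius_pos hqm' hr) hr)
        (fun r hr => hasDerivAt_profile_div (S₁ := fun r => rnRadiusDeriv m q r + δ * η₁ r) hr
          (h.hasDerivAt_radius δ r hr))
        (fun r hr => hasDerivAt_profile_div hr (hasDerivAt_rnRadius hr)) ha ha' hr
      rw [mul_div_cancel₀ _ hρ.ne', mul_div_cancel₀ _ hr0.ne'] at h1
      have e1 : ρ * (rnRadius m' q' ρ / ρ + ρ * (rnRadiusDeriv m' q' ρ / ρ -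
          rnRadius m' q' ρ / ρ ^ 2)) = ρ * rnRadiusDeriv m' q' ρ := by field_simp; ring
      have e2 : r * ((rnRadius m q r + δ * η r) / r + r * ((rnRadiusDeriv m q r + δ * η₁ r) / r -
          (rnRadius m q r + δ * η r) / r ^ 2)) = r * (rnRadiusDeriv m q r + δ * η₁ r) := by
        field_simp
        ring
      rw [e1, e2] at h2
      rw [← h2, ← h1, mul_rnRadiusDeriv_sq hρ]
  have hfar : ∀ r, 0 < r → rnHorizon m q < r → b' < r →
      -2 * m * rnRadius m q r + q ^ 2 = -2 * m' * rnRadius m q r + q' ^ 2 := fun r hr0 hr hrb => by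
    have h1 := key r hr
    obtain ⟨h2, h3, -⟩ := h.support_of_gt hrb
    rw [h2, h3, mul_zero, add_zero, add_zero, mul_rnRadiusDeriv_sq hr0] at h1
    linarith
  set R := max (rnHorizon m q) b' + 1 with hR
  have hRa : rnHorizon m q < R := by linarith [le_max_left (rnHorizon m q) b']
  have hRb : b' < R := by linarith [le_max_right (rnHorizon m q) b']
  have hR0 : 0 < R := ha.trans hRa
  have hm := h.mass_pos
  have hsR := add_le_rnRadius h.subextremal hR0
  have hs0 : 0 < rnRadius m q R := by linarith
  have hsR' := add_le_rnRadius h.subextremal hs0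
  have f1 := hfar R hR0 hRa hRb
  -- The area radius at `R` is reused as a second isotropic radius: it exceeds `R`, and the area
  -- radius there is larger still. Two different area radii separate `m'` from `q'²`.
  have f2 := hfar (rnRadius m q R) hs0 (by linarith) (by linarith)
  have hmm : m' = m := by
    have : (m' - m) * (rnRadius m q (rnRadius m q R) - rnRadius m q R) = 0 := by linarith
    rcases mul_eq_zero.1 this with h' | h' <;> linarith
  subst hmm
  have f3 := key r₀ hr₀
  have hr₀' : 0 < r₀ := ha.trans hr₀
  rw [hη, hη₁, mul_zero, add_zero, mul_one, mul_rnRadiusDeriv_sq hr₀'] at f3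
  have hs := add_le_rnRadius h.subextremal hr₀'
  -- Since `q'² = q²`, the relation at `r₀` would force `δ (2 (s - m) + δ) = 0`, although `s > m`.
  nlinarith [mul_pos hδ (by linarith : 0 < rnRadius m' q r₀ - m'), mul_pos hδ hδ]

end IsPerturbationProfile

/-! ### Choice of the bumps and conclusion. -/

theorem exists_smooth_bump (c : ℝ) {κ : ℝ} (hκ : 0 < κ) : ∃ f : ℝ → ℝ, ContDiff ℝ ∞ f ∧
    (∀ r, 0 ≤ f r ∧ f r ≤ 1) ∧ (∀ r, |r - c| ≤ κ / 2 → f r = 1) ∧ ∀ r, κ ≤ |r - c| → f r = 0 := by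
  let f : ContDiffBump c := ⟨κ / 2, κ, by positivity, by linarith⟩
  refine ⟨f, f.contDiff, fun r => ⟨f.nonneg, f.le_one⟩, fun r hr => ?_, fun r hr => ?_⟩
  · exact f.one_of_mem_closedBall (by rwa [Metric.mem_closedBall, Real.dist_eq])
  · exact f.zero_of_le_dist (by rwa [Real.dist_eq])

theorem exists_rnRadius_eq {m q s : ℝ} (h : |q| < m) (hs : m + Real.sqrt (m ^ 2 - q ^ 2) < s) :
    ∃ r, rnHorizon m q < r ∧ rnRadius m q r = s := by
  have ha := rnHorizon_pos h
  have hm : 0 < m := (abs_nonneg q).trans_lt h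
  rw [← rnRadius_rnHorizon h] at hs
  have h1 := add_le_rnRadius h ha
  have has : rnHorizon m q < s := by linarith
  have h2 := add_le_rnRadius h (ha.trans has)
  -- The number `s` itself serves as upper endpoint, because the area radius at isotropic radius `s`
  -- is at least `s + m`.
  obtain ⟨r, hr, hrs⟩ := intermediate_value_Icc has.le
    (continuousOn_rnRadius.mono fun r (hr : r ∈ Set.Icc (rnHorizon m q) s) => ha.trans_le hr.1)
    ⟨hs.le, by linarith⟩
  refine ⟨r, lt_of_le_of_ne hr.1 fun heq => ?_, hrs⟩
  rw [← heq] at hrs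
  exact hs.ne hrs

end Penrose

end

theorem proposition5 (m q r₁ r₂ : ℝ) (hq : q ≠ 0) (hqm : |q| < m)
    (h₁ : m + Real.sqrt (m ^ 2 - q ^ 2) < r₁) (h₁₂ : r₁ < r₂)
    (k : ℕ) (ε : ℝ) (hε : 0 < ε) :
    ∃ D : InitialData,
      (∀ x, D.magnetic x = 0) ∧
      D.IsSphericallySymmetric (rnHorizon m q) ∧
      (∀ x ∈ exterior (rnHorizon m q), rnAreaRadius m q x ∉ Set.Ioo r₁ r₂ →
        D.metric x = (reissnerNordstrom m q).metric x ∧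
        D.electric x = (reissnerNordstrom m q).electric x) ∧
      D.IsCkClose (reissnerNordstrom m q) (rnHorizon m q) k ε ∧
      (∀ m' q' : ℝ, |q'| < m' →
        ¬ InitialData.AreIsometric D.metric (rnHorizon m q)
          (reissnerNordstrom m' q').metric (rnHorizon m' q')) ∧
      ∃ ρ : ℝ, D.IsPenroseDataWithCharges (rnHorizon m q) m |q| ρ ∧
        |q| ≤ ρ ∧ m = 1 / 2 * (ρ + |q| ^ 2 / ρ) := by
  obtain ⟨c, hc, hcs⟩ := exists_rnRadius_eq (s := (r₁ + r₂) / 2) hqm (by linarith)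
  have hc0 : 0 < c := (rnHorizon_pos hqm).trans hc
  obtain ⟨κ, hκ, hball⟩ : ∃ κ : ℝ, 0 < κ ∧ ∀ r, |r - c| < 4 * κ →
      rnHorizon m q < r ∧ rnRadius m q r ∈ Set.Ioo r₁ r₂ := by
    have hev : ∀ᶠ r in 𝓝 c, rnHorizon m q < r ∧ rnRadius m q r ∈ Set.Ioo r₁ r₂ :=
      Filter.Eventually.and (Ioi_mem_nhds hc) ((hasDerivAt_rnRadius hc0).continuousAt.eventually
        (Ioo_mem_nhds (by rw [hcs]; linarith) (by rw [hcs]; linarith)))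
    obtain ⟨ν, hν, hνb⟩ := Metric.eventually_nhds_iff.1 hev
    exact ⟨ν / 4, by positivity, fun r hr => hνb (by rw [Real.dist_eq]; linarith)⟩
  obtain ⟨η, hηs, hη01, hη1, hη0⟩ := exists_smooth_bump c hκ
  -- A wider bump, equal to 1 on the whole support of `η`: near the edge of that support `η` is no
  -- substitute, since its derivatives are not controlled by its values.
  obtain ⟨χ, hχs, hχ01, hχ1, hχ0⟩ := exists_smooth_bump c (κ := 2 * κ) (by positivity)
  have hη's : ContDiff ℝ ∞ (deriv η) := (contDiff_infty_iff_deriv.1 hηs).2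
  have hη''s : ContDiff ℝ ∞ (deriv (deriv η)) := (contDiff_infty_iff_deriv.1 hη's).2
  have hIcc : ∀ r t, r ∈ Set.Icc (c - t) (c + t) ↔ |r - c| ≤ t := fun r t => by
    rw [abs_le, Set.mem_Icc]
    constructor <;> rintro ⟨h1, h2⟩ <;> constructor <;> linarith
  have hηsupp : ∀ r, r ∉ Set.Icc (c - κ) (c + κ) →
      η r = 0 ∧ deriv η r = 0 ∧ deriv (deriv η) r = 0 := fun r hr => by
    rw [hIcc, not_le] at hr
    have hev : η =ᶠ[𝓝 r] fun _ => 0 := by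
      have : ∀ᶠ t in 𝓝 r, κ < |t - c| :=
        (isOpen_lt continuous_const
          (by fun_prop : Continuous fun t => |t - c|)).eventually_mem hr
      filter_upwards [this] with t ht using hη0 t ht.le
    have hev1 : deriv η =ᶠ[𝓝 r] fun _ => 0 := by simpa using hev.deriv
    exact ⟨hev.eq_of_nhds, hev1.eq_of_nhds, by simpa using hev1.deriv_eq⟩
  have hsubset : Set.Icc (c - κ) (c + κ) ⊆ Set.Icc (c - 2 * κ) (c + 2 * κ) :=
    Set.Icc_subset_Icc (by linarith) (by linarith)
  have hprofile : IsPerturbationProfile m q (c - 2 * κ) (c + 2 * κ) η (deriv η)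
      (deriv (deriv η)) χ := by
    refine ⟨hqm, (hball _ ?_).1, hηs, hχs,
      fun r => (hηs.differentiable (by simp) r).hasDerivAt,
      fun r => (hη's.differentiable (by simp) r).hasDerivAt, hη''s.continuous, fun r hr => ?_,
      fun r => (hη01 r).1⟩
    · rw [sub_sub_cancel_left, abs_neg, abs_of_pos (by positivity)]
      linarith
    · obtain ⟨h0, h1, h2⟩ := hηsupp r fun h => hr (hsubset h)
      rw [hIcc, not_le] at hr
      exact ⟨h0, h1, h2, hχ0 r hr.le⟩
  -- The constants are computed on the support interval `c ± κ` of `η`, where `χ = 1`, whereas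
  -- `hprofile` uses the interval `c ± 2κ` that also contains the support of `χ`.
  obtain ⟨K, δ₀, hδ₀, hconst⟩ := exists_perturbation_constants (b := c - κ) (b' := c + κ) hq hqm
    (hball _ (by rw [sub_sub_cancel_left, abs_neg, abs_of_pos hκ]; linarith)).1
    hηs.continuous hη's.continuous hη''s.continuous hηsupp hη01 hχ01 fun r hr => hχ1 r (by
      rw [hIcc] at hr
      linarith)
  obtain ⟨δ₁, hδ₁, hclose⟩ := hprofile.exists_isCkClose (rnHorizon m q) K k hε
  have hδ : 0 < min δ₀ δ₁ := lt_min hδ₀ hδ₁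
  obtain ⟨hmono, henergy⟩ := hconst _ hδ (min_le_left _ _)
  have hsqrt : 0 ≤ Real.sqrt (m ^ 2 - q ^ 2) := Real.sqrt_nonneg _
  have hm := hprofile.mass_pos
  refine ⟨perturbedData m q η χ K (min δ₀ δ₁), fun _ => rfl,
    perturbedData_isSphericallySymmetric _ _ _ _ _ _ _, fun x _ hxr => ?_,
    hclose _ hδ (min_le_right _ _), fun m' q' hqm' => ?_, m + Real.sqrt (m ^ 2 - q ^ 2),
    hprofile.isPenroseDataWithCharges hδ.le hmono henergy, by linarith, ?_⟩
  · refine hprofile.eq_reissnerNordstrom fun hx => hxr (hball ‖x‖ ?_).2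
    rw [hIcc] at hx
    linarith
  · refine hprofile.not_areIsometric hδ hc (hη1 c (by rw [sub_self, abs_zero]; positivity)) ?_ hqm'
    have hev : η =ᶠ[𝓝 c] fun _ => 1 := by
      filter_upwards [Metric.ball_mem_nhds c (half_pos hκ)] with t ht
      rw [Metric.mem_ball, Real.dist_eq] at ht
      exact hη1 t ht.le
    simpa using hev.deriv_eq
  · have hpos : 0 < m + Real.sqrt (m ^ 2 - q ^ 2) := by linarith
    have h2 := Real.sq_sqrt (sq_sub_sq_pos hqm).le
    rw [sq_abs]
    field_simp
    -- The horizon radius `ρ = m + √(m² - q²)` is a root of `ρ² - 2mρ + q² = 0`.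
    linear_combination -h2
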